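/- Let $\Omega\subset\mathbb R^d$ be a bounded open set, $T>0$, $\kappa>0$, and let $A$ be the Laplacian on $L^2=L^2(\Omega)$ (real-valued) with zero boundary condition, i.e. $D(A)=\{v\in H^1_0(\Omega):\Delta v\in L^2(\Omega)\}$, $Av=\Delta v$ (weak Laplacian). Let $\alpha:[0,T]\to(1,2)$ be three times differentiable with $|\alpha'|+|\alpha''|+|\alpha'''|\le L$ on $[0,T]$ for some constant $L$, and put $\alpha_0=\alpha(0)$. Write $(k*q)(t)=\int_0^t k(t-s)q(s)\,ds$, $\beta_\mu(t)=t^{\mu-1}/\Gamma(\mu)$, and let $$g(t)=\int_0^1\frac{(tz)^{\alpha_0-\alpha(tz)}}{\Gamma(\alpha_0-1)\Gamma(2-\alpha(tz))}(1-z)^{\alpha_0-2}z^{1-\alpha_0}\,dz ,$$ so that, for $t>0$, $g=\beta_{\alpha_0-1}*k$ with $k(t)=t^{1-\alpha(t)}/\Gamma(2-\alpha(t))$. For $f\in C([0,T];L^2)$ and $u_0,\bar u_0\in L^2$, a function $u\in C([0,T];L^2)$ is called a mild solution of the variable-exponent fractional diffusion-wave problem $k*\partial_t^2u-\kappa Au=f$,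 $u(0)=u_0$, $\partial_tu(0)=\bar u_0$, $u|_{\partial\Omega}=0$, if for every $t\in[0,T]$ one has $(\beta_{\alpha_0}*u)(t)\in D(A)$ and $$u(t)-u_0-\kappa A(\beta_{\alpha_0}*u)(t)=(\beta_{\alpha_0}*f)(t)-\big(g'*(u-u_0)\big)(t)+(\beta_1*g)(t)\,\bar u_0 .$$ **Theorem.** There is a constant $Q>0$, depending only on $\Omega,T,\kappa,\alpha$, such that for all $f\in C([0,T];L^2)$ and $u_0,\bar u_0\in L^2$ the problem has a unique mild solution $u\in C([0,T];L^2)$, and it satisfies $$\|u\|_{C([0,T];L^2)}\le Q\big(\|f\|_{C([0,T];L^2)}+\|u_0\|_{L^2}+\|\bar u_0\|_{L^2}\big).$$ -/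

import Mathlib

open MeasureTheory Set Filter Topology
open scoped ContDiff RealInnerProductSpace

noncomputable section

namespace DiffusionWave

/-- The Euclidean space `ℝ^d`. -/
abbrev E (d : ℕ) : Type := EuclideanSpace ℝ (Fin d)

/-- The real Hilbert space `L²(Ω)`. -/
abbrev L2 {d : ℕ} (Ω : Set (E d)) : Type :=
  Lp ℝ 2 ((volume : Measure (E d)).restrict Ω)

/-- Square integrable vector fields on `Ω`. -/
abbrev L2Field {d : ℕ} (Ω : Set (E d)) : Type :=
  Lp (E d) 2 ((volume : Measure (E d)).restrict Ω)

/-- `C([0,T]; X)`, with the supremum norm. -/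
abbrev CT (T : ℝ) (X : Type) [NormedAddCommGroup X] : Type := C(Icc (0 : ℝ) T, X)

/-! ### The Dirichlet Laplacian on `L²(Ω)` -/

/-- `φ ∈ C₀^∞(Ω)`: smooth with compact support contained in `Ω`. -/
def IsTest {d : ℕ} (Ω : Set (E d)) (φ : E d → ℝ) : Prop :=
  ContDiff ℝ ∞ φ ∧ HasCompactSupport φ ∧ tsupport φ ⊆ Ω

/-- `v ∈ H¹(Ω)` with weak gradient `G`. -/
def HasWeakGradient {d : ℕ} (Ω : Set (E d)) (v : L2 Ω) (G : L2Field Ω) : Prop :=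
  ∀ φ : E d → ℝ, IsTest Ω φ →
    ∀ i : Fin d, ∫ x in Ω, v x * gradient φ x i = -∫ x in Ω, G x i * φ x

/-- `v ∈ H¹₀(Ω)` with weak gradient `G`: `v ∈ H¹(Ω)` is the limit in the `H¹` norm of functions
in `C₀^∞(Ω)`. -/
def MemH10 {d : ℕ} (Ω : Set (E d)) (v : L2 Ω) (G : L2Field Ω) : Prop :=
  HasWeakGradient Ω v G ∧
    ∃ φ : ℕ → E d → ℝ, (∀ n, IsTest Ω (φ n)) ∧
      Tendsto (fun n => eLpNorm (fun x => v x - φ n x) 2 (volume.restrict Ω)) atTop (𝓝 0) ∧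
      Tendsto (fun n => eLpNorm (fun x => G x - gradient (φ n) x) 2 (volume.restrict Ω))
        atTop (𝓝 0)

/-- The graph of the Laplacian `A` on `L²(Ω)` with zero boundary condition:
`v ∈ D(A)` and `A v = w`, that is, `v ∈ H¹₀(Ω)` and its weak Laplacian is `w ∈ L²(Ω)`. -/
def IsDirichletLaplacian {d : ℕ} (Ω : Set (E d)) (v w : L2 Ω) : Prop :=
  ∃ G : L2Field Ω, MemH10 Ω v G ∧
    ∀ φ : E d → ℝ, IsTest Ω φ → ∫ x in Ω, ⟪G x, gradient φ x⟫ = -∫ x in Ω, w x * φ x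

/-! ### Convolutions and kernels -/

/-- `(k * q)(t) = ∫₀ᵗ k(t-s) q(s) ds` for a scalar kernel `k`. -/
def conv {X : Type} [NormedAddCommGroup X] [NormedSpace ℝ X]
    (k : ℝ → ℝ) (q : ℝ → X) (t : ℝ) : X :=
  ∫ s in (0 : ℝ)..t, k (t - s) • q s

/-- `β_μ(t) = t^(μ-1) / Γ(μ)`. -/
def beta (μ t : ℝ) : ℝ := t ^ (μ - 1) / Real.Gamma μ

/-- The variable-exponent Abel kernel `k(t) = t^(1-α(t)) / Γ(2-α(t))`. -/
def abelKernel (α : ℝ → ℝ) (t : ℝ) : ℝ := t ^ (1 - α t) / Real.Gamma (2 - α t)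

/-- The generalized identity function `g`, with `g(0) = 1` and `g = β_{α(0)-1} * k` on `(0,T]`;
see `conv_beta_abelKernel`. -/
def genId (α : ℝ → ℝ) (t : ℝ) : ℝ :=
  ∫ z in (0 : ℝ)..1,
    (t * z) ^ (α 0 - α (t * z)) / (Real.Gamma (α 0 - 1) * Real.Gamma (2 - α (t * z)))
      * (1 - z) ^ (α 0 - 2) * z ^ (1 - α 0)

theorem conv_beta_abelKernel (α : ℝ → ℝ) {t : ℝ} (ht : 0 < t) :
    conv (beta (α 0 - 1)) (abelKernel α) t = genId α t := by
  have h := intervalIntegral.smul_integral_comp_mul_left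
    (fun s => beta (α 0 - 1) (t - s) • abelKernel α s) t (a := 0) (b := 1)
  simp only [mul_zero, mul_one] at h
  unfold conv genId
  rw [← h, ← intervalIntegral.integral_smul]
  refine intervalIntegral.integral_congr_ae (Eventually.of_forall fun z hz => ?_)
  rw [uIoc_of_le zero_le_one] at hz
  obtain ⟨hz0, hz1⟩ := hz
  have hs : 0 < t * z := mul_pos ht hz0
  have e1 : t - t * z = t * (1 - z) := by ring
  have e2 : (t * z) ^ (1 - α (t * z))
      = (t * z) ^ (α 0 - α (t * z)) * (t ^ (1 - α 0) * z ^ (1 - α 0)) := by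
    rw [← Real.mul_rpow ht.le hz0.le, ← Real.rpow_add hs]
    ring_nf
  have e3 : t * (t ^ (α 0 - 2) * t ^ (1 - α 0)) = 1 := by
    rw [← Real.rpow_add ht, show α 0 - 2 + (1 - α 0) = -1 by ring, Real.rpow_neg_one,
      mul_inv_cancel₀ ht.ne']
  simp only [beta, abelKernel, smul_eq_mul]
  rw [e1, e2, show α 0 - 1 - 1 = α 0 - 2 by ring, Real.mul_rpow ht.le (by linarith)]
  calc _ = (t * (t ^ (α 0 - 2) * t ^ (1 - α 0))) *
        ((t * z) ^ (α 0 - α (t * z)) / (Real.Gamma (α 0 - 1) * Real.Gamma (2 - α (t * z)))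
          * (1 - z) ^ (α 0 - 2) * z ^ (1 - α 0)) := by
        rw [div_mul_div_comm]; ring
    _ = _ := by rw [e3, one_mul]

/-! ### Mild solutions -/

/-- The standing assumption on the exponent: `1 < α < 2` on `[0,T]`, and `α` is three times
differentiable on `[0,T]` with `|α'| + |α''| + |α'''| ≤ L`. -/
structure IsExponent (T L : ℝ) (α : ℝ → ℝ) : Prop where
  mem : ∀ t ∈ Icc (0 : ℝ) T, 1 < α t ∧ α t < 2
  diff : ∀ i < 3, DifferentiableOn ℝ (iteratedDerivWithin i α (Icc (0 : ℝ) T)) (Icc (0 : ℝ) T)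
  bound : ∀ t ∈ Icc (0 : ℝ) T,
    |iteratedDerivWithin 1 α (Icc (0 : ℝ) T) t| + |iteratedDerivWithin 2 α (Icc (0 : ℝ) T) t|
      + |iteratedDerivWithin 3 α (Icc (0 : ℝ) T) t| ≤ L

/-- The right-hand side
`P_u = β_{α(0)} * f - g' * (u - u₀) + (β_1 * g) ū₀`. Functions on `[0,T]` are extended to `ℝ` by
constants; only their values on `[0,t]` enter for `t ∈ [0,T]`. -/
def rhsP {d : ℕ} {Ω : Set (E d)} {T : ℝ} (hT : 0 ≤ T) (α : ℝ → ℝ)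
    (f : CT T (L2 Ω)) (u₀ ubar₀ : L2 Ω) (u : CT T (L2 Ω)) (t : ℝ) : L2 Ω :=
  conv (beta (α 0)) (IccExtend hT f) t
    - conv (deriv (genId α)) (fun s => IccExtend hT u s - u₀) t
    + conv (beta 1) (genId α) t • ubar₀

/-- `u ∈ C([0,T]; L²(Ω))` is a mild solution: for all `t ∈ [0,T]`, `(β_{α(0)} * u)(t) ∈ D(A)` and
`u(t) - u₀ - κ A (β_{α(0)} * u)(t) = P_u(t)`. -/
def IsMildSolution {d : ℕ} {Ω : Set (E d)} {T : ℝ} (hT : 0 ≤ T) (κ : ℝ) (α : ℝ → ℝ)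
    (f : CT T (L2 Ω)) (u₀ ubar₀ : L2 Ω) (u : CT T (L2 Ω)) : Prop :=
  ∀ t : Icc (0 : ℝ) T, ∃ w : L2 Ω,
    IsDirichletLaplacian Ω (conv (beta (α 0)) (IccExtend hT u) t) w ∧
      u t - u₀ - κ • w = rhsP hT α f u₀ ubar₀ u t

end DiffusionWave

end

/-! Put `a = α 0 - 1`, which lies in `(0,1)`, and `γ = g'`. Since `β_{1+a} = 1 * β_a`, the mild
formulation reads `u - κ A (β_{1+a} * u) + γ * u = u₀ + ∫₀ᵗ F` with `F = g' u₀ + β_a * f + g ū₀`: a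
Volterra equation with an unbounded operator. The only facts needed about `g` are that `g` and `g'`
are integrable on `(0,T]`; they come from `|g| ≤ C` and `|g'| ≤ C t^(-1/2)` (`genId_bound`,
`isKernel_deriv_genId`).

The heart is an a priori bound that does not see the size of `-κ A`. Replace `-κ A` by a bounded
symmetric positive `B`. Then `v = y + γ * y` solves `v' + B (β_a * y) = F`, and pairing with `exp
(-2σt) v` leaves the memory form `∫ exp (-2σt) ⟪B (β_a * y), y + γ * y⟫`. Diagonalizing `B` on
finite-dimensional subspaces makes this form scalar, and Plancherel shows that it is nonnegative:
the transform of `exp (-σt) β_a` is `(σ + iω)^(-a)`, which lies in the sector `|arg| ≤ aπ/2`, and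
for large `σ` the weighted kernel `γ` has too little `L¹` mass to push it out of the right
half-plane (`integral_inner_conv_nonneg`). The resulting bound `energy_integrable` has a constant
independent of `B`.

The Laplacian enters only through `R = (1 - A)⁻¹`, obtained by orthogonal projection onto `H¹₀`: `R`
is symmetric, injective and satisfies `‖R x‖² ≤ ⟪R x, x⟫`. The operators `κ (1 - R) (R + 1/(n+1))⁻¹`
are bounded, symmetric, positive and approximate `-κ A`. The uniform bound yields uniqueness
(`memorySolution_unique`), existence for data in the range of `R²` by a Cauchy argument
(`exists_memorySolution_sq`), and then all data by density (`memory_wellPosed`). -/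

noncomputable section

namespace DiffusionWave

open scoped Convolution

/-! ### Convolution on `[0,T]` as a convolution on the line. -/

section Conv

variable {X : Type} [NormedAddCommGroup X] [NormedSpace ℝ X]

/-- The causal extension of a function on `(0,T]` by zero. -/
def causal {Y : Type} [Zero Y] (T : ℝ) (f : ℝ → Y) : ℝ → Y := indicator (Ioc 0 T) f

theorem conv_comm_left (k : ℝ → ℝ) (q : ℝ → X) (t : ℝ) :
    conv k q t = ∫ s in (0 : ℝ)..t, k s • q (t - s) := by
  have := intervalIntegral.integral_comp_sub_left (a := 0) (b := t)
    (fun s => k s • q (t - s)) t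
  simp only [sub_sub_cancel, sub_self, sub_zero] at this
  exact this

theorem conv_mul_comm (k l : ℝ → ℝ) (t : ℝ) : conv k l t = conv l k t := by
  rw [conv_comm_left]
  simp only [conv, smul_eq_mul, mul_comm]

theorem conv_congr {k l : ℝ → ℝ} {q p : ℝ → X} {t : ℝ} (ht : 0 ≤ t)
    (hk : ∀ s ∈ Ioo 0 t, k s = l s) (hq : ∀ s ∈ Ioo 0 t, q s = p s) :
    conv k q t = conv l p t := by
  unfold conv
  rw [intervalIntegral.integral_of_le ht, intervalIntegral.integral_of_le ht,
    integral_Ioc_eq_integral_Ioo, integral_Ioc_eq_integral_Ioo]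
  refine setIntegral_congr_fun measurableSet_Ioo fun s hs => ?_
  have h1 : t - s ∈ Ioo 0 t := ⟨by linarith [hs.2], by linarith [hs.1]⟩
  simp only [hk _ h1, hq _ hs]

theorem conv_eq_convolution {T t : ℝ} (k : ℝ → ℝ) (q : ℝ → X) (ht : 0 ≤ t) (htT : t ≤ T) :
    conv k q t = (causal T k ⋆[ContinuousLinearMap.lsmul ℝ ℝ, volume] causal T q) t := by
  rw [convolution_eq_swap]
  unfold conv
  rw [intervalIntegral.integral_of_le ht, integral_Ioc_eq_integral_Ioo,
    ← integral_indicator measurableSet_Ioo]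
  congr 1
  ext s
  simp only [causal, indicator, mem_Ioo, mem_Ioc, ContinuousLinearMap.lsmul_apply]
  by_cases h1 : 0 < s <;> by_cases h2 : s < t
  · have : s ≤ T := by linarith
    have h3 : t - s ≤ T := by linarith
    simp [h1, h2, this, h3]
  · simp [h2]
  · simp [h1]
  · simp [h1]

theorem convolution_causal_eq_zero {T t : ℝ} (k : ℝ → ℝ) (q : ℝ → X) (ht : t ≤ 0) :
    (causal T k ⋆[ContinuousLinearMap.lsmul ℝ ℝ, volume] causal T q) t = 0 := by
  unfold convolution
  rw [integral_eq_zero_of_ae (Eventually.of_forall fun s => ?_)]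
  simp only [causal, indicator, mem_Ioc, ContinuousLinearMap.lsmul_apply, Pi.zero_apply]
  by_cases h1 : 0 < s
  · have : ¬ (s < t) := by linarith
    simp [this]
  · simp [h1]

theorem integrable_causal {Y : Type} [NormedAddCommGroup Y] {T : ℝ} {f : ℝ → Y}
    (hf : IntegrableOn f (Ioc 0 T)) : Integrable (causal T f) :=
  (integrable_indicator_iff measurableSet_Ioc).2 hf

theorem norm_conv_le {T t : ℝ} {k : ℝ → ℝ} {q : ℝ → X} (hk : IntegrableOn k (Ioc 0 T))
    (ht : 0 ≤ t) (htT : t ≤ T) {M : ℝ} (hM : ∀ s ∈ Ioc 0 t, ‖q s‖ ≤ M) (hM0 : 0 ≤ M) :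
    ‖conv k q t‖ ≤ (∫ s in Ioc 0 T, |k s|) * M := by
  have hkt : IntegrableOn (fun s => |k s|) (Ioc 0 T) := hk.abs
  rw [conv_comm_left, intervalIntegral.integral_of_le ht, ← integral_mul_const]
  refine (norm_integral_le_of_norm_le ((hkt.mono_set (Ioc_subset_Ioc_right htT)).mul_const M)
    ?_).trans (setIntegral_mono_set (hkt.mul_const M) ?_ ?_)
  · have : ∀ᵐ s ∂(volume.restrict (Ioo 0 t)), ‖k s • q (t - s)‖ ≤ |k s| * M := by
      filter_upwards [ae_restrict_mem measurableSet_Ioo] with s hs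
      rw [norm_smul, Real.norm_eq_abs]
      exact mul_le_mul_of_nonneg_left (hM _ ⟨by linarith [hs.2], by linarith [hs.1]⟩) (abs_nonneg _)
    rwa [← restrict_Ioo_eq_restrict_Ioc]
  · exact Eventually.of_forall fun s => mul_nonneg (abs_nonneg _) hM0
  · exact (Ioc_subset_Ioc_right htT).eventuallyLE

/-- Associativity is inherited from the convolution of the causal extensions on `ℝ`. Two integrable
kernels convolve only almost everywhere, but boundedness of `q` makes the triple integral converge
absolutely at every `t`. -/
theorem conv_conv [CompleteSpace X] {T t : ℝ} {k l : ℝ → ℝ} {q : ℝ → X}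
    (hk : IntegrableOn k (Ioc 0 T))
    (hl : IntegrableOn l (Ioc 0 T)) (hq : IntegrableOn q (Ioc 0 T)) {M : ℝ}
    (hM : ∀ s ∈ Ioc 0 T, ‖q s‖ ≤ M) (ht : 0 ≤ t) (htT : t ≤ T) :
    conv k (conv l q) t = conv (conv k l) q t := by
  have hT : 0 ≤ T := ht.trans htT
  set k' := causal T k
  set l' := causal T l
  set q' := causal T q
  have hk' : Integrable k' := integrable_causal hk
  have hl' : Integrable l' := integrable_causal hl
  have hq' : Integrable q' := integrable_causal hq
  have hM' : ∀ s, ‖q' s‖ ≤ max M 0 := fun s => by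
    by_cases h : s ∈ Ioc 0 T
    · simpa [q', causal, h] using Or.inl (hM s h)
    · simp [q', causal, h]
  let L := ContinuousLinearMap.lsmul ℝ ℝ (E := X)
  let L' := ContinuousLinearMap.lsmul ℝ ℝ (E := ℝ)
  have key : ((k' ⋆[L', volume] l') ⋆[L, volume] q') t = (k' ⋆[L, volume] (l' ⋆[L, volume] q')) t := by
    refine convolution_assoc _ _ _ _ (fun x y z => mul_smul x y z) hk'.1 hl'.1 hq'.1 ?_ ?_ ?_
    · exact hk'.ae_convolution_exists L' hl'
    · exact hl'.norm.ae_convolution_exists _ hq'.norm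
    · refine (BddAbove.convolutionExistsAt' (ContinuousLinearMap.mul ℝ ℝ) (s := univ)
        (f := fun x => ‖k' x‖) ?_ MeasurableSet.univ ?_ ?_ ?_)
      · refine ⟨(∫ s, ‖l' s‖) * max M 0, ?_⟩
        rintro _ ⟨x, -, rfl⟩
        have : (fun x => ‖l' x‖) ⋆[ContinuousLinearMap.mul ℝ ℝ, volume] (fun x => ‖q' x‖)
            = fun x => ∫ s, ‖l' s‖ * ‖q' (x - s)‖ := rfl
        simp only [this]
        rw [← integral_mul_const]
        refine norm_integral_le_of_norm_le (hl'.norm.mul_const _) (Eventually.of_forall fun s => ?_)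
        rw [norm_mul, norm_norm, norm_norm]
        exact mul_le_mul_of_nonneg_left (hM' _) (norm_nonneg _)
      · simp
      · exact hk'.norm.integrableOn
      · rw [Measure.restrict_univ, Measure.map_sub_left_eq_self]
        exact (hl'.norm.integrable_convolution _ hq'.norm).1
  have e1 : conv (conv k l) q t = ((k' ⋆[L', volume] l') ⋆[L, volume] q') t := by
    rw [conv_congr ht (l := k' ⋆[L', volume] l') (fun s hs => conv_eq_convolution k l hs.1.le (hs.2.le.trans htT))
      (fun s _ => rfl), conv_eq_convolution (T := T) _ _ ht htT]
    rw [convolution_eq_swap, convolution_eq_swap]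
    congr 1
    ext s
    simp only [causal, indicator, mem_Ioc, q', L, ContinuousLinearMap.lsmul_apply]
    by_cases h1 : 0 < s
    · have : t - s ≤ T := by linarith
      by_cases h2 : 0 < t - s
      · simp [h2, this]
      · have := convolution_causal_eq_zero (T := T) k l (not_lt.1 h2)
        change (k' ⋆[L', volume] l') (t - s) = 0 at this
        simp [h2, this]
    · simp [h1]
  have e2 : conv k (conv l q) t = (k' ⋆[L, volume] (l' ⋆[L, volume] q')) t := by
    rw [conv_congr ht (p := l' ⋆[L, volume] q') (fun s _ => rfl)
      (fun s hs => conv_eq_convolution l q hs.1.le (hs.2.le.trans htT)),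
      conv_eq_convolution (T := T) _ _ ht htT]
    unfold convolution
    congr 1
    ext s
    by_cases h1 : 0 < s
    · have : t - s ≤ T := by linarith
      by_cases h2 : 0 < t - s
      · simp only [causal, indicator, mem_Ioc, h2, this, k', and_self, if_true]; rfl
      · have := convolution_causal_eq_zero (T := T) l q (not_lt.1 h2)
        change (l' ⋆[L, volume] q') (t - s) = 0 at this
        unfold convolution at this
        simp [causal, h2, this]
    · simp [causal, h1, k']
  rw [e1, e2, key]

theorem integrableOn_conv {T : ℝ} {k l : ℝ → ℝ} (hk : IntegrableOn k (Ioc 0 T))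
    (hl : IntegrableOn l (Ioc 0 T)) : IntegrableOn (conv k l) (Ioc 0 T) := by
  have := (integrable_causal hk).integrable_convolution (ContinuousLinearMap.lsmul ℝ ℝ) (integrable_causal hl)
  refine this.integrableOn.congr_fun (fun t ht => ?_) measurableSet_Ioc
  exact (conv_eq_convolution k l ht.1.le ht.2).symm

/-- Young's inequality in `L¹`; it controls the mass of the resolvent kernel below. -/
theorem setIntegral_abs_conv_le {T : ℝ} {k l : ℝ → ℝ} (hk : IntegrableOn k (Ioc 0 T))
    (hl : IntegrableOn l (Ioc 0 T)) :
    ∫ t in Ioc 0 T, |conv k l t| ≤ (∫ t in Ioc 0 T, |k t|) * ∫ t in Ioc 0 T, |l t| := by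
  have hk' := (integrable_causal hk).abs
  have hl' := (integrable_causal hl).abs
  have h := integral_convolution (ContinuousLinearMap.mul ℝ ℝ) hk' hl'
  have hi := hk'.integrable_convolution (ContinuousLinearMap.mul ℝ ℝ) hl'
  have e : ∀ m : ℝ → ℝ, ∫ t in Ioc 0 T, |m t| = ∫ t, |causal T m t| := fun m => by
    rw [← integral_indicator measurableSet_Ioc]
    congr 1; ext s
    by_cases hs : s ∈ Ioc 0 T <;> simp [causal, hs]
  have hnn : ∀ t, 0 ≤ ((fun x => |causal T k x|) ⋆[ContinuousLinearMap.mul ℝ ℝ, volume]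
      (fun x => |causal T l x|)) t := fun t =>
    integral_nonneg fun s => mul_nonneg (abs_nonneg _) (abs_nonneg _)
  rw [e k, e l]
  refine le_trans ?_ (h.le)
  refine le_trans (setIntegral_mono_on (integrableOn_conv hk hl).abs hi.integrableOn
    measurableSet_Ioc fun t ht => ?_) (setIntegral_le_integral hi (Eventually.of_forall hnn))
  rw [conv_eq_convolution (X := ℝ) k l ht.1.le ht.2]
  unfold convolution
  refine abs_integral_le_integral_abs.trans_eq ?_
  simp [abs_mul]

end Conv

/-! ### Convolution operators on `C([0,T]; X)` and bounded Volterra equations. -/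

section ConvCT

set_option linter.unusedSectionVars false

variable {X : Type} [NormedAddCommGroup X] [NormedSpace ℝ X] [CompleteSpace X] {T : ℝ}

/-- Scalar convolution kernels on `[0,T]`: functions integrable on `(0,T]`. -/
abbrev IsKernel (T : ℝ) (k : ℝ → ℝ) : Prop := IntegrableOn k (Ioc 0 T) volume

theorem norm_IccExtend_le (hT : 0 ≤ T) (q : CT T X) (s : ℝ) : ‖IccExtend hT q s‖ ≤ ‖q‖ :=
  q.norm_coe_le_norm _

theorem continuous_IccExtend (hT : 0 ≤ T) (q : CT T X) : Continuous (IccExtend hT q) :=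
  q.continuous.Icc_extend'

theorem conv_intervalIntegrable (hT : 0 ≤ T) {k : ℝ → ℝ} (hk : IsKernel T k)
    (q : CT T X) {t : ℝ} (ht : t ∈ Icc 0 T) :
    IntervalIntegrable (fun s => k s • IccExtend hT q (t - s)) volume 0 t := by
  rw [intervalIntegrable_iff_integrableOn_Ioc_of_le ht.1]
  refine Integrable.smul_bdd (f := fun s => IccExtend hT q (t - s))
    (hk.mono_set (Ioc_subset_Ioc_right ht.2)) ‖q‖ ?_ ?_
  · exact ((continuous_IccExtend hT q).comp (by fun_prop)).aestronglyMeasurable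
  · exact Eventually.of_forall fun s => norm_IccExtend_le hT q _

theorem conv_intervalIntegrable' (hT : 0 ≤ T) {k : ℝ → ℝ} (hk : IsKernel T k)
    (q : CT T X) {t : ℝ} (ht : t ∈ Icc 0 T) :
    IntervalIntegrable (fun s => k (t - s) • IccExtend hT q s) volume 0 t := by
  have := (conv_intervalIntegrable hT hk q ht).comp_sub_left t
  simp only [sub_sub_cancel, sub_zero, sub_self] at this
  exact this.symm

/-- Extending `q` by zero would create a jump at `0`, so `q 0` is split off: `q - q 0` extended by
constants is continuous and vanishes on the negative axis, which allows integration over the fixed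
set `(0,T]` and dominated convergence. The remaining term is a primitive of `k` times `q 0`. -/
theorem continuousOn_conv (hT : 0 ≤ T) {k : ℝ → ℝ} (hk : IsKernel T k) (q : CT T X) :
    ContinuousOn (conv k (IccExtend hT q)) (Icc 0 T) := by
  set Q := IccExtend hT q
  have hQ : Continuous Q := continuous_IccExtend hT q
  have hQ0 : ∀ s ≤ 0, Q s = Q 0 := fun s hs => by
    simp only [Q]
    rw [IccExtend_of_le_left _ _ hs, IccExtend_left]
  have h1 : Continuous fun t => ∫ s in Ioc 0 T, k s • (Q (t - s) - Q 0) := by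
    refine continuous_of_dominated (bound := fun s => |k s| * (2 * ‖q‖)) (fun t => ?_) (fun t => ?_)
      (hk.abs.mul_const _) ?_
    · exact hk.1.smul ((hQ.comp (by fun_prop)).sub continuous_const).aestronglyMeasurable
    · refine Eventually.of_forall fun s => ?_
      rw [norm_smul, Real.norm_eq_abs]
      refine mul_le_mul_of_nonneg_left ((norm_sub_le _ _).trans ?_) (abs_nonneg _)
      linarith [norm_IccExtend_le hT q (t - s), norm_IccExtend_le hT q 0]
    · exact Eventually.of_forall fun s => by fun_prop
  have h2 : ContinuousOn (fun t => (∫ s in (0 : ℝ)..t, k s) • Q 0) (Icc 0 T) := by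
    have := intervalIntegral.continuousOn_primitive_interval (μ := volume) (f := k) (a := 0) (b := T)
      (by rwa [uIcc_of_le hT, integrableOn_Icc_iff_integrableOn_Ioc])
    rw [uIcc_of_le hT] at this
    exact this.smul continuousOn_const
  refine (h1.continuousOn.add h2).congr fun t ht => ?_
  have hkt := hk.mono_set (Ioc_subset_Ioc_right ht.2)
  have e1 : ∫ s in Ioc 0 T, k s • (Q (t - s) - Q 0) = ∫ s in (0 : ℝ)..t, k s • (Q (t - s) - Q 0) := by
    rw [intervalIntegral.integral_of_le ht.1]
    refine (setIntegral_eq_of_subset_of_forall_sdiff_eq_zero measurableSet_Ioc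
      (Ioc_subset_Ioc_right ht.2) fun s hs => ?_)
    have : t - s ≤ 0 := by
      by_contra h
      exact hs.2 ⟨hs.1.1, by linarith⟩
    rw [hQ0 _ this, sub_self, smul_zero]
  change _ = (∫ s in Ioc 0 T, k s • (Q (t - s) - Q 0)) + (∫ s in (0 : ℝ)..t, k s) • Q 0
  rw [conv_comm_left, e1, ← intervalIntegral.integral_smul_const, ← intervalIntegral.integral_add]
  · simp [smul_sub]
  · simp_rw [smul_sub]
    refine (conv_intervalIntegrable hT hk q ht).sub ?_
    rw [intervalIntegrable_iff_integrableOn_Ioc_of_le ht.1]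
    exact hkt.smul_const _
  · rw [intervalIntegrable_iff_integrableOn_Ioc_of_le ht.1]
    exact hkt.smul_const _

theorem conv_add (hT : 0 ≤ T) {k : ℝ → ℝ} (hk : IsKernel T k) (q p : CT T X)
    {t : ℝ} (ht : t ∈ Icc 0 T) :
    conv k (IccExtend hT (q + p)) t = conv k (IccExtend hT q) t + conv k (IccExtend hT p) t := by
  unfold conv
  rw [← intervalIntegral.integral_add (conv_intervalIntegrable' hT hk q ht)
    (conv_intervalIntegrable' hT hk p ht)]
  simp only [← smul_add]
  rfl

/-- Convolution with an integrable scalar kernel, as an operator on `C([0,T]; X)`. -/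
def convCT (hT : 0 ≤ T) (k : ℝ → ℝ) (hk : IsKernel T k) (q : CT T X) : CT T X :=
  ⟨fun t => conv k (IccExtend hT q) t,
    continuousOn_iff_continuous_domRestrict.1 (continuousOn_conv hT hk q)⟩

theorem convCT_add (hT : 0 ≤ T) {k : ℝ → ℝ} (hk : IsKernel T k) (q p : CT T X) :
    convCT hT k hk (q + p) = convCT hT k hk q + convCT hT k hk p :=
  ContinuousMap.ext fun t => conv_add hT hk q p t.2

theorem convCT_sub (hT : 0 ≤ T) {k : ℝ → ℝ} (hk : IsKernel T k) (q p : CT T X) :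
    convCT hT k hk (q - p) = convCT hT k hk q - convCT hT k hk p := by
  rw [eq_sub_iff_add_eq, ← convCT_add, sub_add_cancel]

theorem convCT_apply (hT : 0 ≤ T) {k : ℝ → ℝ} (hk : IsKernel T k) (q : CT T X)
    (t : Icc (0 : ℝ) T) : convCT hT k hk q t = conv k (IccExtend hT q) t := rfl

theorem norm_convCT_le (hT : 0 ≤ T) {k : ℝ → ℝ} (hk : IsKernel T k) (q : CT T X) :
    ‖convCT hT k hk q‖ ≤ (∫ s in Ioc 0 T, |k s|) * ‖q‖ := by
  have h0 : 0 ≤ ∫ s in Ioc 0 T, |k s| := integral_nonneg fun _ => abs_nonneg _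
  refine (ContinuousMap.norm_le _ (by positivity)).2 fun t => ?_
  exact norm_conv_le hk t.2.1 t.2.2 (fun s _ => norm_IccExtend_le hT q s) (norm_nonneg _)

theorem convCT_comp (hT : 0 ≤ T) {k l : ℝ → ℝ} (hk : IsKernel T k)
    (hl : IsKernel T l) (q : CT T X) :
    convCT hT k hk (convCT hT l hl q) = convCT hT (conv k l) (integrableOn_conv hk hl) q := by
  ext t
  rw [convCT_apply, convCT_apply, ← conv_conv hk hl
    ((continuous_IccExtend hT q).integrableOn_Ioc) (fun s _ => norm_IccExtend_le hT q s) t.2.1 t.2.2]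
  refine conv_congr t.2.1 (fun s _ => rfl) fun s hs => ?_
  rw [IccExtend_of_mem _ _ ⟨hs.1.le, hs.2.le.trans t.2.2⟩]
  rfl

theorem convCT_congr (hT : 0 ≤ T) {k l : ℝ → ℝ} (hk : IsKernel T k)
    (hl : IsKernel T l) (h : ∀ s ∈ Ioo 0 T, k s = l s) (q : CT T X) :
    convCT hT k hk q = convCT hT l hl q := by
  ext t
  exact conv_congr t.2.1 (fun s hs => h s ⟨hs.1, hs.2.trans_le t.2.2⟩) fun s _ => rfl

theorem convCT_comm (hT : 0 ≤ T) {k l : ℝ → ℝ} (hk : IsKernel T k)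
    (hl : IsKernel T l) (q : CT T X) :
    convCT hT k hk (convCT hT l hl q) = convCT hT l hl (convCT hT k hk q) := by
  rw [convCT_comp, convCT_comp]
  exact convCT_congr _ _ _ (fun s _ => conv_mul_comm k l s) q

theorem convCT_sub_kernel (hT : 0 ≤ T) {k l : ℝ → ℝ} (hk : IsKernel T k)
    (hl : IsKernel T l) (q : CT T X) :
    convCT hT (k - l) (IntegrableOn.sub hk hl) q = convCT hT k hk q - convCT hT l hl q := by
  ext t
  change conv (k - l) (IccExtend hT q) t = conv k (IccExtend hT q) t - conv l (IccExtend hT q) t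
  unfold conv
  rw [← intervalIntegral.integral_sub (conv_intervalIntegrable' hT hk q t.2)
    (conv_intervalIntegrable' hT hl q t.2)]
  simp only [Pi.sub_apply, sub_smul]

variable {Y : Type} [NormedAddCommGroup Y] [NormedSpace ℝ Y]

/-- A bounded operator acting pointwise on `C([0,T]; X)`. -/
def pointwise (B : X →L[ℝ] Y) (q : CT T X) : CT T Y := ⟨fun t => B (q t), by fun_prop⟩

theorem pointwise_add (B : X →L[ℝ] Y) (q p : CT T X) :
    pointwise B (q + p) = pointwise B q + pointwise B p := ContinuousMap.ext fun _ => map_add B _ _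

theorem pointwise_sub (B : X →L[ℝ] Y) (q p : CT T X) :
    pointwise B (q - p) = pointwise B q - pointwise B p := ContinuousMap.ext fun _ => map_sub B _ _

theorem pointwise_apply (B : X →L[ℝ] Y) (q : CT T X) (t : Icc (0 : ℝ) T) :
    pointwise B q t = B (q t) := rfl

theorem norm_pointwise_le (B : X →L[ℝ] Y) (q : CT T X) : ‖pointwise B q‖ ≤ ‖B‖ * ‖q‖ :=
  (ContinuousMap.norm_le _ (by positivity)).2 fun t =>
    (B.le_opNorm _).trans (mul_le_mul_of_nonneg_left (q.norm_coe_le_norm t) (norm_nonneg _))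

theorem pointwise_convCT [CompleteSpace Y] (hT : 0 ≤ T) {k : ℝ → ℝ}
    (hk : IsKernel T k) (B : X →L[ℝ] Y) (q : CT T X) :
    pointwise B (convCT hT k hk q) = convCT hT k hk (pointwise B q) := by
  ext t
  rw [pointwise_apply, convCT_apply, convCT_apply]
  unfold conv
  rw [← B.intervalIntegral_comp_comm (conv_intervalIntegrable' hT hk q t.2)]
  simp only [map_smul]
  rfl

/-- Multiplication by `exp (-σ t)` on `C([0,T]; X)`. -/
def expMul (σ : ℝ) (q : CT T X) : CT T X := ⟨fun t => Real.exp (-(σ * t)) • q t, by fun_prop⟩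

theorem expMul_add (σ : ℝ) (q p : CT T X) : expMul σ (q + p) = expMul σ q + expMul σ p :=
  ContinuousMap.ext fun _ => smul_add _ _ _

theorem expMul_apply (σ : ℝ) (q : CT T X) (t : Icc (0 : ℝ) T) :
    expMul σ q t = Real.exp (-(σ * t)) • q t := rfl

theorem expMul_neg_expMul (σ : ℝ) (q : CT T X) : expMul (-σ) (expMul σ q) = q := by
  ext t
  rw [expMul_apply, expMul_apply, smul_smul, ← Real.exp_add]
  simp

theorem expMul_expMul_neg (σ : ℝ) (q : CT T X) : expMul σ (expMul (-σ) q) = q := by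
  simpa using expMul_neg_expMul (-σ) q

theorem norm_expMul_le {σ : ℝ} (hσ : 0 ≤ σ) (q : CT T X) : ‖expMul σ q‖ ≤ ‖q‖ :=
  (ContinuousMap.norm_le _ (norm_nonneg _)).2 fun t => by
    rw [expMul_apply, norm_smul, Real.norm_eq_abs, Real.abs_exp]
    have : Real.exp (-(σ * t)) ≤ 1 := Real.exp_le_one_iff.2 (by
      have := mul_nonneg hσ t.2.1; linarith)
    exact (mul_le_of_le_one_left (norm_nonneg _) this).trans (q.norm_coe_le_norm t)

theorem norm_le_expMul {σ : ℝ} (hσ : 0 ≤ σ) (q : CT T X) :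
    ‖q‖ ≤ Real.exp (σ * T) * ‖expMul σ q‖ :=
  (ContinuousMap.norm_le _ (by positivity)).2 fun t => by
    have h : q t = Real.exp (σ * t) • expMul σ q t := by
      rw [expMul_apply, smul_smul, ← Real.exp_add]
      simp
    rw [h, norm_smul, Real.norm_eq_abs, Real.abs_exp]
    exact mul_le_mul (Real.exp_le_exp.2 (mul_le_mul_of_nonneg_left t.2.2 hσ))
      ((expMul σ q).norm_coe_le_norm t) (norm_nonneg _) (Real.exp_pos _).le

/-- The kernel `exp (-σ t) k(t)`. -/
def expKernel (σ : ℝ) (k : ℝ → ℝ) (t : ℝ) : ℝ := Real.exp (-(σ * t)) * k t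

theorem integrableOn_expKernel {k : ℝ → ℝ} (hk : IsKernel T k) (σ : ℝ) :
    IsKernel T (expKernel σ k) := by
  have : IntegrableOn k (Icc 0 T) := by rwa [integrableOn_Icc_iff_integrableOn_Ioc]
  rw [IsKernel, ← integrableOn_Icc_iff_integrableOn_Ioc]
  exact this.continuousOn_mul (by fun_prop) isCompact_Icc

/-- The exponential weight is multiplicative along `t = (t - s) + s`, so it can be moved onto both
factors. The kernel then becomes small in `L¹` for large `σ` at the price of an equivalent norm. -/
theorem expMul_convCT (hT : 0 ≤ T) {k : ℝ → ℝ} (hk : IsKernel T k) (σ : ℝ)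
    (q : CT T X) : expMul σ (convCT hT k hk q)
      = convCT hT (expKernel σ k) (integrableOn_expKernel hk σ) (expMul σ q) := by
  ext t
  rw [expMul_apply, convCT_apply, convCT_apply]
  unfold conv
  rw [← intervalIntegral.integral_smul]
  refine intervalIntegral.integral_congr fun s hs => ?_
  rw [uIcc_of_le t.2.1] at hs
  have hs' : s ∈ Icc 0 T := ⟨hs.1, hs.2.trans t.2.2⟩
  simp only [IccExtend_of_mem hT _ hs', expMul_apply, expKernel, smul_smul]
  congr 1
  rw [show -(σ * (t : ℝ)) = -(σ * (t - s)) + -(σ * s) by ring, Real.exp_add]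
  ring

theorem exists_weight {k : ℝ → ℝ} (hk : IsKernel T k) {ε : ℝ} (hε : 0 < ε) :
    ∀ᶠ σ in atTop, ∫ s in Ioc 0 T, |expKernel σ k s| < ε := by
  have : Tendsto (fun σ => ∫ s in Ioc 0 T, |expKernel σ k s|) atTop (𝓝 (∫ s in Ioc 0 T, 0)) := by
    refine tendsto_integral_filter_of_dominated_convergence (fun s => |k s|) ?_ ?_ hk.abs ?_
    · exact Eventually.of_forall fun σ => (integrableOn_expKernel hk σ).1.norm
    · filter_upwards [eventually_ge_atTop 0] with σ hσ
      filter_upwards [ae_restrict_mem measurableSet_Ioc] with s hs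
      rw [expKernel, abs_mul, Real.abs_exp, Real.norm_eq_abs, abs_mul, abs_abs, Real.abs_exp]
      refine mul_le_of_le_one_left (abs_nonneg _) (Real.exp_le_one_iff.2 ?_)
      have := mul_nonneg hσ hs.1.le
      linarith
    · filter_upwards [ae_restrict_mem measurableSet_Ioc] with s hs
      have h1 : Tendsto (fun σ : ℝ => Real.exp (-(σ * s))) atTop (𝓝 0) :=
        Real.tendsto_exp_neg_atTop_nhds_zero.comp (tendsto_id.atTop_mul_const hs.1)
      simpa [expKernel] using (h1.mul_const (k s)).abs
  rw [integral_zero] at this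
  exact this.eventually_lt_const hε

theorem norm_le_two_mul_of_perturbation {z p q : X} (hp : ‖p‖ ≤ 1 / 4 * ‖z‖) (hq : ‖q‖ ≤ 1 / 4 * ‖z‖) :
    ‖z‖ ≤ 2 * ‖z + p + q‖ := by
  have h1 := norm_sub_le (z + p + q) (p + q)
  have h2 := norm_add_le p q
  rw [add_assoc, add_sub_cancel_right] at h1
  rw [add_assoc]
  linarith

/-- The two quarters add up to a contraction constant `1/2`. Here `σ` depends on `‖B‖`; removing
this dependence is the purpose of the energy estimate. -/
theorem volterra_weight (T : ℝ) (B : X →L[ℝ] X) {k l : ℝ → ℝ} (hk : IsKernel T k)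
    (hl : IsKernel T l) : ∃ σ : ℝ, 0 ≤ σ ∧
      ‖B‖ * (∫ s in Ioc 0 T, |expKernel σ k s|) ≤ 1 / 4 ∧
      ∫ s in Ioc 0 T, |expKernel σ l s| ≤ 1 / 4 := by
  obtain ⟨σ, ⟨h1, h2⟩, hσ⟩ := (((exists_weight hk (show 0 < 1 / (4 * (‖B‖ + 1)) by positivity)).and
    (exists_weight hl (show (0 : ℝ) < 1 / 4 by norm_num))).and (eventually_ge_atTop 0)).exists
  refine ⟨σ, hσ, (mul_le_mul_of_nonneg_left h1.le (norm_nonneg B)).trans ?_, h2.le⟩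
  rw [mul_one_div, div_le_div_iff₀ (by positivity) (by norm_num)]
  linarith

theorem norm_pointwise_convCT_le (hT : 0 ≤ T) (B : X →L[ℝ] X) {k : ℝ → ℝ}
    (hk : IsKernel T k) (q : CT T X) :
    ‖pointwise B (convCT hT k hk q)‖ ≤ ‖B‖ * (∫ s in Ioc 0 T, |k s|) * ‖q‖ := by
  refine (norm_pointwise_le _ _).trans ?_
  rw [mul_assoc]
  exact mul_le_mul_of_nonneg_left (norm_convCT_le hT hk q) (norm_nonneg _)

theorem expMul_volterra (hT : 0 ≤ T) (B : X →L[ℝ] X) {k l : ℝ → ℝ}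
    (hk : IsKernel T k) (hl : IsKernel T l) (σ : ℝ) (y : CT T X) :
    expMul σ (y + pointwise B (convCT hT k hk y) + convCT hT l hl y)
      = expMul σ y + pointwise B (convCT hT _ (integrableOn_expKernel hk σ) (expMul σ y))
        + convCT hT _ (integrableOn_expKernel hl σ) (expMul σ y) := by
  rw [expMul_add, expMul_add, expMul_convCT, ← expMul_convCT hT hk]
  congr 2
  ext t
  simp only [expMul_apply, pointwise_apply, map_smul]

/-- Stability of the Volterra equation `y + B (k * y) + l * y = G`. -/
theorem volterra_bound (hT : 0 ≤ T) (B : X →L[ℝ] X) {k l : ℝ → ℝ} (hk : IsKernel T k)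
    (hl : IsKernel T l) : ∃ C : ℝ, 0 < C ∧ ∀ y : CT T X,
      ‖y‖ ≤ C * ‖y + pointwise B (convCT hT k hk y) + convCT hT l hl y‖ := by
  obtain ⟨σ, hσ, h1, h2⟩ := volterra_weight T B hk hl
  refine ⟨Real.exp (σ * T) * 2, by positivity, fun y => ?_⟩
  have b1 := (norm_pointwise_convCT_le hT B (integrableOn_expKernel hk σ) (expMul σ y)).trans
    (mul_le_mul_of_nonneg_right h1 (norm_nonneg _))
  have b2 := (norm_convCT_le hT (integrableOn_expKernel hl σ) (expMul σ y)).trans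
    (mul_le_mul_of_nonneg_right h2 (norm_nonneg _))
  have b3 := norm_le_two_mul_of_perturbation b1 b2
  rw [← expMul_volterra hT B hk hl] at b3
  refine (norm_le_expMul hσ y).trans ?_
  rw [mul_assoc]
  exact mul_le_mul_of_nonneg_left (b3.trans
    (mul_le_mul_of_nonneg_left (norm_expMul_le hσ _) zero_le_two)) (Real.exp_pos _).le

/-- Solvability of the Volterra equation `y + B (k * y) + l * y = G`. -/
theorem volterra_exists (hT : 0 ≤ T) (B : X →L[ℝ] X) {k l : ℝ → ℝ}
    (hk : IsKernel T k) (hl : IsKernel T l) (G : CT T X) :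
    ∃ y : CT T X, y + pointwise B (convCT hT k hk y) + convCT hT l hl y = G := by
  obtain ⟨σ, hσ, h1, h2⟩ := volterra_weight T B hk hl
  -- In the weighted unknown `z = exp (-σt) y` the equation is `z = exp (-σt) G - M z`, solved by
  -- the contraction principle and then unweighted.
  let M : CT T X → CT T X := fun q => pointwise B (convCT hT _ (integrableOn_expKernel hk σ) q)
    + convCT hT _ (integrableOn_expKernel hl σ) q
  have hsub : ∀ q p, M (q - p) = M q - M p := fun q p => by
    simp only [M, convCT_sub, pointwise_sub]
    abel
  have hM : ∀ q, ‖M q‖ ≤ 1 / 2 * ‖q‖ := fun q => by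
    have c1 := (norm_pointwise_convCT_le hT B (integrableOn_expKernel hk σ) q).trans
          (mul_le_mul_of_nonneg_right h1 (norm_nonneg _))
    have c2 := (norm_convCT_le hT (integrableOn_expKernel hl σ) q).trans
          (mul_le_mul_of_nonneg_right h2 (norm_nonneg _))
    have c3 := norm_add_le (pointwise B (convCT hT _ (integrableOn_expKernel hk σ) q))
      (convCT hT _ (integrableOn_expKernel hl σ) q)
    change ‖pointwise B (convCT hT _ (integrableOn_expKernel hk σ) q)
      + convCT hT _ (integrableOn_expKernel hl σ) q‖ ≤ _
    linarith
  have hc : ContractingWith (1 / 2) fun z => expMul σ G - M z := by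
    refine ⟨by rw [← NNReal.coe_lt_coe]; norm_num, LipschitzWith.of_dist_le_mul fun x y => ?_⟩
    rw [dist_eq_norm, dist_eq_norm, sub_sub_sub_cancel_left, ← hsub, norm_sub_rev x y]
    simpa using hM (y - x)
  let z := hc.fixedPoint
  have hz : z + M z = expMul σ G := by
    have : expMul σ G - M z = z := hc.fixedPoint_isFixedPt
    rw [← this, this]
    exact sub_eq_iff_eq_add.1 this |>.symm
  refine ⟨expMul (-σ) z, ?_⟩
  have e := expMul_volterra hT B hk hl σ (expMul (-σ) z)
  rw [expMul_expMul_neg, add_assoc z] at e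
  rw [← expMul_neg_expMul σ (_ + _ + _), e]
  change expMul (-σ) (z + M z) = G
  rw [hz, expMul_neg_expMul]

end ConvCT

/-! ### Plancherel and the Fourier transform of the weighted Abel kernel. -/

section Fourier

open scoped FourierTransform Convolution SchwartzMap

/-- The Fourier transform on `L²` agrees with the Fourier integral on `L¹ ∩ L²`. -/
theorem fourier_toLp_ae_eq {f : ℝ → ℂ} (hf : Integrable f) (hf2 : MemLp f 2) :
    (𝓕 (hf2.toLp f) : Lp ℂ 2 (volume : Measure ℝ)) =ᵐ[volume] 𝓕 f := by
  have hcont : Continuous (𝓕 f) :=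
    VectorFourier.fourierIntegral_continuous Real.continuous_fourierChar
      (by exact continuous_inner) hf
  -- Both sides are compared as tempered distributions: tested against a bump function, each moves
  -- the transform onto the test function.
  refine ae_eq_of_integral_contDiff_smul_eq ((Lp.memLp _).locallyIntegrable one_le_two)
    hcont.locallyIntegrable fun g hg hgs => ?_
  have hg₁ : HasCompactSupport (Complex.ofRealCLM ∘ g) := hgs.comp_left rfl
  have hg₂ : ContDiff ℝ ∞ (Complex.ofRealCLM ∘ g) := by fun_prop
  set φ : 𝓢(ℝ, ℂ) := hg₁.toSchwartzMap hg₂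
  have h1 := congrArg (fun D : 𝓢'(ℝ, ℂ) => D φ) (Lp.fourier_toTemperedDistribution_eq (hf2.toLp f))
  simp only [TemperedDistribution.fourier_apply, Lp.toTemperedDistribution_apply] at h1
  have h2 : ∫ x, (𝓕 φ : 𝓢(ℝ, ℂ)) x • (hf2.toLp f) x = ∫ x, (𝓕 φ : 𝓢(ℝ, ℂ)) x • f x := by
    refine integral_congr_ae ?_
    filter_upwards [hf2.coeFn_toLp] with x hx
    rw [hx]
  have h3 : ∫ x, 𝓕 (φ : ℝ → ℂ) x • f x = ∫ x, φ x • 𝓕 f x := by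
    simpa using! (VectorFourier.integral_fourierIntegral_smul_eq_flip (L := innerₗ ℝ)
      Real.continuous_fourierChar continuous_inner φ.integrable hf)
  have h4 : ∀ x, (𝓕 φ : 𝓢(ℝ, ℂ)) x = 𝓕 (φ : ℝ → ℂ) x := fun x => by
    rw [SchwartzMap.fourier_coe]
  have e : ∀ x, φ x = (g x : ℂ) := fun x => rfl
  rw [h2] at h1
  simp only [h4] at h1
  rw [h3] at h1
  simpa [e, Complex.real_smul] using h1.symm

theorem integral_mul_conj_fourier {f g : ℝ → ℂ} (hf : Integrable f) (hf2 : MemLp f 2)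
    (hg : Integrable g) (hg2 : MemLp g 2) :
    ∫ x, f x * (starRingEnd ℂ) (g x) = ∫ ξ, 𝓕 f ξ * (starRingEnd ℂ) (𝓕 g ξ) := by
  have h := Lp.inner_fourier_eq (hg2.toLp g) (hf2.toLp f)
  rw [L2.inner_def, L2.inner_def] at h
  have h1 : ∫ a, inner ℂ ((𝓕 (hg2.toLp g) : Lp ℂ 2 (volume : Measure ℝ)) a)
      ((𝓕 (hf2.toLp f) : Lp ℂ 2 (volume : Measure ℝ)) a)
      = ∫ ξ, 𝓕 f ξ * (starRingEnd ℂ) (𝓕 g ξ) := by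
    refine integral_congr_ae ?_
    filter_upwards [fourier_toLp_ae_eq hf hf2, fourier_toLp_ae_eq hg hg2] with x h1 h2
    rw [h1, h2, RCLike.inner_apply]
  have h2 : ∫ a, inner ℂ ((hg2.toLp g) a) ((hf2.toLp f) a)
      = ∫ x, f x * (starRingEnd ℂ) (g x) := by
    refine integral_congr_ae ?_
    filter_upwards [hf2.coeFn_toLp, hg2.coeFn_toLp] with x h1 h2
    rw [h1, h2, RCLike.inner_apply]
  rw [← h1, ← h2, h]

theorem memLp_two_of_bounded {f : ℝ → ℂ} (hf : Integrable f) {C : ℝ} (hC : ∀ x, ‖f x‖ ≤ C) :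
    MemLp f 2 := by
  refine (memLp_two_iff_integrable_sq_norm hf.1).2 ?_
  refine (hf.norm.const_mul C).mono' (hf.1.norm.pow 2) (Eventually.of_forall fun x => ?_)
  rw [norm_pow, norm_norm, pow_two]
  exact mul_le_mul_of_nonneg_right (hC x) (norm_nonneg _)

/-- Laplace transform of a power. -/
theorem laplace_rpow {a : ℝ} (ha : 0 < a) {z : ℂ} (hz : 0 < z.re) :
    ∫ t in Ioi (0 : ℝ), ((t ^ (a - 1) : ℝ) : ℂ) * Complex.exp (-(z * t))
      = Real.Gamma a * z ^ (-(a : ℂ)) := by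
  let μ : Measure ℝ := (volume.restrict (Ioi 0)).withDensity fun t => ENNReal.ofReal (t ^ (a - 1))
  have hmeas : Measurable fun t : ℝ => ENNReal.ofReal (t ^ (a - 1)) := by fun_prop
  have hset : Iio 0 ⊆ ProbabilityTheory.integrableExpSet id μ := fun r hr => by
    have hr' : (0 : ℝ) < -r := by simpa using hr
    change Integrable (fun t => Real.exp (r * id t)) μ
    rw [integrable_withDensity_iff hmeas (Eventually.of_forall fun _ => ENNReal.ofReal_lt_top)]
    have := Real.GammaIntegral_convergent ha
    have h2 := integrableOn_rpow_mul_exp_neg_mul_rpow (s := a - 1) (p := 1) (b := -r) (by linarith)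
      one_pos hr'
    refine h2.congr_fun (fun t ht => ?_) measurableSet_Ioi
    rw [ENNReal.toReal_ofReal (Real.rpow_nonneg (le_of_lt ht) _)]
    simp [mul_comm]
  have hint : ∀ w : ℂ, ProbabilityTheory.complexMGF id μ w
      = ∫ t in Ioi (0 : ℝ), ((t ^ (a - 1) : ℝ) : ℂ) * Complex.exp (w * t) := fun w => by
    rw [ProbabilityTheory.complexMGF, integral_withDensity_eq_integral_toReal_smul hmeas
      (Eventually.of_forall fun _ => ENNReal.ofReal_lt_top)]
    refine setIntegral_congr_fun measurableSet_Ioi fun t ht => ?_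
    simp only [id]
    rw [ENNReal.toReal_ofReal (Real.rpow_nonneg (le_of_lt ht) _), Complex.real_smul]
  -- The integral is a complex moment generating function, hence analytic in the left half-plane. It
  -- is known on the negative real axis from the Gamma integral, and the identity theorem extends
  -- the formula to all of `U`.
  let U : Set ℂ := {w | w.re < 0}
  have hU : IsPreconnected U := (convex_halfSpace_re_lt 0).isPreconnected
  have hUo : IsOpen U := isOpen_lt Complex.continuous_re continuous_const
  have hA : AnalyticOnNhd ℂ (ProbabilityTheory.complexMGF id μ) U := fun w hw =>
    ProbabilityTheory.analyticOnNhd_complexMGF w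
      (interior_mono hset (by rw [isOpen_Iio.interior_eq]; exact hw))
  have hB : AnalyticOnNhd ℂ (fun w : ℂ => (Real.Gamma a : ℂ) * (-w) ^ (-(a : ℂ))) U := by
    refine DifferentiableOn.analyticOnNhd (fun w hw => ?_) hUo
    refine DifferentiableAt.differentiableWithinAt ?_
    refine (DifferentiableAt.cpow (by fun_prop) (by fun_prop) ?_).const_mul _
    left
    have : w.re < 0 := hw
    simpa using this
  have hreal : ∀ r : ℝ, r < 0 → ProbabilityTheory.complexMGF id μ r
      = (Real.Gamma a : ℂ) * (-(r : ℂ)) ^ (-(a : ℂ)) := fun r hr => by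
    have h := Complex.integral_cpow_mul_exp_neg_mul_Ioi (a := (a : ℂ)) (r := -r) (by simpa using ha)
      (by linarith)
    rw [hint]
    have e : (1 / ((-r : ℝ) : ℂ)) ^ (a : ℂ) = (-(r : ℂ)) ^ (-(a : ℂ)) := by
      rw [one_div, Complex.inv_cpow, Complex.cpow_neg, Complex.ofReal_neg]
      rw [Complex.arg_ofReal_of_nonneg (by linarith)]
      exact Real.pi_pos.ne
    rw [e, Complex.Gamma_ofReal, mul_comm] at h
    rw [← h]
    refine setIntegral_congr_fun measurableSet_Ioi fun t ht => ?_
    rw [Complex.ofReal_cpow (le_of_lt ht)]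
    push_cast
    ring_nf
  have hfreq : ∃ᶠ w in 𝓝[≠] (-1 : ℂ), ProbabilityTheory.complexMGF id μ w
      = (Real.Gamma a : ℂ) * (-w) ^ (-(a : ℂ)) := by
    have ht : Tendsto (fun r : ℝ => (r : ℂ)) (𝓝[≠] (-1)) (𝓝[≠] (-1 : ℂ)) := by
      refine tendsto_nhdsWithin_iff.2 ⟨?_, ?_⟩
      · exact (Complex.continuous_ofReal.tendsto' _ _ (by simp)).mono_left nhdsWithin_le_nhds
      · filter_upwards [self_mem_nhdsWithin] with r hr
        intro h
        exact hr (by simpa using congrArg Complex.re h)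
    refine ht.frequently (Eventually.frequently ?_)
    have : ∀ᶠ r : ℝ in 𝓝[≠] (-1), r < 0 :=
      nhdsWithin_le_nhds (Iio_mem_nhds (by norm_num))
    filter_upwards [this] with r hr using hreal r hr
  have := hA.eqOn_of_preconnected_of_frequently_eq hB hU (z₀ := -1) (by simp [U]) hfreq
    (x := -z) (by simpa [U] using hz)
  simp only [neg_neg] at this
  rw [← this, hint]
  simp

/-- The weighted Abel kernel on the half-line. -/
def weightedBeta (σ a : ℝ) : ℝ → ℝ := indicator (Ioi 0) (expKernel σ (beta a))

theorem integrable_weightedBeta {σ a : ℝ} (hσ : 0 < σ) (ha : 0 < a) :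
    Integrable (weightedBeta σ a) := by
  refine (integrable_indicator_iff measurableSet_Ioi).2 ?_
  have h2 := integrableOn_rpow_mul_exp_neg_mul_rpow (s := a - 1) (p := 1) (b := σ) (by linarith)
      one_pos hσ
  refine IntegrableOn.congr_fun (h2.const_mul (Real.Gamma a)⁻¹) (fun t ht => ?_) measurableSet_Ioi
  simp only [expKernel, beta, Real.rpow_one, neg_mul]
  ring

theorem fourier_weightedBeta {σ a : ℝ} (hσ : 0 < σ) (ha : 0 < a) (ξ : ℝ) :
    𝓕 (fun t => (weightedBeta σ a t : ℂ)) ξ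
      = ((σ : ℂ) + (2 * Real.pi * ξ : ℝ) * Complex.I) ^ (-(a : ℂ)) := by
  have hG : (Real.Gamma a : ℂ) ≠ 0 := by exact_mod_cast (Real.Gamma_pos_of_pos ha).ne'
  have h := laplace_rpow ha (z := (σ : ℂ) + (2 * Real.pi * ξ : ℝ) * Complex.I) (by simpa using hσ)
  rw [Real.fourier_real_eq_integral_exp_smul]
  have e : ∀ t : ℝ, Complex.exp (↑(-2 * Real.pi * t * ξ) * Complex.I) • (weightedBeta σ a t : ℂ)
      = (Real.Gamma a : ℂ)⁻¹ * (Ioi (0 : ℝ)).indicator (fun t : ℝ => ((t ^ (a - 1) : ℝ) : ℂ)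
        * Complex.exp (-(((σ : ℂ) + (2 * Real.pi * ξ : ℝ) * Complex.I) * t))) t := fun t => by
    by_cases ht : t ∈ Ioi (0 : ℝ)
    · simp only [weightedBeta, indicator_of_mem ht, expKernel, beta, smul_eq_mul]
      push_cast
      rw [show -(((σ : ℂ) + 2 * Real.pi * ξ * Complex.I) * t)
        = (-2 * Real.pi * t * ξ * Complex.I) + -(σ * t) by ring, Complex.exp_add]
      ring
    · simp [weightedBeta, indicator_of_notMem ht]
  simp_rw [e]
  rw [integral_const_mul, integral_indicator measurableSet_Ioi, h, inv_mul_cancel_left₀ hG]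

/-- The power `z ^ (-a)` of a point of the right half-plane lies in a sector. -/
theorem re_cpow_neg_ge {a : ℝ} (ha : 0 < a) (ha1 : a < 1) {z : ℂ} (hz : 0 < z.re) :
    Real.cos (a * (Real.pi / 2)) * ‖z ^ (-(a : ℂ))‖ ≤ (z ^ (-(a : ℂ))).re := by
  have hz0 : z ≠ 0 := fun h => by simp [h] at hz
  rw [Complex.cpow_def_of_ne_zero hz0, Complex.norm_exp, Complex.exp_re, mul_comm]
  refine mul_le_mul_of_nonneg_left ?_ (Real.exp_pos _).le
  -- The argument of `z ^ (-a)` is `-a arg z`, of modulus at most `aπ/2 < π`, where the cosine is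
  -- decreasing.
  have h1 : (Complex.log z * -(a : ℂ)).im = -(a * z.arg) := by
    simp [Complex.log_im, mul_comm]
  have h2 : |z.arg| ≤ Real.pi / 2 := Complex.abs_arg_le_pi_div_two_iff.2 hz.le
  rw [h1, Real.cos_neg, ← Real.cos_abs (a * z.arg), abs_mul, abs_of_pos ha]
  refine Real.cos_le_cos_of_nonneg_of_le_pi (by positivity) ?_
    (mul_le_mul_of_nonneg_left h2 ha.le)
  nlinarith [Real.pi_pos]

end Fourier

/-! ### Positivity of the scalar memory form. -/

section Positivity

open scoped FourierTransform Convolution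

theorem norm_convolution_le_of_bounded {k V : ℝ → ℂ} (hk : Integrable k) {C : ℝ}
    (hC : ∀ x, ‖V x‖ ≤ C) (t : ℝ) :
    ‖(k ⋆[ContinuousLinearMap.mul ℂ ℂ, volume] V) t‖ ≤ (∫ s, ‖k s‖) * C := by
  unfold convolution
  rw [← integral_mul_const]
  refine norm_integral_le_of_norm_le (hk.norm.mul_const _) (Eventually.of_forall fun s => ?_)
  rw [ContinuousLinearMap.mul_apply', norm_mul]
  exact mul_le_mul_of_nonneg_left (hC _) (norm_nonneg _)

theorem norm_fourier_le_integral (f : ℝ → ℂ) (ξ : ℝ) : ‖𝓕 f ξ‖ ≤ ∫ s, ‖f s‖ :=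
  VectorFourier.norm_fourierIntegral_le_integral_norm _ _ _ f ξ

theorem fourier_sub_apply {f g : ℝ → ℂ} (hf : Integrable f) (hg : Integrable g) (ξ : ℝ) :
    𝓕 (f - g) ξ = 𝓕 f ξ - 𝓕 g ξ := by
  rw [Real.fourier_real_eq, Real.fourier_real_eq, Real.fourier_real_eq, ← integral_sub]
  · simp [smul_sub]
  · exact (Real.fourierIntegral_convergent_iff ξ).2 hf |>.congr (Eventually.of_forall fun t => by
      simp [mul_comm])
  · exact (Real.fourierIntegral_convergent_iff ξ).2 hg |>.congr (Eventually.of_forall fun t => by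
      simp [mul_comm])

/-- By Plancherel the integral equals `∫ k̂ (1 - r̂) |V̂|²`. The sector bound gives `Re k̂ ≥
cos(aπ/2) |k̂|`, while `|r̂| ≤ ‖r‖₁ ≤ cos(aπ/2)`, so the real part of `k̂ (1 - r̂)` is nonnegative.
-/
theorem re_integral_convolution_mul_conj_nonneg {σ a : ℝ} (hσ : 0 < σ) (ha : 0 < a) (ha1 : a < 1)
    {r V : ℝ → ℂ} (hr : Integrable r) (hrc : ∫ s, ‖r s‖ ≤ Real.cos (a * (Real.pi / 2)))
    (hV : Integrable V) {C : ℝ} (hC : ∀ x, ‖V x‖ ≤ C) :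
    0 ≤ (∫ t, ((fun t => (weightedBeta σ a t : ℂ)) ⋆[ContinuousLinearMap.mul ℂ ℂ, volume]
      (V - r ⋆[ContinuousLinearMap.mul ℂ ℂ, volume] V)) t * (starRingEnd ℂ) (V t)).re := by
  set k : ℝ → ℂ := fun t => (weightedBeta σ a t : ℂ)
  have hk : Integrable k := (integrable_weightedBeta hσ ha).ofReal
  have hrV : Integrable (r ⋆[ContinuousLinearMap.mul ℂ ℂ, volume] V) :=
    hr.integrable_convolution _ hV
  set W := V - r ⋆[ContinuousLinearMap.mul ℂ ℂ, volume] V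
  have hW : Integrable W := hV.sub hrV
  have hWC : ∀ x, ‖W x‖ ≤ C + (∫ s, ‖r s‖) * C := fun x =>
    (norm_sub_le _ _).trans (add_le_add (hC x) (norm_convolution_le_of_bounded hr hC x))
  have hF : Integrable (k ⋆[ContinuousLinearMap.mul ℂ ℂ, volume] W) :=
    hk.integrable_convolution _ hW
  rw [integral_mul_conj_fourier hF
    (memLp_two_of_bounded hF (norm_convolution_le_of_bounded hk hWC)) hV
    (memLp_two_of_bounded hV hC)]
  have e : ∀ ξ, 𝓕 (k ⋆[ContinuousLinearMap.mul ℂ ℂ, volume] W) ξ * (starRingEnd ℂ) (𝓕 V ξ)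
      = (𝓕 k ξ * (1 - 𝓕 r ξ)) * ((‖𝓕 V ξ‖ ^ 2 : ℝ) : ℂ) := fun ξ => by
    rw [Real.fourier_mul_convolution_eq hk hW, fourier_sub_apply hV hrV,
      Real.fourier_mul_convolution_eq hr hV, Complex.ofReal_pow, ← Complex.mul_conj']
    ring
  simp_rw [e]
  -- If the integrand is not integrable its integral is `0` by convention, and the claim is trivial.
  by_cases hi : Integrable fun ξ => (𝓕 k ξ * (1 - 𝓕 r ξ)) * ((‖𝓕 V ξ‖ ^ 2 : ℝ) : ℂ)
  swap
  · rw [integral_undef hi]; simp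
  have := integral_re (𝕜 := ℂ) hi
  simp only [RCLike.re_to_complex] at this
  rw [← this]
  refine integral_nonneg fun ξ => ?_
  simp only [Pi.zero_apply]
  rw [Complex.re_mul_ofReal]
  refine mul_nonneg ?_ (sq_nonneg _)
  have h1 : Real.cos (a * (Real.pi / 2)) * ‖𝓕 k ξ‖ ≤ (𝓕 k ξ).re := by
    rw [fourier_weightedBeta hσ ha]
    exact re_cpow_neg_ge ha ha1 (by simpa using hσ)
  have h2 := (norm_fourier_le_integral r ξ).trans hrc
  have h3 := (Complex.re_le_norm (𝓕 k ξ * 𝓕 r ξ))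
  rw [norm_mul] at h3
  rw [mul_sub, mul_one, Complex.sub_re]
  nlinarith [norm_nonneg (𝓕 k ξ)]

theorem ofReal_convolution (f g : ℝ → ℝ) (t : ℝ) :
    (((f ⋆[ContinuousLinearMap.lsmul ℝ ℝ, volume] g) t : ℝ) : ℂ)
      = ((fun s => (f s : ℂ)) ⋆[ContinuousLinearMap.mul ℂ ℂ, volume] fun s => (g s : ℂ)) t := by
  unfold convolution
  rw [← integral_complex_ofReal]
  simp

theorem integral_convolution_mul_nonneg {σ a : ℝ} (hσ : 0 < σ) (ha : 0 < a) (ha1 : a < 1)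
    {r V : ℝ → ℝ} (hr : Integrable r) (hrc : ∫ s, |r s| ≤ Real.cos (a * (Real.pi / 2)))
    (hV : Integrable V) {C : ℝ} (hC : ∀ x, |V x| ≤ C) :
    0 ≤ ∫ t, (weightedBeta σ a ⋆[ContinuousLinearMap.lsmul ℝ ℝ, volume]
      (V - r ⋆[ContinuousLinearMap.lsmul ℝ ℝ, volume] V)) t * V t := by
  have h := re_integral_convolution_mul_conj_nonneg hσ ha ha1 (r := fun s => (r s : ℂ))
    (V := fun s => (V s : ℂ)) hr.ofReal (by simpa using hrc) hV.ofReal (C := C) (by simpa using hC)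
  have e : ((fun s => (V s : ℂ)) - (fun s => (r s : ℂ)) ⋆[ContinuousLinearMap.mul ℂ ℂ, volume]
      fun s => (V s : ℂ)) = fun s => (((V - r ⋆[ContinuousLinearMap.lsmul ℝ ℝ, volume] V) s : ℝ) : ℂ) := by
    ext s
    rw [Pi.sub_apply, Pi.sub_apply, Complex.ofReal_sub, ofReal_convolution]
  rw [e] at h
  simp_rw [← ofReal_convolution, Complex.conj_ofReal, ← Complex.ofReal_mul] at h
  rwa [integral_complex_ofReal, Complex.ofReal_re] at h

variable {T : ℝ}

theorem isKernel_IccExtend (hT : 0 ≤ T) (q : CT T ℝ) : IsKernel T (IccExtend hT q) :=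
  (continuous_IccExtend hT q).integrableOn_Ioc

theorem isKernel_beta {μ : ℝ} (hμ : 0 < μ) (T : ℝ) (hT : 0 ≤ T) : IsKernel T (beta μ) := by
  have := (intervalIntegral.intervalIntegrable_rpow' (a := 0) (b := T) (r := μ - 1)
    (by linarith)).div_const (Real.Gamma μ)
  exact (intervalIntegrable_iff_integrableOn_Ioc_of_le hT).1 this

/-- A continuous kernel of small mass has a resolvent. -/
theorem exists_resolvent (hT : 0 ≤ T) (k : CT T ℝ) {c : ℝ} (hc : c ≤ 1)
    (hk : ∫ s in Ioc 0 T, |IccExtend hT k s| ≤ c / 2) :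
    ∃ r : CT T ℝ, (∫ s in Ioc 0 T, |IccExtend hT r s| ≤ c) ∧ ∀ w v : CT T ℝ,
      v = w + convCT hT _ (isKernel_IccExtend hT k) w →
      w = v - convCT hT _ (isKernel_IccExtend hT r) v := by
  -- The resolvent kernel solves `r + k * r = k`. From `‖r‖₁ ≤ ‖k‖₁ + ‖k‖₁ ‖r‖₁` and `‖k‖₁ ≤ c/2 ≤
  -- 1/2` follows `‖r‖₁ ≤ c`.
  obtain ⟨r, hr⟩ := volterra_exists hT (0 : ℝ →L[ℝ] ℝ) (isKernel_IccExtend hT k)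
    (isKernel_IccExtend hT k) k
  have hr' : ∀ t (ht : t ∈ Icc 0 T), IccExtend hT r t
      = IccExtend hT k t - conv (IccExtend hT k) (IccExtend hT r) t := fun t ht => by
    have h1 := congrArg (fun q : CT T ℝ => q ⟨t, ht⟩) hr
    simp only [ContinuousMap.add_apply, pointwise_apply, convCT_apply,
      zero_apply, add_zero] at h1
    rw [IccExtend_of_mem hT _ ht, IccExtend_of_mem hT _ ht, ← h1]
    ring
  refine ⟨r, ?_, fun w v hv => ?_⟩
  · have h1 := setIntegral_abs_conv_le (isKernel_IccExtend hT k) (isKernel_IccExtend hT r)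
    have h2 : ∫ s in Ioc 0 T, |IccExtend hT r s| ≤ (∫ s in Ioc 0 T, |IccExtend hT k s|)
        + ∫ s in Ioc 0 T, |conv (IccExtend hT k) (IccExtend hT r) s| := by
      rw [← integral_add (isKernel_IccExtend hT k).abs
        (integrableOn_conv (isKernel_IccExtend hT k) (isKernel_IccExtend hT r)).abs]
      refine setIntegral_mono_on (isKernel_IccExtend hT r).abs
        ((isKernel_IccExtend hT k).abs.add
        (integrableOn_conv (isKernel_IccExtend hT k) (isKernel_IccExtend hT r)).abs)
        measurableSet_Ioc fun s hs => ?_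
      rw [hr' s (Ioc_subset_Icc_self hs)]
      exact abs_sub _ _
    have h3 : 0 ≤ ∫ s in Ioc 0 T, |IccExtend hT r s| := integral_nonneg fun _ => abs_nonneg _
    nlinarith
  · have h1 : convCT hT _ (isKernel_IccExtend hT r) (convCT hT _ (isKernel_IccExtend hT k) w)
        = convCT hT _ (isKernel_IccExtend hT k) w - convCT hT _ (isKernel_IccExtend hT r) w := by
      rw [convCT_comp, ← convCT_sub_kernel]
      refine convCT_congr _ _ _ (fun s hs => ?_) w
      rw [conv_mul_comm, Pi.sub_apply, hr' s (Ioo_subset_Icc_self hs)]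
      ring
    rw [hv, convCT_add, h1]
    abel

/-- The second factor is `v = w + k * w`. Writing `w = v - r * v` with the resolvent `r` of `k`
expresses the form through `v` alone, which is the shape that Plancherel handles. -/
theorem integral_conv_mul_nonneg (hT : 0 ≤ T) {σ a : ℝ} (hσ : 0 < σ) (ha : 0 < a) (ha1 : a < 1)
    (k : CT T ℝ) (hk : ∫ s in Ioc 0 T, |IccExtend hT k s| ≤ Real.cos (a * (Real.pi / 2)) / 2)
    (w : CT T ℝ) {τ : ℝ} (hτ : τ ∈ Icc 0 T) :
    0 ≤ ∫ t in (0 : ℝ)..τ, conv (expKernel σ (beta a)) (IccExtend hT w) t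
      * (IccExtend hT w t + conv (IccExtend hT k) (IccExtend hT w) t) := by
  obtain ⟨r, hr, hrw⟩ := exists_resolvent hT k (Real.cos_le_one _) hk
  set v : CT T ℝ := w + convCT hT _ (isKernel_IccExtend hT k) w with hv
  have hwv := hrw w v hv
  set R := causal τ (IccExtend hT r)
  set V := causal τ (IccExtend hT v)
  have hR : Integrable R :=
    integrable_causal ((isKernel_IccExtend hT r).mono_set (Ioc_subset_Ioc_right hτ.2))
  have hV : Integrable V :=
    integrable_causal ((isKernel_IccExtend hT v).mono_set (Ioc_subset_Ioc_right hτ.2))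
  have hRc : ∫ s, |R s| ≤ Real.cos (a * (Real.pi / 2)) := by
    refine le_trans ?_ hr
    have : ∀ s, |R s| = (Ioc 0 τ).indicator (fun s => |IccExtend hT r s|) s := fun s => by
      by_cases hs : s ∈ Ioc 0 τ <;> simp [R, causal, hs]
    simp_rw [this]
    rw [integral_indicator measurableSet_Ioc]
    exact setIntegral_mono_set (isKernel_IccExtend hT r).abs
      (Eventually.of_forall fun _ => abs_nonneg _) (Ioc_subset_Ioc_right hτ.2).eventuallyLE
  have hVC : ∀ x, |V x| ≤ ‖v‖ := fun x => by
    by_cases hx : x ∈ Ioc 0 τ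
    · simp only [V, causal, indicator_of_mem hx]
      exact norm_IccExtend_le hT v x
    · simp [V, causal, hx]
  have key := integral_convolution_mul_nonneg hσ ha ha1 hR hRc hV hVC
  -- Truncating `v` and `r` at `τ` leaves `W = w` on `(0,τ]`. Beyond `τ` the two may differ, but
  -- there `V` vanishes and nothing is counted.
  set W := V - R ⋆[ContinuousLinearMap.lsmul ℝ ℝ, volume] V
  have hW0 : ∀ x ≤ 0, W x = 0 := fun x hx => by
    have h1 := convolution_causal_eq_zero (T := τ) (IccExtend hT r) (IccExtend hT v) hx
    simp only [W, Pi.sub_apply]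
    rw [h1, sub_zero]
    exact indicator_of_notMem (fun h => absurd h.1 (not_lt.2 hx)) _
  have hW1 : ∀ x ∈ Ioc 0 τ, W x = IccExtend hT w x := fun x hx => by
    have hxT : x ∈ Icc 0 T := ⟨hx.1.le, hx.2.trans hτ.2⟩
    have h1 := conv_eq_convolution (IccExtend hT r) (IccExtend hT v) hx.1.le hx.2
    simp only [W, Pi.sub_apply]
    rw [← h1, IccExtend_of_mem hT _ hxT, hwv]
    simp only [V, causal, indicator_of_mem hx]
    rw [IccExtend_of_mem hT _ hxT]
    rfl
  have hconv : ∀ t ∈ Ioc 0 τ, (weightedBeta σ a ⋆[ContinuousLinearMap.lsmul ℝ ℝ, volume] W) t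
      = conv (expKernel σ (beta a)) (IccExtend hT w) t := fun t ht => by
    rw [conv_comm_left, intervalIntegral.integral_of_le ht.1.le, integral_Ioc_eq_integral_Ioo,
      ← integral_indicator measurableSet_Ioo]
    unfold convolution
    congr 1
    ext s
    rw [ContinuousLinearMap.lsmul_apply]
    by_cases hs : s ∈ Ioo 0 t
    · rw [indicator_of_mem hs, hW1 (t - s) ⟨by linarith [hs.2], by linarith [hs.1, ht.2]⟩]
      simp only [weightedBeta, indicator_of_mem (show s ∈ Ioi (0 : ℝ) from hs.1)]
    · rw [indicator_of_notMem hs]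
      by_cases h0 : 0 < s
      · rw [hW0 (t - s) (by
          by_contra h
          exact hs ⟨h0, by linarith⟩), smul_zero]
      · simp only [weightedBeta, indicator_of_notMem (show s ∉ Ioi (0 : ℝ) from h0), zero_smul]
  refine key.trans_eq ?_
  rw [intervalIntegral.integral_of_le hτ.1, ← integral_indicator measurableSet_Ioc]
  congr 1
  ext t
  by_cases ht : t ∈ Ioc 0 τ
  · have htT : t ∈ Icc 0 T := ⟨ht.1.le, ht.2.trans hτ.2⟩
    rw [indicator_of_mem ht, hconv t ht]
    simp only [V, causal, indicator_of_mem ht]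
    congr 1
    rw [IccExtend_of_mem hT _ htT, hv, IccExtend_of_mem hT _ htT]
    rfl
  · rw [indicator_of_notMem ht]
    simp [V, causal, ht]

end Positivity

/-! ### From scalar to Hilbert space valued positivity. -/

section Energy

set_option linter.unusedSectionVars false

variable {H : Type} [NormedAddCommGroup H] [InnerProductSpace ℝ H] [CompleteSpace H] {T : ℝ}

/-- A bounded operator that is symmetric and positive semidefinite. -/
structure IsSymmPos (C : H →L[ℝ] H) : Prop where
  symm : ∀ x y, ⟪C x, y⟫ = ⟪x, C y⟫
  nonneg : ∀ x, 0 ≤ ⟪C x, x⟫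

/-- Diagonalization of the compression of a symmetric operator to a finite-dimensional subspace. -/
theorem IsSymmPos.exists_diagonalization {C : H →L[ℝ] H} (hC : IsSymmPos C) (V : Submodule ℝ H)
    [FiniteDimensional ℝ V] : ∃ (n : ℕ) (e : Fin n → H) (μ : Fin n → ℝ), (∀ j, 0 ≤ μ j) ∧
      ∀ x y, ⟪C (V.starProjection x), V.starProjection y⟫ = ∑ j, μ j * (⟪e j, x⟫ * ⟪e j, y⟫) := by
  -- The compression of `C` to `V` is symmetric on a finite-dimensional space, so it has an
  -- orthonormal eigenbasis, whatever the spectrum of `C` itself.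
  let S : V →ₗ[ℝ] V := (V.orthogonalProjectionOnto.comp (C.comp V.subtypeL)).toLinearMap
  have hS : ∀ p q : V, ⟪S p, q⟫ = ⟪C (p : H), (q : H)⟫ := fun p q => by
    change ⟪V.orthogonalProjectionOnto (C p), q⟫ = _
    rw [Submodule.inner_orthogonalProjectionOnto_eq_of_mem_right]
  have hsymm : S.IsSymmetric := fun p q => by
    rw [hS, hC.symm, real_inner_comm, ← hS, real_inner_comm]
  let e := hsymm.eigenvectorBasis rfl
  let μ := hsymm.eigenvalues rfl
  have hμ : ∀ j, S (e j) = μ j • e j := fun j => hsymm.apply_eigenvectorBasis rfl j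
  refine ⟨_, fun j => (e j : H), μ, fun j => ?_, fun x y => ?_⟩
  · have h1 := hS (e j) (e j)
    rw [hμ, real_inner_smul_left, real_inner_self_eq_norm_sq, e.norm_eq_one] at h1
    have := hC.nonneg (e j)
    linarith
  · have h1 := hS (V.orthogonalProjectionOnto x) (V.orthogonalProjectionOnto y)
    rw [← e.sum_inner_mul_inner] at h1
    refine h1.symm.trans (Finset.sum_congr rfl fun j _ => ?_)
    rw [hsymm, hμ, real_inner_smul_right, real_inner_comm,
      Submodule.inner_orthogonalProjectionOnto_eq_of_mem_left,
      Submodule.inner_orthogonalProjectionOnto_eq_of_mem_left, mul_assoc]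

/-- The range of `w` is compact, so the span of a finite `δ`-net comes uniformly close to it. -/
theorem exists_finiteDimensional_approx (w : CT T H) {δ : ℝ} (hδ : 0 < δ) :
    ∃ (V : Submodule ℝ H) (_ : FiniteDimensional ℝ V), ∀ t, ‖w t - V.starProjection (w t)‖ ≤ δ := by
  obtain ⟨s, hs, hsf, hcov⟩ := (isCompact_range w.continuous).finite_cover_balls hδ
  have := FiniteDimensional.span_of_finite ℝ hsf
  refine ⟨Submodule.span ℝ s, this, fun t => ?_⟩
  obtain ⟨x, hx, hxt⟩ := mem_iUnion₂.1 (hcov (mem_range_self t))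
  have h1 : ‖w t - (Submodule.span ℝ s).starProjection (w t)‖ ≤ ‖w t - x‖ := by
    rw [Submodule.starProjection_minimal]
    exact ciInf_le ⟨0, by rintro _ ⟨y, rfl⟩; positivity⟩
      (⟨x, Submodule.subset_span hx⟩ : Submodule.span ℝ s)
  refine h1.trans ?_
  rw [← dist_eq_norm]
  exact (Metric.mem_ball.1 hxt).le

theorem inner_integral_bound (hT : 0 ≤ T) (C : H →L[ℝ] H) (p q p' q' : CT T H) {τ : ℝ}
    (hτ : τ ∈ Icc 0 T) :
    |(∫ t in (0 : ℝ)..τ, ⟪C (IccExtend hT p t), IccExtend hT q t⟫)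
      - ∫ t in (0 : ℝ)..τ, ⟪C (IccExtend hT p' t), IccExtend hT q' t⟫|
      ≤ ‖C‖ * (‖p - p'‖ * ‖q‖ + ‖p'‖ * ‖q - q'‖) * T := by
  have hc : ∀ p q : CT T H, Continuous fun t => ⟪C (IccExtend hT p t), IccExtend hT q t⟫ :=
    fun p q => (C.continuous.comp (continuous_IccExtend hT p)).inner (continuous_IccExtend hT q)
  rw [← intervalIntegral.integral_sub ((hc p q).intervalIntegrable _ _)
    ((hc p' q').intervalIntegrable _ _)]
  have h0 : 0 ≤ ‖C‖ * (‖p - p'‖ * ‖q‖ + ‖p'‖ * ‖q - q'‖) := by positivity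
  rw [← Real.norm_eq_abs]
  refine (intervalIntegral.norm_integral_le_of_norm_le_const
    (C := ‖C‖ * (‖p - p'‖ * ‖q‖ + ‖p'‖ * ‖q - q'‖)) fun t _ => ?_).trans ?_
  · have e : ⟪C (IccExtend hT p t), IccExtend hT q t⟫ - ⟪C (IccExtend hT p' t), IccExtend hT q' t⟫
        = ⟪C (IccExtend hT (p - p') t), IccExtend hT q t⟫
          + ⟪C (IccExtend hT p' t), IccExtend hT (q - q') t⟫ := by
      change _ = ⟪C (IccExtend hT p t - IccExtend hT p' t), IccExtend hT q t⟫
        + ⟪C (IccExtend hT p' t), IccExtend hT q t - IccExtend hT q' t⟫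
      rw [map_sub, inner_sub_left, inner_sub_right]
      ring
    have hb : ∀ p q : CT T H, ‖⟪C (IccExtend hT p t), IccExtend hT q t⟫‖ ≤ ‖C‖ * (‖p‖ * ‖q‖) :=
      fun p q => by
        refine (norm_inner_le_norm _ _).trans ?_
        rw [← mul_assoc]
        exact mul_le_mul (C.le_opNorm_of_le (norm_IccExtend_le hT p t)) (norm_IccExtend_le hT q t)
          (norm_nonneg _) (by positivity)
    rw [e, mul_add]
    exact (norm_add_le _ _).trans (add_le_add (hb (p - p') q) (hb p' (q - q')))
  · rw [sub_zero, abs_of_nonneg hτ.1]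
    exact mul_le_mul_of_nonneg_left hτ.2 h0

/-- Positivity of the memory form for Hilbert space valued functions. -/
theorem integral_inner_conv_nonneg (hT : 0 ≤ T) {σ a : ℝ} (hσ : 0 < σ) (ha : 0 < a) (ha1 : a < 1)
    (k : CT T ℝ) (hk : ∫ s in Ioc 0 T, |IccExtend hT k s| ≤ Real.cos (a * (Real.pi / 2)) / 2)
    {C : H →L[ℝ] H} (hC : IsSymmPos C) (w : CT T H) {τ : ℝ} (hτ : τ ∈ Icc 0 T) :
    0 ≤ ∫ t in (0 : ℝ)..τ, ⟪C (conv (expKernel σ (beta a)) (IccExtend hT w) t),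
      IccExtend hT w t + conv (IccExtend hT k) (IccExtend hT w) t⟫ := by
  have h1 : IsKernel T (expKernel σ (beta a)) := integrableOn_expKernel (isKernel_beta ha T hT) σ
  have h2 := isKernel_IccExtend hT k
  let P : CT T H → CT T H := fun w => convCT hT _ h1 w
  let R : CT T H → CT T H := fun w => w + convCT hT _ h2 w
  have hform : ∀ w : CT T H, ∫ t in (0 : ℝ)..τ, ⟪C (conv (expKernel σ (beta a)) (IccExtend hT w) t),
      IccExtend hT w t + conv (IccExtend hT k) (IccExtend hT w) t⟫
      = ∫ t in (0 : ℝ)..τ, ⟪C (IccExtend hT (P w) t), IccExtend hT (R w) t⟫ := fun w => by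
    refine intervalIntegral.integral_congr fun t ht => ?_
    rw [uIcc_of_le hτ.1] at ht
    have htT : t ∈ Icc 0 T := ⟨ht.1, ht.2.trans hτ.2⟩
    simp only [IccExtend_of_mem hT _ htT]
    rfl
  rw [hform]
  set M1 := ∫ s in Ioc 0 T, |expKernel σ (beta a) s|
  set M2 := ∫ s in Ioc 0 T, |IccExtend hT k s|
  have hM1 : 0 ≤ M1 := integral_nonneg fun _ => abs_nonneg _
  have hM2 : 0 ≤ M2 := integral_nonneg fun _ => abs_nonneg _
  have hP : ∀ w, ‖P w‖ ≤ M1 * ‖w‖ := fun w => norm_convCT_le hT h1 w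
  have hR : ∀ w, ‖R w‖ ≤ (1 + M2) * ‖w‖ := fun w => by
    have := norm_convCT_le hT h2 w
    refine (norm_add_le _ _).trans ?_
    linarith
  -- For projected functions the form splits into scalar forms of the coordinates `⟪e j, w⟫`,
  -- weighted by the nonnegative eigenvalues. Projection commutes with scalar convolution.
  have hfin : ∀ (V : Submodule ℝ H) [FiniteDimensional ℝ V],
      0 ≤ ∫ t in (0 : ℝ)..τ, ⟪C (IccExtend hT (P (pointwise V.starProjection w)) t),
        IccExtend hT (R (pointwise V.starProjection w)) t⟫ := fun V _ => by
    obtain ⟨n, e, μ, hμ, hdiag⟩ := hC.exists_diagonalization V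
    let wj : Fin n → CT T ℝ := fun j => pointwise (innerSL ℝ (e j)) w
    have e1 : P (pointwise V.starProjection w) = pointwise V.starProjection (P w) :=
      (pointwise_convCT hT h1 _ w).symm
    have e2 : R (pointwise V.starProjection w) = pointwise V.starProjection (R w) := by
      simp only [R]
      rw [← pointwise_convCT, pointwise_add]
    have e3 : ∀ t ∈ Icc 0 T, ⟪C (IccExtend hT (P (pointwise V.starProjection w)) t),
        IccExtend hT (R (pointwise V.starProjection w)) t⟫
        = ∑ j, μ j * (conv (expKernel σ (beta a)) (IccExtend hT (wj j)) t
          * (IccExtend hT (wj j) t + conv (IccExtend hT k) (IccExtend hT (wj j)) t)) := fun t ht => by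
      rw [e1, e2, IccExtend_of_mem hT _ ht, IccExtend_of_mem hT _ ht, pointwise_apply,
        pointwise_apply, hdiag]
      refine Finset.sum_congr rfl fun j _ => ?_
      have f1 := congrArg (fun q : CT T ℝ => q ⟨t, ht⟩) (pointwise_convCT hT h1 (innerSL ℝ (e j)) w)
      have f2 := congrArg (fun q : CT T ℝ => q ⟨t, ht⟩) (pointwise_convCT hT h2 (innerSL ℝ (e j)) w)
      simp only [pointwise_apply, innerSL_apply_apply, convCT_apply] at f1 f2
      have f3 : ⟪e j, P w ⟨t, ht⟩⟫ = conv (expKernel σ (beta a)) (IccExtend hT (wj j)) t := f1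
      have f4 : ⟪e j, R w ⟨t, ht⟩⟫ = IccExtend hT (wj j) t
          + conv (IccExtend hT k) (IccExtend hT (wj j)) t := by
        rw [IccExtend_of_mem hT _ ht]
        refine Eq.trans ?_ (congrArg (⟪e j, w ⟨t, ht⟩⟫ + ·) f2)
        exact inner_add_right _ _ _
      rw [f3, f4]
    have e4 : ∫ t in (0 : ℝ)..τ, ⟪C (IccExtend hT (P (pointwise V.starProjection w)) t),
        IccExtend hT (R (pointwise V.starProjection w)) t⟫
        = ∑ j, μ j * ∫ t in (0 : ℝ)..τ, (conv (expKernel σ (beta a)) (IccExtend hT (wj j)) t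
          * (IccExtend hT (wj j) t + conv (IccExtend hT k) (IccExtend hT (wj j)) t)) := by
      simp_rw [← intervalIntegral.integral_const_mul]
      rw [← intervalIntegral.integral_finsetSum]
      · refine intervalIntegral.integral_congr fun t ht => ?_
        rw [uIcc_of_le hτ.1] at ht
        exact e3 t ⟨ht.1, ht.2.trans hτ.2⟩
      · intro j _
        refine ContinuousOn.intervalIntegrable ?_
        rw [uIcc_of_le hτ.1]
        have hsub : Icc 0 τ ⊆ Icc 0 T := Icc_subset_Icc_right hτ.2
        exact continuousOn_const.mul (((continuousOn_conv hT h1 (wj j)).mono hsub).mul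
          ((continuous_IccExtend hT (wj j)).continuousOn.add
            ((continuousOn_conv hT h2 (wj j)).mono hsub)))
    rw [e4]
    exact Finset.sum_nonneg fun j _ => mul_nonneg (hμ j)
      (integral_conv_mul_nonneg hT hσ ha ha1 k hk (wj j) hτ)
  refine le_of_forall_pos_le_add fun ε hε => ?_
  -- `K δ` bounds the change of the form when `w` moves by `δ` under a projection. Dividing by `K +
  -- 1` below avoids a case distinction at `K = 0`.
  set K := ‖C‖ * (M1 * ((1 + M2) * ‖w‖) + M1 * ‖w‖ * (1 + M2)) * T
  have hK : 0 ≤ K := by positivity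
  obtain ⟨V, hV, hVw⟩ := exists_finiteDimensional_approx w (δ := ε / (K + 1)) (by positivity)
  set w' := pointwise V.starProjection w
  have hd : ‖w - w'‖ ≤ ε / (K + 1) := (ContinuousMap.norm_le _ (by positivity)).2 fun t => hVw t
  have hw' : ‖w'‖ ≤ ‖w‖ := (ContinuousMap.norm_le _ (norm_nonneg _)).2 fun t =>
    (V.norm_starProjection_apply_le (w t)).trans (w.norm_coe_le_norm t)
  have hb := inner_integral_bound hT C (P w) (R w) (P w') (R w') hτ
  have hPs : P w - P w' = P (w - w') := (convCT_sub hT h1 w w').symm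
  have hRs : R w - R w' = R (w - w') := by
    simp only [R, convCT_sub]
    abel
  rw [hPs, hRs] at hb
  have hb2 : ‖C‖ * (‖P (w - w')‖ * ‖R w‖ + ‖P w'‖ * ‖R (w - w')‖) * T ≤ K * (ε / (K + 1)) := by
    have g1 : ‖P (w - w')‖ ≤ M1 * (ε / (K + 1)) := (hP _).trans (by gcongr)
    have g2 : ‖R (w - w')‖ ≤ (1 + M2) * (ε / (K + 1)) := (hR _).trans (by gcongr)
    have g3 : ‖P w'‖ ≤ M1 * ‖w‖ := (hP _).trans (by gcongr)
    calc _ ≤ ‖C‖ * (M1 * (ε / (K + 1)) * ((1 + M2) * ‖w‖)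
          + M1 * ‖w‖ * ((1 + M2) * (ε / (K + 1)))) * T := by
          refine mul_le_mul_of_nonneg_right (mul_le_mul_of_nonneg_left (add_le_add
            (mul_le_mul g1 (hR w) (norm_nonneg _) (by positivity))
            (mul_le_mul g3 g2 (norm_nonneg _) (by positivity))) (norm_nonneg _)) hT
      _ = _ := by simp only [K]; ring
  have hb3 : K * (ε / (K + 1)) ≤ ε := by
    rw [mul_div_assoc', div_le_iff₀ (by positivity)]
    nlinarith
  have := hfin V
  have := (abs_le.1 hb).1
  linarith

end Energy

/-! ### Energy estimate for a continuous perturbation kernel. -/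

section EnergyEstimate

set_option linter.unusedSectionVars false

variable {H : Type} [NormedAddCommGroup H] [InnerProductSpace ℝ H] [CompleteSpace H] {T : ℝ}

theorem isKernel_one (T : ℝ) : IsKernel T (fun _ => 1) := by
  change IntegrableOn _ _ _
  exact integrableOn_const (by simp)

theorem conv_one (q : ℝ → H) (t : ℝ) : conv (fun _ => (1 : ℝ)) q t = ∫ s in (0 : ℝ)..t, q s := by
  simp [conv]

theorem conv_one_beta {a : ℝ} (ha : 0 < a) {t : ℝ} :
    conv (fun _ => (1 : ℝ)) (beta a) t = beta (1 + a) t := by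
  rw [conv_one]
  simp only [beta]
  rw [intervalIntegral.integral_div, integral_rpow (Or.inl (by linarith)),
    Real.zero_rpow (by linarith), show (1 : ℝ) + a - 1 = a by ring, add_comm 1 a,
    Real.Gamma_add_one ha.ne']
  simp only [sub_add_cancel, sub_zero]
  rw [div_div]

/-- The semigroup law `β_{1+a} = 1 * β_a` exhibits the memory term as a primitive, so the integrated
equation can be differentiated even though `y` is only continuous. -/
theorem convCT_beta_one_add (hT : 0 ≤ T) {a : ℝ} (ha : 0 < a) (q : CT T H) :
    convCT hT _ (isKernel_beta (by linarith : 0 < 1 + a) T hT) q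
      = convCT hT _ (isKernel_one T) (convCT hT _ (isKernel_beta ha T hT) q) := by
  rw [convCT_comp]
  exact convCT_congr _ _ _ (fun s _ => (conv_one_beta ha).symm) q

theorem conv_beta_one_add (hT : 0 ≤ T) {a : ℝ} (ha : 0 < a) (q : CT T H) {t : ℝ}
    (ht : t ∈ Icc 0 T) : conv (beta (1 + a)) (IccExtend hT q) t
      = ∫ s in (0 : ℝ)..t, IccExtend hT (convCT hT _ (isKernel_beta ha T hT) q) s := by
  have := congrArg (fun q : CT T H => q ⟨t, ht⟩) (convCT_beta_one_add hT ha q)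
  simp only [convCT_apply, conv_one] at this
  exact this

theorem cos_mul_pi_div_two_pos {a : ℝ} (ha : 0 < a) (ha1 : a < 1) :
    0 < Real.cos (a * (Real.pi / 2)) :=
  Real.cos_pos_of_mem_Ioo ⟨by nlinarith [Real.pi_pos], by nlinarith [Real.pi_pos]⟩

theorem le_add_of_sq_le {M c I : ℝ} (hc : 0 ≤ c) (hI : 0 ≤ I) (h : M ^ 2 ≤ c ^ 2 + 2 * M * I) :
    M ≤ c + 2 * I := by
  by_contra! hM
  nlinarith

/-- Weighted energy estimate for the integrated memory equation. -/
theorem energy_weighted (hT : 0 ≤ T) {σ a : ℝ} (hσ : 0 < σ) (ha : 0 < a) (ha1 : a < 1) (k : CT T ℝ)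
    (hk : ∫ s in Ioc 0 T, |IccExtend hT (expMul σ k) s| ≤ Real.cos (a * (Real.pi / 2)) / 2)
    {B : H →L[ℝ] H} (hB : IsSymmPos B) (c : H) (F y : CT T H)
    (hy : ∀ t : Icc (0 : ℝ) T, y t + B (conv (beta (1 + a)) (IccExtend hT y) t)
      + conv (IccExtend hT k) (IccExtend hT y) t = c + ∫ s in (0 : ℝ)..t, IccExtend hT F s) :
    ‖expMul σ (y + convCT hT _ (isKernel_IccExtend hT k) y)‖
      ≤ ‖c‖ + 2 * ∫ s in Ioc 0 T, ‖IccExtend hT F s‖ := by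
  set v : CT T H := y + convCT hT _ (isKernel_IccExtend hT k) y
  set A : CT T H := convCT hT _ (isKernel_beta ha T hT) y
  set w : CT T H := expMul σ y
  set M := ‖expMul σ v‖
  set I := ∫ s in Ioc 0 T, ‖IccExtend hT F s‖
  have hI : 0 ≤ I := integral_nonneg fun _ => norm_nonneg _
  let Z : ℝ → H := fun t => IccExtend hT F t - B (IccExtend hT A t)
  have hFc := continuous_IccExtend hT F
  have hBAc : Continuous fun t => B (IccExtend hT A t) :=
    B.continuous.comp (continuous_IccExtend hT A)
  have hZ : Continuous Z := hFc.sub hBAc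
  -- `V` extends `v = y + k * y` from `[0,T]` to a differentiable function on the line, with
  -- derivative `Z = F - B (β_a * y)`.
  let V : ℝ → H := fun t => c + ∫ s in (0 : ℝ)..t, Z s
  have hV : ∀ t, HasDerivAt V (Z t) t := fun t =>
    (intervalIntegral.integral_hasDerivAt_right (hZ.intervalIntegrable _ _)
      hZ.stronglyMeasurable.stronglyMeasurableAtFilter hZ.continuousAt).const_add c
  have hVc : Continuous V := continuous_iff_continuousAt.2 fun t => (hV t).continuousAt
  have hvV : ∀ t (ht : t ∈ Icc 0 T), v ⟨t, ht⟩ = V t := fun t ht => by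
    have h1 := hy ⟨t, ht⟩
    rw [conv_beta_one_add hT ha y ht,
      ← B.intervalIntegral_comp_comm ((continuous_IccExtend hT A).intervalIntegrable _ _)] at h1
    simp only [V, Z]
    rw [intervalIntegral.integral_sub (hFc.intervalIntegrable _ _) (hBAc.intervalIntegrable _ _),
      ← add_sub_assoc, ← h1]
    simp only [v, ContinuousMap.add_apply, convCT_apply, A]
    abel
  have hderiv : ∀ t, HasDerivAt (fun t => Real.exp (-(2 * σ) * t) * ‖V t‖ ^ 2)
      (-(2 * σ) * (Real.exp (-(2 * σ) * t) * ‖V t‖ ^ 2)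
        + Real.exp (-(2 * σ) * t) * (2 * ⟪V t, Z t⟫)) t := fun t => by
    have h1 : HasDerivAt (fun t : ℝ => Real.exp (-(2 * σ) * t))
        (Real.exp (-(2 * σ) * t) * (-(2 * σ))) t := by
      simpa using ((hasDerivAt_id t).const_mul (-(2 * σ))).exp
    convert! h1.mul (hV t).norm_sq using 1
    ring
  have hmain : ∀ t ∈ Icc 0 T, Real.exp (-(2 * σ) * t) * ‖V t‖ ^ 2 ≤ ‖c‖ ^ 2 + 2 * M * I := by
    intro t ht
    have hVZ : Continuous fun s => ⟪V s, Z s⟫ := hVc.inner hZ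
    have hc1 : Continuous fun s : ℝ => Real.exp (-(2 * σ) * s) := by fun_prop
    have ftc := intervalIntegral.integral_eq_sub_of_hasDerivAt (a := 0) (b := t)
      (fun s _ => hderiv s) (Continuous.intervalIntegrable (by fun_prop) _ _)
    have hV0 : V 0 = c := by simp [V]
    simp only [hV0, mul_zero, Real.exp_zero, one_mul] at ftc
    have hpos := integral_inner_conv_nonneg hT hσ ha ha1 (expMul σ k) hk hB w ht
    -- The weight `exp (-2σs)` splits into one factor `exp (-σs)` on each side of the inner product,
    -- which gives exactly the memory form of the weighted function `w`.
    have hform : ∀ s ∈ Icc 0 t, ⟪B (conv (expKernel σ (beta a)) (IccExtend hT w) s),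
        IccExtend hT w s + conv (IccExtend hT (expMul σ k)) (IccExtend hT w) s⟫
        = Real.exp (-(2 * σ) * s) * ⟪V s, B (IccExtend hT A s)⟫ := fun s hs => by
      have hsT : s ∈ Icc 0 T := ⟨hs.1, hs.2.trans ht.2⟩
      have f1 := congrArg (fun q : CT T H => q ⟨s, hsT⟩)
        (expMul_convCT hT (isKernel_beta ha T hT) σ y)
      have f2 := congrArg (fun q : CT T H => q ⟨s, hsT⟩)
        (expMul_convCT hT (isKernel_IccExtend hT k) σ y)
      simp only [convCT_apply, expMul_apply] at f1 f2
      have f3 : conv (IccExtend hT (expMul σ k)) (IccExtend hT w) s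
          = conv (expKernel σ (IccExtend hT k)) (IccExtend hT w) s := by
        refine conv_congr hs.1 (fun r hr => ?_) fun _ _ => rfl
        have hrT : r ∈ Icc 0 T := ⟨hr.1.le, hr.2.le.trans hsT.2⟩
        rw [IccExtend_of_mem hT _ hrT, expKernel, IccExtend_of_mem hT _ hrT, expMul_apply,
          smul_eq_mul]
      rw [f3, ← f1, ← f2, IccExtend_of_mem hT _ hsT, IccExtend_of_mem hT _ hsT, ← hvV s hsT]
      change ⟪B (Real.exp (-(σ * s)) • A ⟨s, hsT⟩), Real.exp (-(σ * s)) • y ⟨s, hsT⟩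
        + Real.exp (-(σ * s)) • (convCT hT _ (isKernel_IccExtend hT k) y) ⟨s, hsT⟩⟫ = _
      rw [← smul_add, map_smul, real_inner_smul_left, real_inner_smul_right, ← mul_assoc,
        ← Real.exp_add, real_inner_comm]
      congr 2
      ring
    have hpos' : 0 ≤ ∫ s in (0 : ℝ)..t, Real.exp (-(2 * σ) * s) * ⟪V s, B (IccExtend hT A s)⟫ := by
      refine hpos.trans_eq (intervalIntegral.integral_congr fun s hs => ?_)
      rw [uIcc_of_le ht.1] at hs
      exact hform s hs
    have hVB : Continuous fun s => ⟪V s, B (IccExtend hT A s)⟫ := hVc.inner hBAc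
    have hVF : Continuous fun s => ⟪V s, IccExtend hT F s⟫ := hVc.inner hFc
    have hle : ∫ s in (0 : ℝ)..t, (-(2 * σ) * (Real.exp (-(2 * σ) * s) * ‖V s‖ ^ 2)
        + Real.exp (-(2 * σ) * s) * (2 * ⟪V s, Z s⟫))
        ≤ ∫ s in (0 : ℝ)..t, (2 * M * ‖IccExtend hT F s‖
          - 2 * (Real.exp (-(2 * σ) * s) * ⟪V s, B (IccExtend hT A s)⟫)) := by
      refine intervalIntegral.integral_mono_on ht.1 (Continuous.intervalIntegrable (by fun_prop) _ _)
        (Continuous.intervalIntegrable (by fun_prop) _ _) fun s hs => ?_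
      have hsT : s ∈ Icc 0 T := ⟨hs.1, hs.2.trans ht.2⟩
      -- The derivative of the weight contributes a term of favourable sign, which is discarded.
      have g1 : 0 ≤ 2 * σ * (Real.exp (-(2 * σ) * s) * ‖V s‖ ^ 2) := by positivity
      have g2 : Real.exp (-(2 * σ) * s) * ⟪V s, IccExtend hT F s⟫ ≤ M * ‖IccExtend hT F s‖ := by
        have b1 : Real.exp (-(σ * s)) * ‖V s‖ ≤ M := by
          have := (expMul σ v).norm_coe_le_norm ⟨s, hsT⟩
          rwa [expMul_apply, norm_smul, Real.norm_eq_abs, Real.abs_exp, hvV s hsT] at this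
        have b2 : Real.exp (-(σ * s)) ≤ 1 := Real.exp_le_one_iff.2 (by
          have := mul_nonneg hσ.le hs.1; linarith)
        have b3 := real_inner_le_norm (V s) (IccExtend hT F s)
        have b4 : Real.exp (-(2 * σ) * s) = Real.exp (-(σ * s)) * Real.exp (-(σ * s)) := by
          rw [← Real.exp_add]; ring_nf
        calc _ ≤ Real.exp (-(σ * s)) * Real.exp (-(σ * s)) * (‖V s‖ * ‖IccExtend hT F s‖) := by
              rw [b4]; exact mul_le_mul_of_nonneg_left b3 (by positivity)
          _ = Real.exp (-(σ * s)) * ((Real.exp (-(σ * s)) * ‖V s‖) * ‖IccExtend hT F s‖) := by ring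
          _ ≤ 1 * (M * ‖IccExtend hT F s‖) := mul_le_mul b2
              (mul_le_mul_of_nonneg_right b1 (norm_nonneg _)) (by positivity) zero_le_one
          _ = _ := one_mul _
      simp only [Z, inner_sub_right]
      linarith
    rw [ftc, intervalIntegral.integral_sub (Continuous.intervalIntegrable (by fun_prop) _ _)
      (Continuous.intervalIntegrable (by fun_prop) _ _), intervalIntegral.integral_const_mul,
      intervalIntegral.integral_const_mul] at hle
    have hFI : ∫ s in (0 : ℝ)..t, ‖IccExtend hT F s‖ ≤ I := by
      rw [intervalIntegral.integral_of_le ht.1]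
      exact setIntegral_mono_set (hFc.norm.integrableOn_Ioc)
        (Eventually.of_forall fun _ => norm_nonneg _) (Ioc_subset_Ioc_right ht.2).eventuallyLE
    have hM0 : 0 ≤ 2 * M := mul_nonneg zero_le_two (norm_nonneg _)
    have := mul_le_mul_of_nonneg_left hFI hM0
    linarith
  -- The supremum over `t` turns the pointwise bound into the quadratic inequality `M² ≤ ‖c‖² + 2 M
  -- I`.
  refine le_add_of_sq_le (norm_nonneg _) hI ?_
  have hR : 0 ≤ ‖c‖ ^ 2 + 2 * M * I := by positivity
  rw [← Real.le_sqrt (norm_nonneg _) hR]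
  refine (ContinuousMap.norm_le _ (Real.sqrt_nonneg _)).2 fun t => ?_
  refine Real.le_sqrt_of_sq_le ((le_of_eq ?_).trans (hmain t t.2))
  rw [expMul_apply, norm_smul, Real.norm_eq_abs, Real.abs_exp, mul_pow, ← Real.exp_nat_mul,
    hvV t t.2]
  congr 2
  push_cast
  ring

/-- Energy estimate for a continuous perturbation kernel, uniform in the operator. -/
theorem energy_continuous (hT : 0 ≤ T) {σ a : ℝ} (hσ : 0 < σ) (ha : 0 < a) (ha1 : a < 1)
    (k : CT T ℝ)
    (hk : ∫ s in Ioc 0 T, |IccExtend hT (expMul σ k) s| ≤ Real.cos (a * (Real.pi / 2)) / 2)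
    {B : H →L[ℝ] H} (hB : IsSymmPos B) (c : H) (F y : CT T H)
    (hy : ∀ t : Icc (0 : ℝ) T, y t + B (conv (beta (1 + a)) (IccExtend hT y) t)
      + conv (IccExtend hT k) (IccExtend hT y) t = c + ∫ s in (0 : ℝ)..t, IccExtend hT F s) :
    ‖y‖ ≤ Real.exp (σ * T) * (2 * (‖c‖ + 2 * ∫ s in Ioc 0 T, ‖IccExtend hT F s‖)) := by
  have h := energy_weighted hT hσ ha ha1 k hk hB c F y hy
  refine (norm_le_expMul hσ.le y).trans (mul_le_mul_of_nonneg_left ?_ (Real.exp_pos _).le)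
  rw [expMul_add, expMul_convCT] at h
  -- The weighted kernel has mass at most `1/2`, so `y` is recovered from `y + k * y` at the cost of
  -- a factor `2`.
  have h1 : ∫ s in Ioc 0 T, |expKernel σ (IccExtend hT k) s| ≤ 1 / 2 := by
    have : ∫ s in Ioc 0 T, |expKernel σ (IccExtend hT k) s|
        = ∫ s in Ioc 0 T, |IccExtend hT (expMul σ k) s| :=
      setIntegral_congr_fun measurableSet_Ioc fun s hs => by
        have hs' := Ioc_subset_Icc_self hs
        simp only [IccExtend_of_mem hT _ hs', expKernel, expMul_apply, smul_eq_mul]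
    rw [this]
    linarith [Real.cos_le_one (a * (Real.pi / 2))]
  have h2 := (norm_convCT_le hT (integrableOn_expKernel (isKernel_IccExtend hT k) σ)
    (expMul σ y)).trans (mul_le_mul_of_nonneg_right h1 (norm_nonneg _))
  have h3 := norm_le_add_norm_add (expMul σ y)
    (convCT hT _ (integrableOn_expKernel (isKernel_IccExtend hT k) σ) (expMul σ y))
  linarith

end EnergyEstimate

/-! ### Energy estimate for an integrable perturbation kernel. -/

section EnergyIntegrable

set_option linter.unusedSectionVars false

variable {H : Type} [NormedAddCommGroup H] [InnerProductSpace ℝ H] [CompleteSpace H] {T : ℝ}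

/-- The primitive of an integrable function, as an element of `C([0,T]; H)`. -/
def primitiveCT (hT : 0 ≤ T) (F : ℝ → H) (hF : IntegrableOn F (Ioc 0 T) volume) : CT T H :=
  ⟨fun t => ∫ s in (0 : ℝ)..t, F s, by
    have h := intervalIntegral.continuousOn_primitive_interval (μ := volume) (f := F) (a := 0)
      (b := T) (by rwa [uIcc_of_le hT, integrableOn_Icc_iff_integrableOn_Ioc])
    rw [uIcc_of_le hT] at h
    exact continuousOn_iff_continuous_domRestrict.1 h⟩

theorem norm_intervalIntegral_le (F : ℝ → H) (hF : IntegrableOn F (Ioc 0 T) volume)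
    {t : ℝ} (ht : t ∈ Icc 0 T) : ‖∫ s in (0 : ℝ)..t, F s‖ ≤ ∫ s in Ioc 0 T, ‖F s‖ := by
  rw [intervalIntegral.integral_of_le ht.1]
  exact (norm_integral_le_integral_norm _).trans (setIntegral_mono_set hF.norm
    (Eventually.of_forall fun _ => norm_nonneg _) (Ioc_subset_Ioc_right ht.2).eventuallyLE)

theorem intervalIntegrable_of_mem {F : ℝ → H} (hF : IntegrableOn F (Ioc 0 T) volume)
    {t : ℝ} (ht : t ∈ Icc 0 T) : IntervalIntegrable F volume 0 t :=
  (intervalIntegrable_iff_integrableOn_Ioc_of_le ht.1).2 (hF.mono_set (Ioc_subset_Ioc_right ht.2))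

theorem exists_continuous_approx {Y : Type} [NormedAddCommGroup Y] [NormedSpace ℝ Y] (hT : 0 ≤ T)
    {F : ℝ → Y} (hF : IntegrableOn F (Ioc 0 T) volume) {ε : ℝ} (hε : 0 < ε) :
    ∃ G : CT T Y, ∫ s in Ioc 0 T, ‖F s - IccExtend hT G s‖ ≤ ε := by
  obtain ⟨G, -, h1, h2, -⟩ := hF.integrable.exists_hasCompactSupport_integral_sub_le hε
  refine ⟨⟨fun t => G t, h2.comp continuous_subtype_val⟩, le_trans (le_of_eq ?_) h1⟩
  refine setIntegral_congr_fun measurableSet_Ioc fun s hs => ?_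
  rw [IccExtend_of_mem hT _ (Ioc_subset_Icc_self hs)]
  rfl

/-- Energy estimate for an integrable perturbation kernel, uniform in the operator. -/
theorem energy_integrable (hT : 0 ≤ T) {a : ℝ} (ha : 0 < a) (ha1 : a < 1) {γ : ℝ → ℝ}
    (hγ : IsKernel T γ) : ∃ Q : ℝ, 0 < Q ∧ ∀ {B : H →L[ℝ] H}, IsSymmPos B → ∀ (c : H) (F : ℝ → H),
      IntegrableOn F (Ioc 0 T) volume → ∀ y : CT T H,
      (∀ t : Icc (0 : ℝ) T, y t + B (conv (beta (1 + a)) (IccExtend hT y) t)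
        + conv γ (IccExtend hT y) t = c + ∫ s in (0 : ℝ)..t, F s) →
      ‖y‖ ≤ Q * (‖c‖ + ∫ s in Ioc 0 T, ‖F s‖) := by
  have hcos := cos_mul_pi_div_two_pos ha ha1
  set θ := Real.cos (a * (Real.pi / 2))
  -- `σ` is chosen from `γ` alone. A margin `θ/4` is kept so that every `ε`-approximation of `γ`
  -- with `ε ≤ θ/4` still has weighted mass at most `θ/2`.
  obtain ⟨σ, h1, hσ⟩ := ((exists_weight hγ (show 0 < θ / 4 by positivity)).and
    (eventually_gt_atTop 0)).exists
  refine ⟨Real.exp (σ * T) * 4, by positivity, fun {B} hB c F hF y hy => ?_⟩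
  have hβ := isKernel_beta (by linarith : 0 < 1 + a) T hT
  -- This `C` does depend on `B`, but it only multiplies terms that vanish with `ε`, so it is absent
  -- from the final constant.
  obtain ⟨C, hC, hstab⟩ := volterra_bound hT B hβ hγ
  set J := ∫ s in Ioc 0 T, ‖F s‖
  have hJ : 0 ≤ J := integral_nonneg fun _ => norm_nonneg _
  let N : ℝ → ℝ := fun ε => Real.exp (σ * T) * (2 * (‖c‖ + 2 * (J + ε)))
  have key : ∀ ε ∈ Ioc 0 (θ / 4), ‖y‖ ≤ N ε + C * (ε + ε * N ε) := by
    intro ε hε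
    obtain ⟨k, hk⟩ := exists_continuous_approx hT hγ hε.1
    obtain ⟨F', hF'⟩ := exists_continuous_approx hT hF hε.1
    have hkI := isKernel_IccExtend hT k
    have hF'I : IntegrableOn (IccExtend hT F') (Ioc 0 T) volume :=
      (continuous_IccExtend hT F').integrableOn_Ioc
    obtain ⟨y', hy'⟩ := volterra_exists hT B hβ hkI
      (ContinuousMap.const _ c + primitiveCT hT _ hF'I)
    have hy't : ∀ t : Icc (0 : ℝ) T, y' t + B (conv (beta (1 + a)) (IccExtend hT y') t)
        + conv (IccExtend hT k) (IccExtend hT y') t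
        = c + ∫ s in (0 : ℝ)..t, IccExtend hT F' s := fun t =>
      congrArg (fun q : CT T H => q t) hy'
    have hkσ : ∫ s in Ioc 0 T, |IccExtend hT (expMul σ k) s| ≤ θ / 2 := by
      have g1 : ∫ s in Ioc 0 T, |IccExtend hT (expMul σ k) s|
          ≤ ∫ s in Ioc 0 T, (|expKernel σ γ s| + ‖γ s - IccExtend hT k s‖) := by
        refine setIntegral_mono_on (isKernel_IccExtend hT _).abs
          ((integrableOn_expKernel hγ σ).abs.add (hγ.sub hkI).norm) measurableSet_Ioc
          fun s hs => ?_
        have hs' := Ioc_subset_Icc_self hs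
        rw [IccExtend_of_mem hT _ hs', IccExtend_of_mem hT _ hs', expMul_apply, smul_eq_mul,
          expKernel]
        have e : Real.exp (-(σ * s)) * k ⟨s, hs'⟩ = Real.exp (-(σ * s)) * γ s
            - Real.exp (-(σ * s)) * (γ s - k ⟨s, hs'⟩) := by ring
        have b : Real.exp (-(σ * s)) ≤ 1 := Real.exp_le_one_iff.2 (by
          have := mul_nonneg hσ.le hs.1.le; linarith)
        have b2 : |Real.exp (-(σ * s)) * (γ s - k ⟨s, hs'⟩)| ≤ ‖γ s - k ⟨s, hs'⟩‖ := by
          rw [abs_mul, Real.abs_exp]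
          exact mul_le_of_le_one_left (abs_nonneg _) b
        simp only at *
        rw [e]
        exact (abs_sub _ _).trans (add_le_add le_rfl b2)
      rw [integral_add (integrableOn_expKernel hγ σ).abs (show IntegrableOn
        (fun s => ‖γ s - IccExtend hT k s‖) (Ioc 0 T) volume from (hγ.sub hkI).norm)] at g1
      linarith [hε.2]
    have hJ' : ∫ s in Ioc 0 T, ‖IccExtend hT F' s‖ ≤ J + ε := by
      have g1 : ∫ s in Ioc 0 T, ‖IccExtend hT F' s‖
          ≤ ∫ s in Ioc 0 T, (‖F s‖ + ‖F s - IccExtend hT F' s‖) :=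
        setIntegral_mono_on hF'I.norm (hF.norm.add (hF.sub hF'I).norm) measurableSet_Ioc
          fun s _ => by
            have := norm_sub_le (F s) (F s - IccExtend hT F' s)
            rwa [sub_sub_cancel] at this
      rw [integral_add hF.norm (show IntegrableOn
        (fun s => ‖F s - IccExtend hT F' s‖) (Ioc 0 T) volume from (hF.sub hF'I).norm)] at g1
      linarith
    have hyN : ‖y'‖ ≤ N ε := by
      refine (energy_continuous hT hσ ha ha1 k hkσ hB c F' y' hy't).trans ?_
      have := Real.exp_pos (σ * T)
      simp only [N]
      gcongr
    -- The difference solves the equation with kernel `γ` and datum `∫ (F - F') - (γ - k) * y'`,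
    -- which has size at most `ε + ε ‖y'‖`.
    have hdiff : ‖y - y'‖ ≤ C * (ε + ε * ‖y'‖) := by
      refine (hstab (y - y')).trans (mul_le_mul_of_nonneg_left ?_ hC.le)
      have hpos : 0 ≤ ε + ε * ‖y'‖ := by have := hε.1; positivity
      refine (ContinuousMap.norm_le _ hpos).2 fun t => ?_
      have e : ((y - y') + pointwise B (convCT hT _ hβ (y - y')) + convCT hT _ hγ (y - y')) t
          = (∫ s in (0 : ℝ)..t, (F s - IccExtend hT F' s))
            - conv (γ - IccExtend hT k) (IccExtend hT y') t := by
        have f1 := congrArg (fun q : CT T H => q t) (convCT_sub_kernel hT hγ hkI y')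
        simp only [convCT_apply, ContinuousMap.sub_apply] at f1
        rw [f1, intervalIntegral.integral_sub (intervalIntegrable_of_mem hF t.2)
          (intervalIntegrable_of_mem hF'I t.2)]
        have f2 := hy t
        have f3 := hy't t
        rw [← sub_eq_iff_eq_add'] at f2 f3
        rw [← f2, ← f3, convCT_sub, convCT_sub, pointwise_sub]
        simp only [ContinuousMap.add_apply, ContinuousMap.sub_apply, convCT_apply, pointwise_apply]
        abel
      rw [e]
      refine (norm_sub_le _ _).trans (add_le_add ?_ ?_)
      · exact (norm_intervalIntegral_le _ (hF.sub hF'I) t.2).trans hF'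
      · exact (norm_conv_le (hγ.sub hkI) t.2.1 t.2.2 (fun s _ => norm_IccExtend_le hT y' s)
          (norm_nonneg _)).trans (mul_le_mul_of_nonneg_right hk (norm_nonneg _))
    have h4 := norm_sub_norm_le y y'
    have h5 : C * (ε + ε * ‖y'‖) ≤ C * (ε + ε * N ε) := by
      have := hε.1
      gcongr
    linarith
  have hlim : Tendsto (fun ε => N ε + C * (ε + ε * N ε)) (𝓝[>] 0) (𝓝 (N 0 + C * (0 + 0 * N 0))) := by
    have : Continuous fun ε => N ε + C * (ε + ε * N ε) := by
      simp only [N]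
      fun_prop
    exact (this.tendsto 0).mono_left nhdsWithin_le_nhds
  have := ge_of_tendsto hlim (by
    filter_upwards [Ioc_mem_nhdsGT (show (0 : ℝ) < θ / 4 by positivity)] with ε hε using key ε hε)
  refine this.trans ?_
  simp only [N, zero_mul, add_zero, mul_zero]
  have := mul_nonneg (Real.exp_pos (σ * T)).le (norm_nonneg c)
  linarith

end EnergyIntegrable

/-! ### Bounded positive approximations built from a resolvent. -/

section Resolvent

set_option linter.unusedSectionVars false

variable {H : Type} [NormedAddCommGroup H] [InnerProductSpace ℝ H] [CompleteSpace H]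

/-- `R` behaves like the resolvent `(1 - A)⁻¹` of a nonpositive self-adjoint operator `A`. -/
structure IsFirmResolvent (R : H →L[ℝ] H) : Prop where
  symm : ∀ x y, ⟪R x, y⟫ = ⟪x, R y⟫
  sq_le : ∀ x, ‖R x‖ ^ 2 ≤ ⟪R x, x⟫
  inj : ∀ x, R x = 0 → x = 0

namespace IsFirmResolvent

variable {R : H →L[ℝ] H} (hR : IsFirmResolvent R)

include hR

theorem nonneg (x : H) : 0 ≤ ⟪R x, x⟫ := (sq_nonneg _).trans (hR.sq_le x)

theorem norm_le (x : H) : ‖R x‖ ≤ ‖x‖ := by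
  have h1 := hR.sq_le x
  have h2 := real_inner_le_norm (R x) x
  by_contra! h
  have := norm_nonneg x
  nlinarith

theorem inner_le (x : H) : ⟪R x, x⟫ ≤ ‖x‖ ^ 2 := by
  have h2 := real_inner_le_norm (R x) x
  have := mul_le_mul_of_nonneg_right (hR.norm_le x) (norm_nonneg x)
  nlinarith

theorem exists_shift_inverse {ε : ℝ} (hε : 0 < ε) :
    ∃ S : H →L[ℝ] H, (∀ x, R (S x) + ε • S x = x) ∧ ∀ x, S (R x + ε • x) = x := by
  -- Positivity of `R` makes `R + ε` coercive: `⟪(R + ε) x, x⟫ ≥ ε ‖x‖²`.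
  have hu : IsUnit (R + ε • (1 : H →L[ℝ] H)) := by
    refine ContinuousLinearMap.isUnit_of_forall_le_norm_inner_map _
      (c := ⟨ε, hε.le⟩) hε fun x => ?_
    refine le_trans ?_ (le_abs_self _)
    have := hR.nonneg x
    simp only [add_apply, smul_apply, inner_add_left,
      real_inner_smul_left, one_apply_eq_self, real_inner_self_eq_norm_sq]
    change ‖x‖ ^ 2 * ε ≤ _
    linarith
  obtain ⟨v, hv⟩ := hu
  refine ⟨(↑v⁻¹ : H →L[ℝ] H), fun x => ?_, fun x => ?_⟩
  · have := congrArg (fun f : H →L[ℝ] H => f x) v.mul_inv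
    rw [hv] at this
    simpa using this
  · have := congrArg (fun f : H →L[ℝ] H => f x) v.inv_mul
    rw [hv] at this
    simpa using this

/-- The inverse of `R + 1/(n+1)`. -/
def inv (n : ℕ) : H →L[ℝ] H :=
  (hR.exists_shift_inverse (Nat.one_div_pos_of_nat (α := ℝ) (n := n))).choose

theorem shift_inv (n : ℕ) (x : H) : R (hR.inv n x) + (1 / ((n : ℝ) + 1)) • hR.inv n x = x :=
  (hR.exists_shift_inverse (Nat.one_div_pos_of_nat (α := ℝ) (n := n))).choose_spec.1 x

theorem inv_shift (n : ℕ) (x : H) : hR.inv n (R x + (1 / ((n : ℝ) + 1)) • x) = x :=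
  (hR.exists_shift_inverse (Nat.one_div_pos_of_nat (α := ℝ) (n := n))).choose_spec.2 x

theorem inv_comm (n : ℕ) (x : H) : hR.inv n (R x) = R (hR.inv n x) := by
  conv_lhs => rw [← hR.shift_inv n x, map_add, map_smul, hR.inv_shift]

theorem norm_apply_inv_le (n : ℕ) (x : H) : ‖R (hR.inv n x)‖ ≤ ‖x‖ := by
  have h0 : (0 : ℝ) < 1 / ((n : ℝ) + 1) := Nat.one_div_pos_of_nat
  conv_rhs => rw [← hR.shift_inv n x]
  rw [← sq_le_sq₀ (norm_nonneg _) (norm_nonneg _), norm_add_sq_real, real_inner_smul_right]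
  have := mul_nonneg h0.le (hR.nonneg (hR.inv n x))
  nlinarith [sq_nonneg ‖(1 / ((n : ℝ) + 1)) • hR.inv n x‖]

theorem norm_smul_inv_le (n : ℕ) (x : H) : ‖(1 / ((n : ℝ) + 1)) • hR.inv n x‖ ≤ ‖x‖ := by
  have h0 : (0 : ℝ) < 1 / ((n : ℝ) + 1) := Nat.one_div_pos_of_nat
  conv_rhs => rw [← hR.shift_inv n x]
  rw [← sq_le_sq₀ (norm_nonneg _) (norm_nonneg _), norm_add_sq_real, real_inner_smul_right]
  have := mul_nonneg h0.le (hR.nonneg (hR.inv n x))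
  nlinarith [sq_nonneg ‖R (hR.inv n x)‖]

/-- For a symmetric operator the orthogonal complement of the range is the kernel, which is trivial
here. -/
theorem dense_range : DenseRange R := by
  have : R.range.topologicalClosure = ⊤ := by
    rw [Submodule.topologicalClosure_eq_top_iff, Submodule.eq_bot_iff]
    intro x hx
    refine hR.inj x (ext_inner_left ℝ fun y => ?_)
    rw [inner_zero_right, ← hR.symm]
    exact (Submodule.mem_orthogonal _ _).1 hx _ ⟨y, rfl⟩
  intro x
  have h : x ∈ R.range.topologicalClosure := by rw [this]; trivial
  exact h

/-- These operators are contractions and are of order `1/(n+1)` on vectors `R z`, because `(R + ε)⁻¹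
R` is a contraction. Density of the range of `R` does the rest. -/
theorem tendsto_smul_inv (x : H) :
    Tendsto (fun n : ℕ => (1 / ((n : ℝ) + 1)) • hR.inv n x) atTop (𝓝 0) := by
  rw [Metric.tendsto_atTop]
  intro e he
  obtain ⟨z, hz⟩ := hR.dense_range.exists_dist_lt x (half_pos he)
  have h1 : Tendsto (fun n : ℕ => 1 / ((n : ℝ) + 1) * ‖z‖) atTop (𝓝 0) := by
    simpa using tendsto_one_div_add_atTop_nhds_zero_nat.mul_const ‖z‖
  obtain ⟨N, hN⟩ := eventually_atTop.1 (h1.eventually (gt_mem_nhds (half_pos he)))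
  refine ⟨N, fun n hn => ?_⟩
  have h0 : (0 : ℝ) < 1 / ((n : ℝ) + 1) := Nat.one_div_pos_of_nat
  rw [dist_zero_right]
  have e1 : (1 / ((n : ℝ) + 1)) • hR.inv n x = (1 / ((n : ℝ) + 1)) • hR.inv n (x - R z)
      + (1 / ((n : ℝ) + 1)) • R (hR.inv n z) := by
    rw [← hR.inv_comm, ← smul_add, ← map_add, sub_add_cancel]
  rw [e1]
  refine (norm_add_le _ _).trans_lt ?_
  have h2 := hR.norm_smul_inv_le n (x - R z)
  have h3 : ‖(1 / ((n : ℝ) + 1)) • R (hR.inv n z)‖ ≤ 1 / ((n : ℝ) + 1) * ‖z‖ := by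
    rw [norm_smul, Real.norm_of_nonneg h0.le]
    exact mul_le_mul_of_nonneg_left (hR.norm_apply_inv_le n z) h0.le
  have h4 := hN n hn
  rw [dist_eq_norm] at hz
  linarith

/-- The bounded approximation `κ (1 - R) (R + 1/(n+1))⁻¹` of `-κ A`. -/
def approx (κ : ℝ) (n : ℕ) : H →L[ℝ] H := κ • ((1 - R).comp (hR.inv n))

theorem approx_apply (κ : ℝ) (n : ℕ) (x : H) :
    hR.approx κ n x = κ • (hR.inv n x - R (hR.inv n x)) := rfl

theorem inv_symm (n : ℕ) (x y : H) : ⟪hR.inv n x, y⟫ = ⟪x, hR.inv n y⟫ := by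
  conv_lhs => rw [← hR.shift_inv n y]
  conv_rhs => rw [← hR.shift_inv n x]
  rw [inner_add_right, inner_add_left, hR.symm, real_inner_smul_left, real_inner_smul_right]

theorem isSymmPos_approx {κ : ℝ} (hκ : 0 ≤ κ) (n : ℕ) : IsSymmPos (hR.approx κ n) where
  symm x y := by
    rw [approx_apply, approx_apply, real_inner_smul_left, real_inner_smul_right, inner_sub_left,
      inner_sub_right, hR.symm, hR.inv_symm, hR.inv_symm, hR.inv_comm]
  nonneg x := by
    have h0 : (0 : ℝ) < 1 / ((n : ℝ) + 1) := Nat.one_div_pos_of_nat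
    rw [approx_apply, real_inner_smul_left]
    refine mul_nonneg hκ ?_
    have h1 := hR.sq_le (hR.inv n x)
    have h2 := mul_nonneg h0.le (sub_nonneg.2 (hR.inner_le (hR.inv n x)))
    -- With `z = (R + ε)⁻¹ x` the form is `⟪z - R z, R z + ε z⟫ = (⟪R z, z⟫ - ‖R z‖²) + ε (‖z‖² - ⟪R
    -- z, z⟫)`, and both brackets are nonnegative.
    suffices 0 ≤ ⟪hR.inv n x - R (hR.inv n x),
        R (hR.inv n x) + (1 / ((n : ℝ) + 1)) • hR.inv n x⟫ by rwa [hR.shift_inv] at this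
    rw [inner_sub_left, inner_add_right, inner_add_right, real_inner_smul_right,
      real_inner_smul_right, real_inner_self_eq_norm_sq, real_inner_self_eq_norm_sq,
      real_inner_comm _ (hR.inv n x)]
    linarith

/-- Multiplying by `R + 1/(n+1)` removes the inverse, so the limit `n → ∞` can be taken in an
equation whose operators are bounded uniformly in `n`. -/
theorem shift_approx (κ : ℝ) (n : ℕ) (x : H) :
    R (hR.approx κ n x) + (1 / ((n : ℝ) + 1)) • hR.approx κ n x = κ • (x - R x) := by
  have h := hR.shift_inv n x
  conv_rhs => rw [← h]
  simp only [approx_apply, map_smul, map_sub, map_add, smul_sub, smul_add]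
  rw [smul_comm κ (1 / ((n : ℝ) + 1)), smul_comm κ (1 / ((n : ℝ) + 1))]
  abel

/-- The second resolvent identity: the difference of two inverses contains the product of both, and
each factor is tamed by one `R`. This is why data in the range of `R²` are treated first. -/
theorem sq_apply_approx_sub (κ : ℝ) (n m : ℕ) (x : H) :
    R (R (hR.approx κ m x - hR.approx κ n x))
      = (κ * (1 / ((n : ℝ) + 1) - 1 / ((m : ℝ) + 1))) •
        ((1 - R) (R (hR.inv n (R (hR.inv m x))))) := by
  have h : hR.inv m x - hR.inv n x
      = (1 / ((n : ℝ) + 1) - 1 / ((m : ℝ) + 1)) • hR.inv n (hR.inv m x) := by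
    have h1 := hR.inv_shift n (hR.inv m x)
    have h2 := congrArg (hR.inv n) (hR.shift_inv m x)
    rw [map_add, map_smul] at h1 h2
    nth_rw 1 [← h1]
    rw [← h2, add_sub_add_left_eq_sub, ← sub_smul]
  have h2 : hR.approx κ m x - hR.approx κ n x
      = κ • (1 - R) (hR.inv m x - hR.inv n x) := by
    simp only [approx_apply, map_sub, sub_apply,
      one_apply_eq_self, smul_sub]
  rw [h2, h, ← hR.inv_comm n, ← hR.inv_comm m]
  simp only [map_smul, smul_smul, sub_apply, one_apply_eq_self,
    map_sub, hR.inv_comm]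

theorem norm_sq_apply_approx_sub_le {κ : ℝ} (hκ : 0 ≤ κ) (n m : ℕ) (x : H) :
    ‖R (R (hR.approx κ m x - hR.approx κ n x))‖
      ≤ κ * (1 / ((n : ℝ) + 1) + 1 / ((m : ℝ) + 1)) * (‖1 - R‖ * ‖x‖) := by
  have h0 : (0 : ℝ) < 1 / ((n : ℝ) + 1) := Nat.one_div_pos_of_nat
  have h1 : (0 : ℝ) < 1 / ((m : ℝ) + 1) := Nat.one_div_pos_of_nat
  rw [sq_apply_approx_sub, norm_smul, norm_mul, Real.norm_of_nonneg hκ]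
  gcongr
  · rw [Real.norm_eq_abs, abs_le]
    constructor <;> linarith
  · exact ((1 - R).le_opNorm _).trans (mul_le_mul_of_nonneg_left
      ((hR.norm_apply_inv_le n _).trans (hR.norm_apply_inv_le m x)) (norm_nonneg _))

/-- With `K = R (R + ε)⁻¹` one has `1 - K² = (1 - K) + K (1 - K)` and `1 - K = ε (R + ε)⁻¹`. So `K²`
is an approximate identity with values in the range of `R²`. -/
theorem norm_sub_sq_apply_inv_le (n : ℕ) (x : H) :
    ‖x - R (R (hR.inv n (hR.inv n x)))‖ ≤ 2 * ‖(1 / ((n : ℝ) + 1)) • hR.inv n x‖ := by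
  have e : x - R (R (hR.inv n (hR.inv n x))) = (1 / ((n : ℝ) + 1)) • hR.inv n x
      + R (hR.inv n ((1 / ((n : ℝ) + 1)) • hR.inv n x)) := by
    have h1 := hR.shift_inv n x
    have h2 : R (hR.inv n (R (hR.inv n x))) = R (R (hR.inv n (hR.inv n x))) := by rw [hR.inv_comm]
    rw [← h2]
    nth_rw 1 [← h1]
    have h3 : R (hR.inv n ((1 / ((n : ℝ) + 1)) • hR.inv n x))
        = R (hR.inv n x) - R (hR.inv n (R (hR.inv n x))) := by
      rw [← map_sub, ← map_sub]
      congr 2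
      rw [eq_sub_iff_add_eq, add_comm, h1]
    rw [h3]
    abel
  rw [e, two_mul]
  exact (norm_add_le _ _).trans (add_le_add le_rfl (hR.norm_apply_inv_le n _))

theorem norm_sq_apply_inv_le (n : ℕ) (x : H) :
    ‖R (R (hR.inv n (hR.inv n x)))‖ ≤ ‖x‖ := by
  rw [← hR.inv_comm]
  exact (hR.norm_apply_inv_le n _).trans (hR.norm_apply_inv_le n x)

end IsFirmResolvent

end Resolvent

/-! ### Well-posedness of the memory equation with an unbounded operator. -/

section WellPosed

set_option linter.unusedSectionVars false

variable {H : Type} [NormedAddCommGroup H] [InnerProductSpace ℝ H] [CompleteSpace H] {T : ℝ}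

theorem cauchySeq_of_norm_sub_le_add {X : Type} [NormedAddCommGroup X] {u : ℕ → X} {b : ℕ → ℝ}
    (hb : Tendsto b atTop (𝓝 0)) (h : ∀ n m, ‖u n - u m‖ ≤ b n + b m) : CauchySeq u := by
  rw [Metric.cauchySeq_iff]
  intro e he
  obtain ⟨N, hN⟩ := eventually_atTop.1 (hb.eventually (gt_mem_nhds (half_pos he)))
  refine ⟨N, fun m hm n hn => ?_⟩
  rw [dist_eq_norm]
  linarith [h m n, hN m hm, hN n hn]

theorem continuous_of_norm_sub_le {X Y : Type} [NormedAddCommGroup X] [NormedAddCommGroup Y]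
    {M : X → Y} (C : ℝ) (h : ∀ q p, ‖M q - M p‖ ≤ C * ‖q - p‖) : Continuous M := by
  refine (LipschitzWith.of_dist_le_mul (K := ⟨max C 0, le_max_right _ _⟩) fun q p => ?_).continuous
  rw [dist_eq_norm, dist_eq_norm]
  exact (h q p).trans (mul_le_mul_of_nonneg_right (le_max_left _ _) (norm_nonneg _))

theorem continuous_pointwise (B : H →L[ℝ] H) :
    Continuous (pointwise B : CT T H → CT T H) :=
  continuous_of_norm_sub_le ‖B‖ fun q p => by
    rw [← pointwise_sub]
    exact norm_pointwise_le B _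

theorem continuous_convCT (hT : 0 ≤ T) {k : ℝ → ℝ} (hk : IsKernel T k) :
    Continuous (convCT hT k hk : CT T H → CT T H) :=
  continuous_of_norm_sub_le _ fun q p => by
    rw [← convCT_sub]
    exact norm_convCT_le hT hk _

/-- The datum `t ↦ c + ∫₀ᵗ F`. -/
def datum (hT : 0 ≤ T) (c : H) (F : ℝ → H) (hF : IntegrableOn F (Ioc 0 T) volume) : CT T H :=
  ContinuousMap.const _ c + primitiveCT hT F hF

theorem datum_apply (hT : 0 ≤ T) (c : H) {F : ℝ → H} (hF : IntegrableOn F (Ioc 0 T) volume)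
    (t : Icc (0 : ℝ) T) : datum hT c F hF t = c + ∫ s in (0 : ℝ)..t, F s := rfl

theorem IsKernel.comp {B : H →L[ℝ] H} {F : ℝ → H} (hF : IntegrableOn F (Ioc 0 T) volume) :
    IntegrableOn (fun s => B (F s)) (Ioc 0 T) volume :=
  B.integrable_comp hF

theorem pointwise_datum (hT : 0 ≤ T) (B : H →L[ℝ] H) (c : H) {F : ℝ → H}
    (hF : IntegrableOn F (Ioc 0 T) volume) :
    pointwise B (datum hT c F hF) = datum hT (B c) (fun s => B (F s)) (IsKernel.comp hF) := by
  ext1 t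
  rw [pointwise_apply, datum_apply, datum_apply, map_add,
    ← B.intervalIntegral_comp_comm (intervalIntegrable_of_mem hF t.2)]

theorem datum_sub (hT : 0 ≤ T) (c c' : H) {F F' : ℝ → H}
    (hF : IntegrableOn F (Ioc 0 T) volume) (hF' : IntegrableOn F' (Ioc 0 T) volume) :
    datum hT c F hF - datum hT c' F' hF' = datum hT (c - c') (fun s => F s - F' s) (hF.sub hF') := by
  ext1 t
  simp only [ContinuousMap.sub_apply, datum_apply]
  rw [intervalIntegral.integral_sub (intervalIntegrable_of_mem hF t.2)
    (intervalIntegrable_of_mem hF' t.2)]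
  abel

/-- `u + κ (R⁻¹ - 1) (k * u) + γ * u = G`, multiplied by `R`. -/
def IsMemorySolution (hT : 0 ≤ T) (R : H →L[ℝ] H) (κ : ℝ) {k γ : ℝ → ℝ} (hk : IsKernel T k)
    (hγ : IsKernel T γ) (G u : CT T H) : Prop :=
  pointwise R (u + convCT hT γ hγ u - G) + κ • pointwise (1 - R) (convCT hT k hk u) = 0

theorem IsMemorySolution.sub {hT : 0 ≤ T} {R : H →L[ℝ] H} {κ : ℝ} {k γ : ℝ → ℝ}
    {hk : IsKernel T k} {hγ : IsKernel T γ} {G G' u u' : CT T H}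
    (h : IsMemorySolution hT R κ hk hγ G u) (h' : IsMemorySolution hT R κ hk hγ G' u') :
    IsMemorySolution hT R κ hk hγ (G - G') (u - u') := by
  unfold IsMemorySolution at *
  rw [← sub_self (0 : CT T H)]
  nth_rw 1 [← h]
  rw [← h']
  simp only [convCT_sub, pointwise_sub, pointwise_add, smul_sub]
  abel

theorem isClosed_isMemorySolution (hT : 0 ≤ T) (R : H →L[ℝ] H) (κ : ℝ) {k γ : ℝ → ℝ}
    (hk : IsKernel T k) (hγ : IsKernel T γ) {G u : ℕ → CT T H} {G' u' : CT T H}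
    (hu : Tendsto u atTop (𝓝 u')) (hG : Tendsto G atTop (𝓝 G'))
    (h : ∀ n, IsMemorySolution hT R κ hk hγ (G n) (u n)) :
    IsMemorySolution hT R κ hk hγ G' u' := by
  have c1 := (((continuous_convCT hT hγ).tendsto _).comp hu)
  have c2 := (((continuous_convCT hT hk).tendsto _).comp hu)
  have c3 := ((continuous_pointwise R).tendsto _).comp ((hu.add c1).sub hG)
  have c4 := (((continuous_pointwise (1 - R)).tendsto _).comp c2).const_smul κ
  exact tendsto_nhds_unique (c3.add c4) (tendsto_const_nhds.congr fun n => (h n).symm)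

theorem eq_zero_of_convCT_one_eq_zero (hT : 0 < T) {u : CT T H}
    (h : convCT hT.le _ (isKernel_one T) u = 0) : u = 0 := by
  have hc := continuous_IccExtend hT.le u
  have h1 : ∀ t ∈ Ioo 0 T, IccExtend hT.le u t = 0 := fun t ht => by
    have d1 := intervalIntegral.integral_hasDerivAt_right (hc.intervalIntegrable 0 t)
      hc.stronglyMeasurable.stronglyMeasurableAtFilter hc.continuousAt
    have d2 : HasDerivAt (fun t => ∫ s in (0 : ℝ)..t, IccExtend hT.le u s) 0 t := by
      refine (hasDerivAt_const t (0 : H)).congr_of_eventuallyEq ?_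
      filter_upwards [isOpen_Ioo.mem_nhds ht] with s hs
      have := congrArg (fun q : CT T H => q ⟨s, Ioo_subset_Icc_self hs⟩) h
      simp only [convCT_apply, conv_one] at this
      exact this
    exact d1.unique d2
  have h2 : ∀ t ∈ Icc 0 T, IccExtend hT.le u t = 0 := by
    have : closure (Ioo 0 T) ⊆ {t | IccExtend hT.le u t = 0} :=
      closure_minimal h1 (isClosed_eq hc continuous_const)
    rwa [closure_Ioo hT.ne] at this
  ext1 t
  rw [← IccExtend_of_mem hT.le u t.2]
  exact h2 t t.2

theorem norm_le_of_approx (hT : 0 ≤ T) {a : ℝ} (ha : 0 < a) (ha1 : a < 1) {γ : ℝ → ℝ}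
    (hγ : IsKernel T γ) : ∃ Q : ℝ, 0 < Q ∧ ∀ {B : H →L[ℝ] H}, IsSymmPos B → ∀ (c : H) (F : ℝ → H)
      (hF : IntegrableOn F (Ioc 0 T) volume) (y : CT T H),
      y + pointwise B (convCT hT _ (isKernel_beta (by linarith : 0 < 1 + a) T hT) y)
        + convCT hT γ hγ y = datum hT c F hF →
      ‖y‖ ≤ Q * (‖c‖ + ∫ s in Ioc 0 T, ‖F s‖) := by
  obtain ⟨Q, hQ, h⟩ := energy_integrable (H := H) hT ha ha1 hγ
  exact ⟨Q, hQ, fun hB c F hF y hy => h hB c F hF y fun t =>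
    congrArg (fun q : CT T H => q t) hy⟩

namespace IsFirmResolvent

variable {R : H →L[ℝ] H} (hR : IsFirmResolvent R)

include hR

/-- Applying `(R + ε)⁻¹` turns a solution with zero datum into a solution of the approximate
equation whose datum is the residual `ε (R + ε)⁻¹ e`, which tends to zero. The energy bound needs a
datum of the form `c + ∫ F`, so the equation is integrated once and the bound is applied to the
primitive `U` of `u`. -/
theorem memorySolution_unique (hT : 0 < T) {κ : ℝ} (hκ : 0 ≤ κ) {a : ℝ} (ha : 0 < a) (ha1 : a < 1)
    {γ : ℝ → ℝ} (hγ : IsKernel T γ) {u : CT T H}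
    (hu : IsMemorySolution hT.le R κ (isKernel_beta (by linarith : 0 < 1 + a) T hT.le) hγ 0 u) :
    u = 0 := by
  have hβ := isKernel_beta (by linarith : 0 < 1 + a) T hT.le
  have hone := isKernel_one T
  obtain ⟨Q, hQ, hest⟩ := norm_le_of_approx (H := H) hT.le ha ha1 hγ
  refine eq_zero_of_convCT_one_eq_zero hT (norm_le_zero_iff.1 ?_)
  set U := convCT hT.le _ hone u
  set e := u + convCT hT.le γ hγ u
  let F : ℕ → ℝ → H := fun n s => (1 / ((n : ℝ) + 1)) • hR.inv n (IccExtend hT.le e s)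
  have hec := continuous_IccExtend hT.le e
  have hFc : ∀ n, Continuous (F n) := fun n => ((hR.inv n).continuous.comp hec).const_smul _
  have hF : ∀ n, IntegrableOn (F n) (Ioc 0 T) volume := fun n => (hFc n).integrableOn_Ioc
  have hle : ∀ n, ‖U‖ ≤ Q * (‖(0 : H)‖ + ∫ s in Ioc 0 T, ‖F n s‖) := fun n => by
    refine hest (hR.isSymmPos_approx hκ n) 0 (F n) (hF n) U ?_
    have h1 : u + pointwise (hR.approx κ n) (convCT hT.le _ hβ u) + convCT hT.le γ hγ u
        = pointwise ((1 / ((n : ℝ) + 1)) • hR.inv n) e := by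
      ext1 t
      have h2 := congrArg (fun q : CT T H => q t) hu
      simp only [ContinuousMap.add_apply, ContinuousMap.smul_apply, pointwise_apply, sub_zero,
        ContinuousMap.zero_apply] at h2
      change R (e t) + κ • (convCT hT.le _ hβ u t - R (convCT hT.le _ hβ u t)) = 0 at h2
      have h3 := hR.inv_shift n (e t)
      rw [eq_neg_of_add_eq_zero_left h2] at h3
      simp only [ContinuousMap.add_apply, pointwise_apply, smul_apply]
      rw [map_add, map_neg, map_smul, map_smul, map_sub, hR.inv_comm, ← hR.approx_apply] at h3
      rw [neg_add_eq_iff_eq_add] at h3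
      rw [h3]
      change _ = _ + (u t + convCT hT.le γ hγ u t)
      abel
    -- Convolution with `1` commutes with the other kernels, so `U` solves the same equation with
    -- the residual under an integral.
    have h4 := congrArg (convCT hT.le _ hone) h1
    rw [convCT_add, convCT_add, ← pointwise_convCT, convCT_comm hT.le hone hβ,
      convCT_comm hT.le hone hγ] at h4
    refine h4.trans ?_
    ext1 t
    rw [convCT_apply, conv_one, datum_apply, zero_add]
    rfl
  have hlim : Tendsto (fun n => Q * (‖(0 : H)‖ + ∫ s in Ioc 0 T, ‖F n s‖)) atTop
      (𝓝 (Q * (‖(0 : H)‖ + ∫ s in Ioc 0 T, ‖(0 : H)‖))) := by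
    refine ((tendsto_integral_of_dominated_convergence
      (fun s => ‖IccExtend hT.le e s‖) (fun n => (hFc n).norm.aestronglyMeasurable)
      hec.norm.integrableOn_Ioc (fun n => Eventually.of_forall fun s => ?_)
      (Eventually.of_forall fun s => (hR.tendsto_smul_inv _).norm)).const_add _).const_mul _
    rw [norm_norm]
    exact hR.norm_smul_inv_le n _
  simpa using ge_of_tendsto' hlim hle

/-- Solvability for data in the range of `R²`. -/
theorem exists_memorySolution_sq (hT : 0 < T) {κ : ℝ} (hκ : 0 ≤ κ) {a : ℝ} (ha : 0 < a)
    (ha1 : a < 1) {γ : ℝ → ℝ} (hγ : IsKernel T γ) {Q : ℝ} (hQ : 0 < Q)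
    (hest : ∀ {B : H →L[ℝ] H}, IsSymmPos B → ∀ (c : H) (F : ℝ → H)
      (hF : IntegrableOn F (Ioc 0 T) volume) (y : CT T H),
      y + pointwise B (convCT hT.le _ (isKernel_beta (by linarith : 0 < 1 + a) T hT.le) y)
        + convCT hT.le γ hγ y = datum hT.le c F hF → ‖y‖ ≤ Q * (‖c‖ + ∫ s in Ioc 0 T, ‖F s‖))
    (c : H) (F : ℝ → H) (hF : IntegrableOn F (Ioc 0 T) volume) :
    ∃ u : CT T H, IsMemorySolution hT.le R κ (isKernel_beta (by linarith : 0 < 1 + a) T hT.le) hγ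
        (pointwise (R * R) (datum hT.le c F hF)) u ∧
      ‖u‖ ≤ Q * (‖R (R c)‖ + ∫ s in Ioc 0 T, ‖R (R (F s))‖) := by
  have hβ := isKernel_beta (by linarith : 0 < 1 + a) T hT.le
  have hβa := isKernel_beta ha T hT.le
  set G := datum hT.le c F hF
  choose v hv using fun n : ℕ => volterra_exists hT.le (hR.approx κ n) hβ hγ G
  have hvb := fun n => hest (hR.isSymmPos_approx hκ n) c F hF (v n) (hv n)
  set N := Q * (‖c‖ + ∫ s in Ioc 0 T, ‖F s‖)
  have hcomm : ∀ n x, R (hR.approx κ n x) = hR.approx κ n (R x) := fun n x => by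
    simp only [approx_apply, map_smul, map_sub, hR.inv_comm]
  -- `R²` commutes with the approximations, so `R² v_n` solves the approximate equation with datum
  -- `R² G`.
  let u : ℕ → CT T H := fun n => pointwise (R * R) (v n)
  have hu : ∀ n, u n + pointwise (hR.approx κ n) (convCT hT.le _ hβ (u n))
      + convCT hT.le γ hγ (u n) = pointwise (R * R) G := fun n => by
    rw [← hv n]
    simp only [u, ← pointwise_convCT, pointwise_add]
    congr 2
    ext1 t
    simp only [pointwise_apply]
    change hR.approx κ n (R (R _)) = R (R (hR.approx κ n _))
    rw [hcomm, hcomm]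
  have hub : ∀ n, ‖u n‖ ≤ Q * (‖R (R c)‖ + ∫ s in Ioc 0 T, ‖R (R (F s))‖) := fun n => by
    have := hu n
    simp only [G] at this
    rw [pointwise_datum] at this
    exact hest (hR.isSymmPos_approx hκ n) _ _ _ (u n) this
  have hcauchy : CauchySeq u := by
    let C := κ * (‖1 - R‖ * ((∫ s in Ioc 0 T, |beta a s|) * N)) * T
    have hb : Tendsto (fun n : ℕ => Q * (C * (1 / ((n : ℝ) + 1)))) atTop (𝓝 0) := by
      simpa using (tendsto_one_div_add_atTop_nhds_zero_nat.const_mul C).const_mul Q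
    refine cauchySeq_of_norm_sub_le_add hb fun n m => ?_
    -- In the equation for `u n - u m` the discrepancy of the operators appears as `D (β_{1+a} *
    -- v_m)`, the primitive of `D (β_a * v_m)`. It is of order `1/(n+1) + 1/(m+1)` because the `v_m`
    -- are uniformly bounded.
    let D : H →L[ℝ] H := (R * R) * (hR.approx κ m - hR.approx κ n)
    let f : CT T H := pointwise D (convCT hT.le _ hβa (v m))
    have hf : IntegrableOn (IccExtend hT.le f) (Ioc 0 T) volume :=
      (continuous_IccExtend hT.le f).integrableOn_Ioc
    have h1 : (u n - u m) + pointwise (hR.approx κ n) (convCT hT.le _ hβ (u n - u m))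
        + convCT hT.le γ hγ (u n - u m) = datum hT.le 0 _ hf := by
      have e1 : datum hT.le 0 _ hf = pointwise D (convCT hT.le _ hβ (v m)) := by
        rw [convCT_beta_one_add hT.le ha, pointwise_convCT]
        ext1 t
        rw [datum_apply, zero_add, convCT_apply, conv_one]
      have e2 : pointwise D (convCT hT.le _ hβ (v m))
          = pointwise (hR.approx κ m) (convCT hT.le _ hβ (u m))
            - pointwise (hR.approx κ n) (convCT hT.le _ hβ (u m)) := by
        simp only [u, ← pointwise_convCT]
        ext1 t
        simp only [pointwise_apply, ContinuousMap.sub_apply]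
        change R (R (hR.approx κ m _ - hR.approx κ n _))
          = hR.approx κ m (R (R _)) - hR.approx κ n (R (R _))
        simp only [map_sub, hcomm]
      rw [e1, e2]
      have e3 := (hu n).trans (hu m).symm
      rw [convCT_sub, convCT_sub, pointwise_sub]
      rw [← sub_eq_zero] at e3 ⊢
      rw [← e3]
      abel
    refine (hest (hR.isSymmPos_approx hκ n) 0 _ hf _ h1).trans ?_
    rw [norm_zero, zero_add, ← mul_add, ← mul_add]
    refine mul_le_mul_of_nonneg_left ?_ hQ.le
    have hfb : ∀ s, ‖IccExtend hT.le f s‖ ≤ κ * (1 / ((n : ℝ) + 1) + 1 / ((m : ℝ) + 1)) *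
        (‖1 - R‖ * ((∫ s in Ioc 0 T, |beta a s|) * N)) := fun s => by
      have h0 : (0 : ℝ) < 1 / ((n : ℝ) + 1) := Nat.one_div_pos_of_nat
      have h1 : (0 : ℝ) < 1 / ((m : ℝ) + 1) := Nat.one_div_pos_of_nat
      refine (hR.norm_sq_apply_approx_sub_le hκ n m _).trans ?_
      gcongr
      refine (ContinuousMap.norm_coe_le_norm _ _).trans ((norm_convCT_le hT.le hβa _).trans ?_)
      exact mul_le_mul_of_nonneg_left (hvb m) (integral_nonneg fun _ => abs_nonneg _)
    refine (setIntegral_mono_on hf.norm (integrableOn_const (by simp)) measurableSet_Ioc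
      fun s _ => hfb s).trans (le_of_eq ?_)
    rw [setIntegral_const, smul_eq_mul, Real.volume_real_Ioc_of_le hT.le]
    simp only [C]
    ring
  obtain ⟨w, hw⟩ := cauchySeq_tendsto_of_complete hcauchy
  refine ⟨w, ?_, le_of_tendsto' hw.norm hub⟩
  have c1 := (((continuous_convCT hT.le hγ).tendsto _).comp hw)
  have c2 := (((continuous_convCT hT.le hβ).tendsto _).comp hw)
  have c3 := (hw.add c1).sub_const (pointwise (R * R) G)
  have c4 := ((continuous_pointwise R).tendsto _).comp c3
  have c5 := (((continuous_pointwise (1 - R)).tendsto _).comp c2).const_smul κ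
  -- The approximate equation is multiplied by `R + 1/(n+1)`; the part carrying `1/(n+1)` disappears
  -- in the limit.
  have c6 := (tendsto_one_div_add_atTop_nhds_zero_nat (𝕜 := ℝ)).smul c3
  have c7 := (c4.add c6).add c5
  rw [zero_smul, add_zero] at c7
  refine tendsto_nhds_unique c7 (tendsto_const_nhds.congr fun n => ?_)
  ext1 t
  have h1 := congrArg (fun q : CT T H => q t) (hu n)
  simp only [ContinuousMap.add_apply, pointwise_apply] at h1
  have h2 : u n t + convCT hT.le γ hγ (u n) t - (R * R) (G t)
      = -hR.approx κ n (convCT hT.le _ hβ (u n) t) := by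
    rw [← h1]; abel
  have h3 := hR.shift_approx κ n (convCT hT.le _ hβ (u n) t)
  simp only [Function.comp_apply, ContinuousMap.add_apply, ContinuousMap.sub_apply,
    ContinuousMap.smul_apply, pointwise_apply, ContinuousMap.zero_apply]
  rw [h2, map_neg, smul_neg, ← neg_add, h3, sub_apply, one_apply_eq_self, neg_add_cancel]

/-- General data are approximated by `K_n² G`, with `K_n = R (R + 1/(n+1))⁻¹`, which lie in the
range of `R²`. Estimate, linearity and uniqueness make the solutions a Cauchy sequence, and the
constant survives because `K_n²` is a contraction. -/
theorem memory_wellPosed (hT : 0 < T) {κ : ℝ} (hκ : 0 ≤ κ) {a : ℝ} (ha : 0 < a)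
    (ha1 : a < 1) {γ : ℝ → ℝ} (hγ : IsKernel T γ) : ∃ Q : ℝ, 0 < Q ∧
    ∀ (c : H) (F : ℝ → H) (hF : IntegrableOn F (Ioc 0 T) volume),
    ∃ u : CT T H, (∀ u', IsMemorySolution hT.le R κ
        (isKernel_beta (by linarith : 0 < 1 + a) T hT.le) hγ (datum hT.le c F hF) u' ↔ u' = u) ∧
      ‖u‖ ≤ Q * (‖c‖ + ∫ s in Ioc 0 T, ‖F s‖) := by
  have hβ := isKernel_beta (by linarith : 0 < 1 + a) T hT.le
  obtain ⟨Q, hQ, hest⟩ := norm_le_of_approx (H := H) hT.le ha ha1 hγ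
  refine ⟨Q, hQ, fun c F hF => ?_⟩
  have huniq : ∀ {G u u' : CT T H}, IsMemorySolution hT.le R κ hβ hγ G u →
      IsMemorySolution hT.le R κ hβ hγ G u' → u' = u := fun {G u u'} h h' => by
    have := h'.sub h
    rw [sub_self] at this
    exact sub_eq_zero.1 (hR.memorySolution_unique hT hκ ha ha1 hγ this)
  let S : ℕ → H →L[ℝ] H := fun n => hR.inv n * hR.inv n
  have hSF : ∀ n, IntegrableOn (fun s => S n (F s)) (Ioc 0 T) volume := fun n => IsKernel.comp hF
  choose u hu hub using fun n =>
    hR.exists_memorySolution_sq hT hκ ha ha1 hγ hQ hest (S n c) _ (hSF n)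
  let p : ℕ → ℝ := fun n => ‖(1 / ((n : ℝ) + 1)) • hR.inv n c‖
    + ∫ s in Ioc 0 T, ‖(1 / ((n : ℝ) + 1)) • hR.inv n (F s)‖
  have hPI : ∀ n : ℕ, IntegrableOn (fun s => (1 / ((n : ℝ) + 1)) • hR.inv n (F s)) (Ioc 0 T)
    volume := fun n => (IsKernel.comp (B := hR.inv n) hF).smul (1 / ((n : ℝ) + 1))
  have hp : Tendsto p atTop (𝓝 0) := by
    have h1 := (hR.tendsto_smul_inv c).norm
    have h2 : Tendsto (fun n : ℕ => ∫ s in Ioc 0 T, ‖(1 / ((n : ℝ) + 1)) • hR.inv n (F s)‖) atTop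
        (𝓝 (∫ s in Ioc 0 T, ‖(0 : H)‖)) :=
      tendsto_integral_of_dominated_convergence (fun s => ‖F s‖)
        (fun n => (hPI n).aestronglyMeasurable.norm) hF.norm
        (fun n => Eventually.of_forall fun s => by
          rw [norm_norm]; exact hR.norm_smul_inv_le n _)
        (Eventually.of_forall fun s => (hR.tendsto_smul_inv _).norm)
    have h3 := h1.add h2
    rw [norm_zero, integral_zero, add_zero] at h3
    exact h3
  let K : ℕ → H →L[ℝ] H := fun n => (R * R) * S n
  have hK : ∀ n x, ‖x - K n x‖ ≤ 2 * ‖(1 / ((n : ℝ) + 1)) • hR.inv n x‖ :=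
    fun n x => hR.norm_sub_sq_apply_inv_le n x
  have hKd : ∀ n, pointwise (R * R) (datum hT.le (S n c) _ (hSF n))
      = datum hT.le (K n c) (fun s => K n (F s)) (IsKernel.comp hF) := fun n => by
    rw [pointwise_datum]; rfl
  have hdiff : ∀ n m, ‖u n - u m‖ ≤ Q * (2 * p n) + Q * (2 * p m) := fun n m => by
    obtain ⟨w, hw, hwb⟩ := hR.exists_memorySolution_sq hT hκ ha ha1 hγ hQ hest
      (S n c - S m c) _ ((hSF n).sub (hSF m))
    have h1 := (hu n).sub (hu m)
    rw [← pointwise_sub, datum_sub] at h1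
    -- Uniqueness identifies `u n - u m` with the solution constructed for the difference of the
    -- data, so the estimate applies to it.
    have h2 := huniq hw h1
    rw [h2]
    refine hwb.trans ?_
    rw [← mul_add]
    refine mul_le_mul_of_nonneg_left ?_ hQ.le
    have h3 : ∀ x, ‖R (R (S n x - S m x))‖ ≤ 2 * ‖(1 / ((n : ℝ) + 1)) • hR.inv n x‖
        + 2 * ‖(1 / ((m : ℝ) + 1)) • hR.inv m x‖ := fun x => by
      have e : R (R (S n x - S m x)) = (x - K m x) - (x - K n x) := by
        change _ = (x - R (R (S m x))) - (x - R (R (S n x)))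
        rw [map_sub, map_sub]
        abel
      rw [e, add_comm]
      exact (norm_sub_le _ _).trans (add_le_add (hK m x) (hK n x))
    have h4 : ∫ s in Ioc 0 T, ‖R (R (S n (F s) - S m (F s)))‖
        ≤ ∫ s in Ioc 0 T, (2 * ‖(1 / ((n : ℝ) + 1)) • hR.inv n (F s)‖
          + 2 * ‖(1 / ((m : ℝ) + 1)) • hR.inv m (F s)‖) :=
      setIntegral_mono_on (IsKernel.comp (IsKernel.comp ((hSF n).sub (hSF m)))).norm
        (((hPI n).norm.const_mul 2).add ((hPI m).norm.const_mul 2)) measurableSet_Ioc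
        fun s _ => h3 _
    rw [integral_add ((hPI n).norm.const_mul 2) ((hPI m).norm.const_mul 2), integral_const_mul,
      integral_const_mul] at h4
    exact (add_le_add (h3 c) h4).trans_eq (by simp only [p]; ring)
  have hb : Tendsto (fun n => Q * (2 * p n)) atTop (𝓝 0) := by
    simpa using (hp.const_mul 2).const_mul Q
  obtain ⟨w, hw⟩ := cauchySeq_tendsto_of_complete (cauchySeq_of_norm_sub_le_add hb hdiff)
  have hG : Tendsto (fun n => pointwise (R * R) (datum hT.le (S n c) _ (hSF n))) atTop
      (𝓝 (datum hT.le c F hF)) := by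
    rw [tendsto_iff_norm_sub_tendsto_zero]
    have hb2 : Tendsto (fun n => 2 * p n) atTop (𝓝 0) := by simpa using hp.const_mul 2
    refine squeeze_zero (fun _ => norm_nonneg _) (fun n => ?_) hb2
    have hKI : IntegrableOn (fun s => K n (F s)) (Ioc 0 T) volume := IsKernel.comp hF
    rw [norm_sub_rev, hKd, datum_sub]
    have hpn : 0 ≤ 2 * p n := mul_nonneg zero_le_two
      (add_nonneg (norm_nonneg _) (integral_nonneg fun _ => norm_nonneg _))
    refine (ContinuousMap.norm_le _ hpn).2 fun t => ?_
    rw [datum_apply]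
    refine (norm_add_le _ _).trans ?_
    have h1 := norm_intervalIntegral_le _ (hF.sub hKI) t.2
    have h2 : ∫ s in Ioc 0 T, ‖F s - K n (F s)‖
        ≤ ∫ s in Ioc 0 T, 2 * ‖(1 / ((n : ℝ) + 1)) • hR.inv n (F s)‖ :=
      setIntegral_mono_on (hF.sub hKI).norm ((hPI n).norm.const_mul 2) measurableSet_Ioc
        fun s _ => hK n _
    rw [integral_const_mul] at h2
    have h3 := hK n c
    simp only [p]
    exact (add_le_add h3 (h1.trans h2)).trans_eq (by ring)
  have hsol := isClosed_isMemorySolution hT.le R κ hβ hγ hw hG hu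
  refine ⟨w, fun u' => ⟨fun h => huniq hsol h, fun h => h ▸ hsol⟩, ?_⟩
  refine le_of_tendsto' hw.norm fun n => (hub n).trans (mul_le_mul_of_nonneg_left ?_ hQ.le)
  refine add_le_add (hR.norm_sq_apply_inv_le n c) ?_
  exact setIntegral_mono_on (IsKernel.comp (IsKernel.comp (hSF n))).norm hF.norm measurableSet_Ioc
    fun s _ => hR.norm_sq_apply_inv_le n _

end IsFirmResolvent

end WellPosed

/-! ### Regularity of the generalized identity function. -/

section GeneralizedIdentity

theorem abs_exp_sub_exp_le {M x y : ℝ} (hx : x ≤ M) (hy : y ≤ M) :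
    |Real.exp x - Real.exp y| ≤ Real.exp M * |x - y| := by
  refine (convex_Iic M).norm_image_sub_le_of_norm_deriv_le (f := Real.exp)
    (fun z _ => Real.differentiableAt_exp) (fun z hz => ?_) hy hx
  rw [Real.deriv_exp, Real.norm_eq_abs, Real.abs_exp]
  exact Real.exp_le_exp.2 hz

/-- The reciprocal `1/Γ` is entire, hence Lipschitz on compact sets. At `0` the convention `0⁻¹ = 0`
agrees with its true value. The extra `1` in the constant absorbs `1/Γ(1) = 1`. -/
theorem exists_inv_Gamma_bound : ∃ K : ℝ, 0 < K ∧ ∀ x ∈ Icc (0 : ℝ) 1, ∀ y ∈ Icc (0 : ℝ) 1,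
    |(Real.Gamma x)⁻¹| ≤ K ∧ |(Real.Gamma x)⁻¹ - (Real.Gamma y)⁻¹| ≤ K * |x - y| := by
  have hG : ∀ x : ℝ, (((Real.Gamma x)⁻¹ : ℝ) : ℂ) = (Complex.Gamma x)⁻¹ := fun x => by
    rw [Complex.Gamma_ofReal, Complex.ofReal_inv]
  have hd : ContDiff ℝ 1 fun x : ℝ => (Complex.Gamma x)⁻¹ :=
    ((Complex.differentiable_one_div_Gamma.contDiff (n := 1)).restrict_scalars ℝ).comp
      Complex.ofRealCLM.contDiff
  obtain ⟨K, hK⟩ := (hd.locallyLipschitz.locallyLipschitzOn).exists_lipschitzOnWith_of_compact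
    (isCompact_Icc (a := (0 : ℝ)) (b := 1))
  refine ⟨K + 1, by positivity, fun x hx y hy => ?_⟩
  have key : ∀ x ∈ Icc (0 : ℝ) 1, ∀ y ∈ Icc (0 : ℝ) 1,
      |(Real.Gamma x)⁻¹ - (Real.Gamma y)⁻¹| ≤ K * |x - y| := fun x hx y hy => by
    have := hK.dist_le_mul x hx y hy
    rw [dist_eq_norm, ← hG, ← hG, ← Complex.ofReal_sub, Complex.norm_real] at this
    exact this
  refine ⟨?_, (key x hx y hy).trans (mul_le_mul_of_nonneg_right (by linarith) (abs_nonneg _))⟩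
  have h1 := key x hx 1 ⟨zero_le_one, le_rfl⟩
  rw [Real.Gamma_one, inv_one] at h1
  have h2 := abs_sub_abs_le_abs_sub (Real.Gamma x)⁻¹ 1
  have h3 : |x - 1| ≤ 1 := abs_le.2 ⟨by linarith [hx.1], by linarith [hx.2]⟩
  have h4 := mul_le_mul_of_nonneg_left h3 K.coe_nonneg
  rw [abs_one] at h2
  linarith

/-- Continuity of `x log x` up to `0`, evaluated at `x = √s`, where `log √s = (log s)/2`. -/
theorem exists_sqrt_mul_log_bound (T : ℝ) :
    ∃ C : ℝ, 0 < C ∧ ∀ s ∈ Ioc 0 T, √s * |Real.log s| ≤ C := by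
  obtain ⟨C, hC⟩ := (isCompact_Icc (a := (0 : ℝ)) (b := √T)).exists_bound_of_continuousOn
    Real.continuous_mul_log.continuousOn
  refine ⟨2 * |C| + 1, by positivity, fun s hs => ?_⟩
  have h1 := hC (√s) ⟨Real.sqrt_nonneg _, Real.sqrt_le_sqrt hs.2⟩
  rw [Real.log_sqrt hs.1.le, norm_mul, norm_div, Real.norm_eq_abs, Real.norm_eq_abs,
    abs_of_nonneg (Real.sqrt_nonneg _), Real.norm_two] at h1
  have := le_abs_self C
  linarith

variable {T L : ℝ} {α : ℝ → ℝ}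

theorem IsExponent.abs_sub_le (hα : IsExponent T L α) {s t : ℝ} (hs : s ∈ Icc 0 T)
    (ht : t ∈ Icc 0 T) : |α t - α s| ≤ L * |t - s| := by
  have h0 := hα.diff 0 (by norm_num)
  rw [iteratedDerivWithin_zero] at h0
  refine (convex_Icc 0 T).norm_image_sub_le_of_norm_derivWithin_le h0 (fun r hr => ?_) hs ht
  have h1 := hα.bound r hr
  rw [iteratedDerivWithin_one] at h1
  rw [Real.norm_eq_abs]
  have h2 := abs_nonneg (iteratedDerivWithin 2 α (Icc (0 : ℝ) T) r)
  have h3 := abs_nonneg (iteratedDerivWithin 3 α (Icc (0 : ℝ) T) r)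
  linarith

/-- The smooth factor of the integrand of `genId`. -/
def genIdFactor (α : ℝ → ℝ) (s : ℝ) : ℝ :=
  s ^ (α 0 - α s) / (Real.Gamma (α 0 - 1) * Real.Gamma (2 - α s))

theorem genIdFactor_eq {s : ℝ} (hs : 0 < s) : genIdFactor α s
    = (Real.Gamma (α 0 - 1))⁻¹ * (Real.exp ((α 0 - α s) * Real.log s)
      * (Real.Gamma (2 - α s))⁻¹) := by
  rw [genIdFactor, Real.rpow_def_of_pos hs, mul_comm (Real.log s), div_eq_mul_inv, mul_inv]
  ring

/-- Write `s^(α 0 - α s) = exp (p s)` with `p s = (α 0 - α s) log s`. The Lipschitz bound on `α`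
gives `|α 0 - α s| ≤ L s`, which beats the logarithm. Increments of `p` cost `(t - s) (1 + |log t|)`
up to a constant, and the logarithm is traded for `1/√s`. -/
theorem IsExponent.genIdFactor_bound (hα : IsExponent T L α) (hT : 0 < T) :
    ∃ C : ℝ, 0 < C ∧ ∀ s t, 0 < s → s ≤ t → t ≤ T →
      |genIdFactor α s| ≤ C ∧ |genIdFactor α t - genIdFactor α s| ≤ C * ((t - s) / √s) := by
  obtain ⟨K, hK, hΓ⟩ := exists_inv_Gamma_bound
  obtain ⟨C, hC, hlog⟩ := exists_sqrt_mul_log_bound T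
  have hb : 0 < Real.Gamma (α 0 - 1) :=
    Real.Gamma_pos_of_pos (by linarith [(hα.mem 0 ⟨le_rfl, hT.le⟩).1])
  have hL : 0 ≤ L := (add_nonneg (add_nonneg (abs_nonneg _) (abs_nonneg _)) (abs_nonneg _)).trans
    (hα.bound 0 ⟨le_rfl, hT.le⟩)
  set b := (Real.Gamma (α 0 - 1))⁻¹
  have hb' : 0 < b := inv_pos.2 hb
  set M := L * (√T * C)
  let p : ℝ → ℝ := fun s => (α 0 - α s) * Real.log s
  have hα0 : ∀ s ∈ Ioc 0 T, |α 0 - α s| ≤ L * s := fun s hs => by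
    have := hα.abs_sub_le (Ioc_subset_Icc_self hs) ⟨le_rfl, hT.le⟩
    rwa [zero_sub, abs_neg, abs_of_pos hs.1] at this
  have hp : ∀ s ∈ Ioc 0 T, |p s| ≤ M := fun s hs => by
    have h1 := hlog s hs
    have h2 := Real.mul_self_sqrt hs.1.le
    have h3 := Real.sqrt_le_sqrt hs.2
    calc |p s| = |α 0 - α s| * |Real.log s| := abs_mul _ _
      _ ≤ L * s * |Real.log s| := mul_le_mul_of_nonneg_right (hα0 s hs) (abs_nonneg _)
      _ = L * (√s * (√s * |Real.log s|)) := by nth_rw 1 [← h2]; ring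
      _ ≤ L * (√T * C) := by gcongr
  have hsub : ∀ s t, 0 < s → s ≤ t → t ≤ T →
      |p t - p s| ≤ L * (√T + C) * ((t - s) / √s) := fun s t hs hst htT => by
    have ht : 0 < t := hs.trans_le hst
    have hss : 0 < √s := Real.sqrt_pos.2 hs
    have hsT : s ∈ Ioc 0 T := ⟨hs, hst.trans htT⟩
    have e : p t - p s = (α 0 - α s) * (Real.log t - Real.log s)
        + (α s - α t) * Real.log t := by simp only [p]; ring
    have h1 : |Real.log t - Real.log s| ≤ (t - s) / s := by
      rw [← Real.log_div ht.ne' hs.ne', abs_of_nonneg (Real.log_nonneg ((one_le_div hs).2 hst))]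
      refine (Real.log_le_sub_one_of_pos (div_pos ht hs)).trans_eq ?_
      field_simp
    have h2 : |α s - α t| ≤ L * (t - s) := by
      have := hα.abs_sub_le ⟨ht.le, htT⟩ (Ioc_subset_Icc_self hsT)
      rwa [abs_sub_comm s t, abs_of_nonneg (sub_nonneg.2 hst)] at this
    have h3 : |Real.log t| ≤ C / √s := by
      rw [le_div_iff₀ hss, mul_comm]
      exact (mul_le_mul_of_nonneg_right (Real.sqrt_le_sqrt hst) (abs_nonneg _)).trans
        (hlog t ⟨ht, htT⟩)
    have h4 : 1 ≤ √T / √s := (one_le_div hss).2 (Real.sqrt_le_sqrt hsT.2)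
    have hts := sub_nonneg.2 hst
    calc |p t - p s| ≤ |α 0 - α s| * |Real.log t - Real.log s| + |α s - α t| * |Real.log t| := by
          rw [e, ← abs_mul, ← abs_mul]; exact abs_add_le _ _
      _ ≤ L * s * ((t - s) / s) + L * (t - s) * (C / √s) := by
          gcongr
          exact hα0 s hsT
      _ = L * (t - s) * 1 + L * (t - s) * (C / √s) := by
          congr 1
          field_simp
      _ ≤ L * (t - s) * (√T / √s) + L * (t - s) * (C / √s) := by gcongr
      _ = _ := by ring
  have hmem : ∀ s ∈ Ioc 0 T, 2 - α s ∈ Icc (0 : ℝ) 1 := fun s hs => by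
    have := hα.mem s (Ioc_subset_Icc_self hs)
    constructor <;> linarith [this.1, this.2]
  refine ⟨b * (Real.exp M * K) + b * (Real.exp M * (L * (√T + C)) * K
    + Real.exp M * (K * (L * √T))), by positivity, fun s t hs hst htT => ?_⟩
  have ht : 0 < t := hs.trans_le hst
  have hsT : s ∈ Ioc 0 T := ⟨hs, hst.trans htT⟩
  have htT' : t ∈ Ioc 0 T := ⟨ht, htT⟩
  have hss : 0 < √s := Real.sqrt_pos.2 hs
  have hes : Real.exp (p s) ≤ Real.exp M := Real.exp_le_exp.2 ((le_abs_self _).trans (hp s hsT))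
  obtain ⟨hq, hqs⟩ := hΓ _ (hmem t htT') _ (hmem s hsT)
  have hts := sub_nonneg.2 hst
  have hA : 0 ≤ b * (Real.exp M * (L * (√T + C)) * K + Real.exp M * (K * (L * √T))) := by
    positivity
  have hB : 0 ≤ b * (Real.exp M * K) := by positivity
  constructor
  · rw [genIdFactor_eq hs, abs_mul, abs_mul, Real.abs_exp, abs_of_pos hb']
    have : b * (Real.exp (p s) * |(Real.Gamma (2 - α s))⁻¹|) ≤ b * (Real.exp M * K) := by
      have := (hΓ _ (hmem s hsT) _ (hmem s hsT)).1
      gcongr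
    exact this.trans (by linarith)
  · have e : genIdFactor α t - genIdFactor α s
        = b * ((Real.exp (p t) - Real.exp (p s)) * (Real.Gamma (2 - α t))⁻¹
          + Real.exp (p s) * ((Real.Gamma (2 - α t))⁻¹ - (Real.Gamma (2 - α s))⁻¹)) := by
      rw [genIdFactor_eq hs, genIdFactor_eq ht]
      simp only [b, p]
      ring
    have h1 : |Real.exp (p t) - Real.exp (p s)|
        ≤ Real.exp M * (L * (√T + C) * ((t - s) / √s)) :=
      (abs_exp_sub_exp_le ((le_abs_self _).trans (hp t htT'))
        ((le_abs_self _).trans (hp s hsT))).trans (by gcongr; exact hsub s t hs hst htT)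
    have h2 : |(Real.Gamma (2 - α t))⁻¹ - (Real.Gamma (2 - α s))⁻¹|
        ≤ K * (L * √T * ((t - s) / √s)) := by
      refine hqs.trans (mul_le_mul_of_nonneg_left ?_ hK.le)
      have h3 := hα.abs_sub_le (Ioc_subset_Icc_self htT') (Ioc_subset_Icc_self hsT)
      have h4 : 1 ≤ √T / √s := (one_le_div hss).2 (Real.sqrt_le_sqrt hsT.2)
      rw [sub_sub_sub_cancel_left]
      rw [abs_sub_comm s t, abs_of_nonneg hts] at h3
      calc |α s - α t| ≤ L * (t - s) * 1 := by linarith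
        _ ≤ L * (t - s) * (√T / √s) := by gcongr
        _ = _ := by ring
    rw [e, abs_mul, abs_of_pos hb']
    calc b * |(Real.exp (p t) - Real.exp (p s)) * (Real.Gamma (2 - α t))⁻¹
          + Real.exp (p s) * ((Real.Gamma (2 - α t))⁻¹ - (Real.Gamma (2 - α s))⁻¹)|
        ≤ b * (Real.exp M * (L * (√T + C) * ((t - s) / √s)) * K
          + Real.exp M * (K * (L * √T * ((t - s) / √s)))) := by
          refine mul_le_mul_of_nonneg_left ((abs_add_le _ _).trans ?_) hb'.le
          rw [abs_mul, abs_mul, Real.abs_exp]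
          gcongr
      _ = b * (Real.exp M * (L * (√T + C)) * K + Real.exp M * (K * (L * √T)))
          * ((t - s) / √s) := by ring
      _ ≤ _ := by
          refine mul_le_mul_of_nonneg_right (by linarith) (by positivity)

/-- This is the Beta integrand with parameters `2 - a` and `a - 1`, both positive. -/
theorem integrableOn_betaWeight {a : ℝ} (h1 : 1 < a) (h2 : a < 2) :
    IntegrableOn (fun z : ℝ => (1 - z) ^ (a - 2) * z ^ (1 - a)) (Ioo 0 1) volume := by
  have h := (Complex.betaIntegral_convergent (u := ((2 - a : ℝ) : ℂ)) (v := ((a - 1 : ℝ) : ℂ))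
    (by rw [Complex.ofReal_re]; linarith) (by rw [Complex.ofReal_re]; linarith)).norm
  rw [intervalIntegrable_iff_integrableOn_Ioo_of_le zero_le_one] at h
  refine h.congr_fun (fun z hz => ?_) measurableSet_Ioo
  have e : (1 : ℂ) - (z : ℂ) = ((1 - z : ℝ) : ℂ) := by push_cast; rfl
  simp only [norm_mul]
  rw [e, Complex.norm_cpow_eq_rpow_re_of_pos hz.1, Complex.norm_cpow_eq_rpow_re_of_pos
    (sub_pos.2 hz.2), mul_comm]
  congr 2
  · simp; ring
  · simp; ring

theorem genId_eq (t : ℝ) : genId α t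
    = ∫ z in Ioo (0 : ℝ) 1, genIdFactor α (t * z) * ((1 - z) ^ (α 0 - 2) * z ^ (1 - α 0)) := by
  rw [genId, intervalIntegral.integral_of_le zero_le_one, integral_Ioc_eq_integral_Ioo]
  simp only [genIdFactor, mul_assoc]

theorem IsExponent.genId_bound (hα : IsExponent T L α) (hT : 0 < T) :
    ∃ C : ℝ, 0 < C ∧ ∀ s t, 0 < s → s ≤ t → t ≤ T →
      |genId α s| ≤ C ∧ |genId α t - genId α s| ≤ C * ((t - s) / √s) := by
  obtain ⟨C, hC, hφ⟩ := hα.genIdFactor_bound hT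
  obtain ⟨h1, h2⟩ := hα.mem 0 ⟨le_rfl, hT.le⟩
  have hwI := integrableOn_betaWeight h1 h2
  set w : ℝ → ℝ := fun z => (1 - z) ^ (α 0 - 2) * z ^ (1 - α 0)
  have hw : ∀ z ∈ Ioo (0 : ℝ) 1, 0 ≤ w z := fun z hz =>
    mul_nonneg (Real.rpow_nonneg (sub_nonneg.2 hz.2.le) _) (Real.rpow_nonneg hz.1.le _)
  set W := ∫ z in Ioo (0 : ℝ) 1, w z
  have hW : 0 ≤ W := setIntegral_nonneg measurableSet_Ioo hw
  have hcont : ContinuousOn (genIdFactor α) (Ioc 0 T) := by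
    have hαc : ContinuousOn α (Icc 0 T) := by
      have h0 := hα.diff 0 (by norm_num)
      rw [iteratedDerivWithin_zero] at h0
      exact h0.continuousOn
    have hαc' := hαc.mono Ioc_subset_Icc_self
    refine ContinuousOn.div (ContinuousOn.rpow continuousOn_id (continuousOn_const.sub hαc')
      fun s hs => Or.inl hs.1.ne') (continuousOn_const.mul ?_) fun s hs => ?_
    · intro s hs
      have hpos : 0 < 2 - α s := by linarith [(hα.mem s (Ioc_subset_Icc_self hs)).2]
      have := (Real.differentiableAt_Gamma (s := 2 - α s) (fun m => by
        have : (0 : ℝ) ≤ m := m.cast_nonneg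
        linarith)).continuousAt
      exact ContinuousAt.comp_continuousWithinAt (f := fun s => 2 - α s) this
        ((continuousOn_const.sub hαc') s hs)
    · have hpos : 0 < 2 - α s := by linarith [(hα.mem s (Ioc_subset_Icc_self hs)).2]
      exact (mul_pos (Real.Gamma_pos_of_pos (by linarith)) (Real.Gamma_pos_of_pos hpos)).ne'
  have hI : ∀ t ∈ Ioc 0 T, IntegrableOn (fun z => genIdFactor α (t * z) * w z) (Ioo 0 1) volume := by
    intro t ht
    refine Integrable.bdd_mul hwI (c := C) ?_ ?_
    · refine ContinuousOn.aestronglyMeasurable (hcont.comp (by fun_prop) fun z hz => ?_)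
        measurableSet_Ioo
      exact ⟨mul_pos ht.1 hz.1, (mul_le_of_le_one_right ht.1.le hz.2.le).trans ht.2⟩
    · refine (ae_restrict_iff' measurableSet_Ioo).2 (Eventually.of_forall fun z hz => ?_)
      exact (hφ (t * z) (t * z) (mul_pos ht.1 hz.1) le_rfl
        ((mul_le_of_le_one_right ht.1.le hz.2.le).trans ht.2)).1
  refine ⟨C * W + 1, by positivity, fun s t hs hst htT => ?_⟩
  have hts := sub_nonneg.2 hst
  have hss : 0 < √s := Real.sqrt_pos.2 hs
  have hsT : s ∈ Ioc 0 T := ⟨hs, hst.trans htT⟩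
  have htT' : t ∈ Ioc 0 T := ⟨hs.trans_le hst, htT⟩
  constructor
  · rw [genId_eq]
    have : |∫ z in Ioo (0 : ℝ) 1, genIdFactor α (s * z) * w z| ≤ ∫ z in Ioo (0 : ℝ) 1, C * w z := by
      refine (norm_integral_le_integral_norm _).trans (setIntegral_mono_on (hI s hsT).norm
        (hwI.const_mul C) measurableSet_Ioo fun z hz => ?_)
      rw [norm_mul, Real.norm_of_nonneg (hw z hz)]
      exact mul_le_mul_of_nonneg_right (hφ (s * z) (s * z) (mul_pos hs hz.1) le_rfl
        ((mul_le_of_le_one_right hs.le hz.2.le).trans hsT.2)).1 (hw z hz)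
    rw [integral_const_mul] at this
    exact this.trans (by linarith)
  · rw [genId_eq, genId_eq, ← integral_sub (hI t htT') (hI s hsT)]
    have : |∫ z in Ioo (0 : ℝ) 1, (genIdFactor α (t * z) * w z - genIdFactor α (s * z) * w z)|
        ≤ ∫ z in Ioo (0 : ℝ) 1, C * ((t - s) / √s) * w z := by
      refine (norm_integral_le_integral_norm _).trans (setIntegral_mono_on
        ((hI t htT').sub (hI s hsT)).norm (hwI.const_mul _) measurableSet_Ioo fun z hz => ?_)
      rw [Pi.sub_apply, ← sub_mul, norm_mul, Real.norm_of_nonneg (hw z hz)]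
      refine mul_le_mul_of_nonneg_right (((hφ (s * z) (t * z) (mul_pos hs hz.1)
        (mul_le_mul_of_nonneg_right hst hz.1.le)
        ((mul_le_of_le_one_right htT'.1.le hz.2.le).trans htT)).2).trans ?_) (hw z hz)
      refine mul_le_mul_of_nonneg_left ?_ hC.le
      have hz1 : √z ≤ 1 := Real.sqrt_le_one.2 hz.2.le
      have hz0 : 0 < √z := Real.sqrt_pos.2 hz.1
      rw [Real.sqrt_mul hs.le, ← sub_mul]
      -- Rescaling by `z` multiplies the increment by `z` and the singularity by `1/√z`; the net
      -- factor `√z` is at most `1`.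
      calc (t - s) * z / (√s * √z) = (t - s) / √s * (z / √z) := by field_simp
        _ = (t - s) / √s * √z := by rw [Real.div_sqrt]
        _ ≤ (t - s) / √s * 1 := by gcongr
        _ = _ := mul_one _
    rw [integral_const_mul] at this
    refine this.trans ?_
    have : 0 ≤ (t - s) / √s := by positivity
    nlinarith

/-- Near `t` one may assume `x > t/4`, so `√x ≥ √t/2`; this is the source of the factor `2`. -/
theorem IsExponent.genId_lipschitzAt (hα : IsExponent T L α) (hT : 0 < T) :
    ∃ C : ℝ, 0 < C ∧ ∀ t ∈ Ioo 0 T,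
      ∀ᶠ x in 𝓝 t, ‖genId α x - genId α t‖ ≤ C / √t * ‖x - t‖ := by
  obtain ⟨C, hC, h⟩ := hα.genId_bound hT
  refine ⟨C * 2, by positivity, fun t ht => ?_⟩
  have ht4 : t / 4 < t := by linarith [ht.1]
  have hst : 0 < √t := Real.sqrt_pos.2 ht.1
  filter_upwards [Ioo_mem_nhds ht4 ht.2] with x hx
  have hx0 : 0 < x := by linarith [hx.1, ht.1]
  have hsx : 0 < √x := Real.sqrt_pos.2 hx0
  have hhalf : √t / 2 ≤ √x := by
    refine Real.le_sqrt_of_sq_le ?_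
    rw [div_pow, Real.sq_sqrt ht.1.le]
    linarith [hx.1]
  rw [Real.norm_eq_abs, Real.norm_eq_abs]
  rcases le_total x t with hxt | hxt
  · rw [abs_sub_comm, abs_sub_comm x t, abs_of_nonneg (sub_nonneg.2 hxt)]
    refine ((h x t hx0 hxt ht.2.le).2).trans ?_
    have := sub_nonneg.2 hxt
    calc C * ((t - x) / √x) ≤ C * ((t - x) / (√t / 2)) := by gcongr
      _ = C * 2 / √t * (t - x) := by field_simp
  · rw [abs_of_nonneg (sub_nonneg.2 hxt)]
    refine ((h t x ht.1 hxt hx.2.le).2).trans ?_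
    have := sub_nonneg.2 hxt
    calc C * ((x - t) / √t) = C * 1 / √t * (x - t) := by field_simp
      _ ≤ C * 2 / √t * (x - t) := by gcongr; norm_num

theorem IsExponent.isKernel_genId (hα : IsExponent T L α) (hT : 0 < T) :
    IsKernel T (genId α) := by
  obtain ⟨C, hC, h⟩ := hα.genId_bound hT
  obtain ⟨C', -, h'⟩ := hα.genId_lipschitzAt hT
  have hc : ContinuousOn (genId α) (Ioo 0 T) := fun t ht =>
    by
    refine ContinuousAt.continuousWithinAt (tendsto_iff_norm_sub_tendsto_zero.2 ?_)
    refine squeeze_zero' (Eventually.of_forall fun _ => norm_nonneg _) (h' t ht) ?_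
    have : Continuous fun x => C' / √t * ‖x - t‖ := by fun_prop
    simpa using this.tendsto t
  change IntegrableOn _ _ _
  rw [integrableOn_Ioc_iff_integrableOn_Ioo]
  refine Integrable.of_bound (C := C) (hc.aestronglyMeasurable measurableSet_Ioo) ?_
  exact (ae_restrict_iff' measurableSet_Ioo).2 (Eventually.of_forall fun s hs =>
    (h s s hs.1 le_rfl hs.2.le).1)

theorem IsExponent.isKernel_deriv_genId (hα : IsExponent T L α) (hT : 0 < T) :
    IsKernel T (deriv (genId α)) := by
  obtain ⟨C, hC, h⟩ := hα.genId_lipschitzAt hT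
  change IntegrableOn _ _ _
  rw [integrableOn_Ioc_iff_integrableOn_Ioo]
  have hb : IntegrableOn (fun t : ℝ => C * t ^ (-(1 / 2) : ℝ)) (Ioo 0 T) volume := by
    have := (intervalIntegral.intervalIntegrable_rpow' (a := 0) (b := T) (r := -(1 / 2))
      (by norm_num)).const_mul C
    rwa [intervalIntegrable_iff_integrableOn_Ioo_of_le hT.le] at this
  refine Integrable.mono' hb (measurable_deriv _).aestronglyMeasurable ?_
  refine (ae_restrict_iff' measurableSet_Ioo).2 (Eventually.of_forall fun t ht => ?_)
  rw [Real.rpow_neg ht.1.le, ← Real.sqrt_eq_rpow, ← div_eq_mul_inv]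
  -- The local Lipschitz constant bounds `deriv` at every point: where the derivative fails to
  -- exist, `deriv` is `0`. The majorant `C t^(-1/2)` is integrable.
  exact norm_deriv_le_of_lip' (by positivity) (h t ht)

end GeneralizedIdentity

/-! ### The Dirichlet Laplacian through its resolvent. -/

section DirichletLaplacian

variable {d : ℕ} {Ω : Set (E d)}

theorem gradient_eq_comp (φ : E d → ℝ) :
    gradient φ = (InnerProductSpace.toDual ℝ (E d)).symm ∘ fderiv ℝ φ := rfl

theorem gradient_apply_eq (φ : E d → ℝ) (x : E d) (i : Fin d) :
    gradient φ x i = fderiv ℝ φ x (EuclideanSpace.single i 1) := by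
  rw [← inner_gradient_left, EuclideanSpace.inner_single_right]
  simp

namespace IsTest

theorem zero : IsTest Ω (0 : E d → ℝ) :=
  ⟨contDiff_const, HasCompactSupport.zero, by simp [tsupport]⟩

theorem add {φ ψ : E d → ℝ} (hφ : IsTest Ω φ) (hψ : IsTest Ω ψ) : IsTest Ω (φ + ψ) :=
  ⟨hφ.1.add hψ.1, hφ.2.1.add hψ.2.1, (closure_minimal ((Function.support_add _ _).trans
    (union_subset_union subset_closure subset_closure))
    ((isClosed_tsupport φ).union (isClosed_tsupport ψ))).trans (union_subset hφ.2.2 hψ.2.2)⟩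

theorem const_smul {φ : E d → ℝ} (c : ℝ) (hφ : IsTest Ω φ) : IsTest Ω (c • φ) :=
  ⟨contDiff_const.smul hφ.1, hφ.2.1.smul_left (f := fun _ => c), (closure_mono
    (Function.support_const_smul_subset c φ)).trans hφ.2.2⟩

variable {φ ψ : E d → ℝ} (hφ : IsTest Ω φ)

include hφ

theorem differentiable : Differentiable ℝ φ := hφ.1.differentiable (by simp)

theorem continuous_gradient : Continuous (gradient φ) :=
  (LinearIsometryEquiv.continuous _).comp (hφ.1.continuous_fderiv (by simp))

theorem hasCompactSupport_gradient : HasCompactSupport (gradient φ) := by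
  rw [gradient_eq_comp]
  exact (hφ.2.1.fderiv ℝ).comp_left (map_zero _)

theorem memLp : MemLp φ 2 (volume.restrict Ω) :=
  hφ.1.continuous.memLp_of_hasCompactSupport hφ.2.1 |>.restrict _

theorem memLp_gradient : MemLp (gradient φ) 2 (volume.restrict Ω) :=
  hφ.continuous_gradient.memLp_of_hasCompactSupport hφ.hasCompactSupport_gradient |>.restrict _

theorem eq_zero {x : E d} (hx : x ∉ Ω) : φ x = 0 :=
  image_eq_zero_of_notMem_tsupport fun h => hx (hφ.2.2 h)

/-- Integration by parts for test functions. -/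
theorem integral_mul_gradient (hψ : IsTest Ω ψ) (i : Fin d) :
    ∫ x in Ω, φ x * gradient ψ x i = -∫ x in Ω, gradient φ x i * ψ x := by
  have h0 : ∀ x ∉ Ω, φ x * gradient ψ x i = 0 := fun x hx => by rw [hφ.eq_zero hx, zero_mul]
  have h1 : ∀ x ∉ Ω, gradient φ x i * ψ x = 0 := fun x hx => by rw [hψ.eq_zero hx, mul_zero]
  rw [setIntegral_eq_integral_of_forall_compl_eq_zero h0,
    setIntegral_eq_integral_of_forall_compl_eq_zero h1]
  simp only [gradient_apply_eq]
  have c1 : Continuous fun x => fderiv ℝ φ x (EuclideanSpace.single i 1) :=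
    (hφ.1.continuous_fderiv (by simp)).clm_apply continuous_const
  have c2 : Continuous fun x => fderiv ℝ ψ x (EuclideanSpace.single i 1) :=
    (hψ.1.continuous_fderiv (by simp)).clm_apply continuous_const
  refine integral_mul_fderiv_eq_neg_fderiv_mul_of_integrable ?_ ?_ ?_
    (fun x _ => hφ.differentiable x) fun x _ => hψ.differentiable x
  · exact (c1.mul hψ.1.continuous).integrable_of_hasCompactSupport hψ.2.1.mul_left
  · exact (hφ.1.continuous.mul c2).integrable_of_hasCompactSupport hφ.2.1.mul_right
  · exact (hφ.1.continuous.mul hψ.1.continuous).integrable_of_hasCompactSupport hφ.2.1.mul_right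

end IsTest

/-- Pairs of a function and a vector field, with the Hilbert norm. -/
abbrev PairSpace (Ω : Set (E d)) : Type := WithLp 2 (L2 Ω × L2Field Ω)

/-- Test functions together with their gradients. -/
def testSubmodule (Ω : Set (E d)) : Submodule ℝ (PairSpace Ω) where
  carrier := {p | ∃ φ, IsTest Ω φ ∧ p.fst =ᵐ[volume.restrict Ω] φ
    ∧ p.snd =ᵐ[volume.restrict Ω] gradient φ}
  zero_mem' := ⟨0, IsTest.zero, Lp.coeFn_zero _ _ _, by
    refine (Lp.coeFn_zero _ _ _).trans (Eventually.of_forall fun x => ?_)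
    simp [gradient]⟩
  add_mem' := by
    rintro p q ⟨φ, hφ, h1, h2⟩ ⟨ψ, hψ, h3, h4⟩
    refine ⟨φ + ψ, hφ.add hψ, (Lp.coeFn_add _ _).trans (h1.add h3),
      (Lp.coeFn_add _ _).trans ((h2.add h4).trans (Eventually.of_forall fun x => ?_))⟩
    simp only [gradient, Pi.add_apply]
    rw [fderiv_add hφ.differentiable.differentiableAt hψ.differentiable.differentiableAt, map_add]
  smul_mem' := by
    rintro c p ⟨φ, hφ, h1, h2⟩
    refine ⟨c • φ, hφ.const_smul c, (Lp.coeFn_smul _ _).trans (h1.const_smul c),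
      (Lp.coeFn_smul _ _).trans ((h2.const_smul c).trans (Eventually.of_forall fun x => ?_))⟩
    simp only [gradient, Pi.smul_apply]
    rw [fderiv_const_smul hφ.differentiable.differentiableAt, map_smul]

/-- The test pair of a test function. -/
def IsTest.pair {φ : E d → ℝ} (hφ : IsTest Ω φ) : PairSpace Ω :=
  WithLp.toLp 2 (hφ.memLp.toLp φ, hφ.memLp_gradient.toLp (gradient φ))

theorem IsTest.pair_mem {φ : E d → ℝ} (hφ : IsTest Ω φ) : hφ.pair ∈ testSubmodule Ω :=
  ⟨φ, hφ, hφ.memLp.coeFn_toLp, hφ.memLp_gradient.coeFn_toLp⟩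

theorem inner_eq_integral_mul (v w : L2 Ω) : ⟪v, w⟫ = ∫ x in Ω, v x * w x := by
  rw [L2.inner_def]
  refine integral_congr_ae (Eventually.of_forall fun x => ?_)
  simp [mul_comm]

/-- The space `H¹₀(Ω)`, embedded by `v ↦ (v, ∇v)`. -/
def H10 (Ω : Set (E d)) : Submodule ℝ (PairSpace Ω) := (testSubmodule Ω).topologicalClosure

instance : CompleteSpace (H10 Ω) :=
  (Submodule.isClosed_topologicalClosure _).completeSpace_coe

/-- For fixed `ψ` and `i` the identity is a closed condition on the pair, and on test pairs it is
integration by parts. -/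
theorem hasWeakGradient_of_mem {p : PairSpace Ω} (hp : p ∈ H10 Ω) :
    HasWeakGradient Ω p.fst p.snd := by
  intro ψ hψ i
  have hm : MemLp (fun x => gradient ψ x i) 2 (volume.restrict Ω) := by
    have := hψ.memLp_gradient.inner_const (𝕜 := ℝ) (EuclideanSpace.single i (1 : ℝ))
    refine this.ae_eq (Eventually.of_forall fun x => ?_)
    exact (inner_gradient_left ..).trans (gradient_apply_eq ψ x i).symm
  have hs : MemLp (fun x => ψ x • EuclideanSpace.single i (1 : ℝ)) 2 (volume.restrict Ω) := by
    refine (hψ.1.continuous.smul continuous_const).memLp_of_hasCompactSupport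
      (HasCompactSupport.smul_right hψ.2.1) |>.restrict _
  have e1 : ∀ v : L2 Ω, ∫ x in Ω, v x * gradient ψ x i = ⟪v, hm.toLp _⟫ := fun v => by
    rw [inner_eq_integral_mul]
    refine integral_congr_ae ?_
    filter_upwards [hm.coeFn_toLp] with x hx
    rw [hx]
  have e2 : ∀ G : L2Field Ω, ∫ x in Ω, G x i * ψ x = ⟪G, hs.toLp _⟫ := fun G => by
    rw [L2.inner_def]
    refine integral_congr_ae ?_
    filter_upwards [hs.coeFn_toLp] with x hx
    rw [hx, real_inner_smul_right]
    simp [EuclideanSpace.inner_single_right, mul_comm]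
  rw [e1, e2]
  have hcl : IsClosed {p : PairSpace Ω | ⟪p.fst, hm.toLp _⟫ = -⟪p.snd, hs.toLp _⟫} :=
    isClosed_eq ((WithLp.continuous_fst 2 _ _).inner continuous_const)
      ((WithLp.continuous_snd 2 _ _).inner continuous_const).neg
  refine closure_minimal (fun q hq => ?_) hcl hp
  obtain ⟨φ, hφ, h1, h2⟩ := hq
  rw [mem_ofPred_eq, ← e1, ← e2]
  have := hφ.integral_mul_gradient hψ i
  rw [integral_congr_ae (show (fun x => q.fst x * gradient ψ x i) =ᵐ[volume.restrict Ω]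
    fun x => φ x * gradient ψ x i by filter_upwards [h1] with x hx; rw [hx]), this,
    integral_congr_ae (show (fun x => q.snd x i * ψ x) =ᵐ[volume.restrict Ω]
    fun x => gradient φ x i * ψ x by filter_upwards [h2] with x hx; rw [hx])]

theorem eLpNorm_sub_eq_of_ae_eq {F : Type} [NormedAddCommGroup F] {μ : Measure (E d)}
    {p : Lp F 2 μ} {φ : E d → F} (h : p =ᵐ[μ] φ) (v : Lp F 2 μ) :
    eLpNorm (⇑p - ⇑v) 2 μ = eLpNorm (fun x => v x - φ x) 2 μ := by
  rw [eLpNorm_sub_comm]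
  refine eLpNorm_congr_ae ?_
  filter_upwards [h] with x hx
  rw [Pi.sub_apply, hx]

theorem memH10_iff (v : L2 Ω) (G : L2Field Ω) :
    MemH10 Ω v G ↔ (WithLp.toLp 2 (v, G) : PairSpace Ω) ∈ H10 Ω := by
  constructor
  · rintro ⟨-, φ, hφ, h1, h2⟩
    refine mem_closure_of_tendsto (f := fun n => (hφ n).pair) (b := atTop) ?_
      (Eventually.of_forall fun n => (hφ n).pair_mem)
    refine ((WithLp.prod_continuous_toLp 2 _ _).tendsto (v, G)).comp (Tendsto.prodMk_nhds ?_ ?_)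
    · rw [Lp.tendsto_Lp_iff_tendsto_eLpNorm']
      refine h1.congr fun n => ?_
      exact (eLpNorm_sub_eq_of_ae_eq ((hφ n).memLp.coeFn_toLp) _).symm
    · rw [Lp.tendsto_Lp_iff_tendsto_eLpNorm']
      refine h2.congr fun n => ?_
      exact (eLpNorm_sub_eq_of_ae_eq ((hφ n).memLp_gradient.coeFn_toLp) _).symm
  · intro h
    refine ⟨hasWeakGradient_of_mem h, ?_⟩
    obtain ⟨p, hp, hlim⟩ := mem_closure_iff_seq_limit.1 h
    choose φ hφ h1 h2 using hp
    refine ⟨φ, hφ, ?_, ?_⟩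
    · have := ((WithLp.continuous_fst 2 _ _).tendsto _).comp hlim
      rw [Lp.tendsto_Lp_iff_tendsto_eLpNorm'] at this
      refine this.congr fun n => ?_
      exact eLpNorm_sub_eq_of_ae_eq (h1 n) _
    · have := ((WithLp.continuous_snd 2 _ _).tendsto _).comp hlim
      rw [Lp.tendsto_Lp_iff_tendsto_eLpNorm'] at this
      refine this.congr fun n => ?_
      exact eLpNorm_sub_eq_of_ae_eq (h2 n) _

/-- The resolvent `(1 - A)⁻¹` of the Dirichlet Laplacian. -/
def dirichletResolvent (Ω : Set (E d)) : L2 Ω →L[ℝ] L2 Ω :=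
  (WithLp.fstL 2 ℝ (L2 Ω) (L2Field Ω)).comp ((H10 Ω).starProjection.comp
    ((WithLp.prodContinuousLinearEquiv 2 ℝ (L2 Ω) (L2Field Ω)).symm.toContinuousLinearMap.comp
      (ContinuousLinearMap.inl ℝ (L2 Ω) (L2Field Ω))))

theorem dirichletResolvent_apply (f : L2 Ω) : dirichletResolvent Ω f
    = ((H10 Ω).starProjection (WithLp.toLp 2 (f, 0))).fst := rfl

/-- The weak equation says that `(w, G)` is orthogonal to all pairs `(φ, ∇φ)`. As `(v - w, 0) - (v,
G) = -(w, G)`, this means that `(v, G)` is the orthogonal projection of `(v - w, 0)` onto `H¹₀`,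
i.e. `v = R (v - w)`. -/
theorem isDirichletLaplacian_iff (v w : L2 Ω) :
    IsDirichletLaplacian Ω v w ↔ v = dirichletResolvent Ω (v - w) := by
  have key : ∀ G : L2Field Ω, (∀ φ : E d → ℝ, IsTest Ω φ →
      ∫ x in Ω, ⟪G x, gradient φ x⟫ = -∫ x in Ω, w x * φ x) ↔
      (WithLp.toLp 2 (w, G) : PairSpace Ω) ∈ (H10 Ω)ᗮ := fun G => by
    have e : ∀ (q : PairSpace Ω) (φ : E d → ℝ), q.fst =ᵐ[volume.restrict Ω] φ →
        q.snd =ᵐ[volume.restrict Ω] gradient φ → ⟪q, (WithLp.toLp 2 (w, G) : PairSpace Ω)⟫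
        = (∫ x in Ω, w x * φ x) + ∫ x in Ω, ⟪G x, gradient φ x⟫ := fun q φ h1 h2 => by
      rw [WithLp.prod_inner_apply, real_inner_comm, inner_eq_integral_mul, real_inner_comm,
        L2.inner_def]
      congr 1
      · exact integral_congr_ae (by filter_upwards [h1] with x hx; simp [hx])
      · exact integral_congr_ae (by filter_upwards [h2] with x hx; simp [hx])
    rw [H10, Submodule.orthogonal_closure, Submodule.mem_orthogonal]
    constructor
    · rintro h q ⟨φ, hφ, h1, h2⟩
      rw [e q φ h1 h2, h φ hφ, add_neg_cancel]
    · intro h φ hφ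
      have := h _ hφ.pair_mem
      rw [e hφ.pair φ hφ.memLp.coeFn_toLp hφ.memLp_gradient.coeFn_toLp] at this
      exact eq_neg_of_add_eq_zero_right this
  constructor
  · rintro ⟨G, hG, hw⟩
    have h1 := (key G).1 hw
    have h2 := (memH10_iff v G).1 hG
    have h3 := Submodule.eq_starProjection_of_mem_orthogonal
      (u := (WithLp.toLp 2 (v - w, 0) : PairSpace Ω)) h2 (by
        have := (H10 Ω)ᗮ.neg_mem h1
        convert this using 1
        rw [← WithLp.toLp_sub, ← WithLp.toLp_neg]
        simp)
    rw [dirichletResolvent_apply, h3, WithLp.toLp_fst]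
  · intro h
    set p := (H10 Ω).starProjection (WithLp.toLp 2 (v - w, (0 : L2Field Ω)))
    have hp : p ∈ H10 Ω := Submodule.starProjection_apply_mem _ _
    have hpv : p = WithLp.toLp 2 (v, p.snd) := by
      conv_rhs => rw [h]
      rfl
    refine ⟨p.snd, (memH10_iff _ _).2 (hpv ▸ hp), (key _).2 ?_⟩
    have h1 := (H10 Ω)ᗮ.neg_mem (Submodule.sub_starProjection_mem_orthogonal (K := H10 Ω)
      (WithLp.toLp 2 (v - w, (0 : L2Field Ω))))
    convert h1 using 1
    change _ = -(_ - p)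
    rw [hpv, ← WithLp.toLp_sub, ← WithLp.toLp_neg]
    simp

/-- With `P` the projection onto `H¹₀`, `⟪R f, f⟫ = ‖P (f, 0)‖² ≥ ‖R f‖²`. If `R f = 0` then `P (f,
0) = 0`, so `f` is orthogonal to every test function and vanishes almost everywhere in the open set
`Ω`. -/
theorem isFirmResolvent_dirichletResolvent (hΩ : IsOpen Ω) :
    IsFirmResolvent (dirichletResolvent Ω) := by
  have e : ∀ (f : L2 Ω) (p : PairSpace Ω), ⟪p, (WithLp.toLp 2 (f, 0) : PairSpace Ω)⟫ = ⟪p.fst, f⟫ :=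
    fun f p => by
      rw [WithLp.prod_inner_apply]
      simp
  have h : ∀ f : L2 Ω, ‖(H10 Ω).starProjection (WithLp.toLp 2 (f, (0 : L2Field Ω)))‖ ^ 2
      = ⟪dirichletResolvent Ω f, f⟫ := fun f => by
    rw [dirichletResolvent_apply, ← e, ← real_inner_self_eq_norm_sq,
      Submodule.inner_starProjection_left_eq_right, real_inner_comm]
    congr 1
    exact Submodule.starProjection_eq_self_iff.2 (Submodule.starProjection_apply_mem _ _)
  refine ⟨fun f g => ?_, fun f => ?_, fun f hf => ?_⟩
  · rw [dirichletResolvent_apply, ← e, Submodule.inner_starProjection_left_eq_right,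
      real_inner_comm, e, real_inner_comm, dirichletResolvent_apply]
  · rw [← h, WithLp.prod_norm_sq_eq_of_L2]
    exact le_add_of_nonneg_right (sq_nonneg _)
  · have h0 := h f
    rw [hf, inner_zero_left, sq_eq_zero_iff, norm_eq_zero] at h0
    have h1 : (WithLp.toLp 2 (f, 0) : PairSpace Ω) ∈ (H10 Ω)ᗮ :=
      (Submodule.starProjection_apply_eq_zero_iff _).1 h0
    have hloc : LocallyIntegrableOn f Ω volume :=
      locallyIntegrableOn_of_locallyIntegrable_restrict
        ((Lp.memLp f).locallyIntegrable one_le_two)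
    have h2 := hΩ.ae_eq_zero_of_integral_contDiff_smul_eq_zero hloc fun φ k1 k2 k3 => by
      have hφ : IsTest Ω φ := ⟨k1, k2, k3⟩
      have h4 := (Submodule.mem_orthogonal _ _).1 h1 _
        ((testSubmodule Ω).le_topologicalClosure hφ.pair_mem)
      rw [e, inner_eq_integral_mul] at h4
      rw [← setIntegral_eq_integral_of_forall_compl_eq_zero (s := Ω) fun x hx => by
        rw [hφ.eq_zero hx, zero_smul], ← h4]
      refine integral_congr_ae ?_
      filter_upwards [hφ.memLp.coeFn_toLp] with x hx
      change _ = (hφ.memLp.toLp φ) x * f x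
      rw [hx, smul_eq_mul]
    refine (Lp.eq_zero_iff_ae_eq_zero).2 ?_
    exact (ae_restrict_iff' hΩ.measurableSet).2 h2

end DirichletLaplacian

/-! ### Mild solutions as solutions of the memory equation. -/

section MildSolutions

variable {d : ℕ} {Ω : Set (E d)} {T L : ℝ} {α : ℝ → ℝ}

theorem beta_one (t : ℝ) : beta 1 t = 1 := by
  simp [beta]

theorem conv_beta_one (q : ℝ → ℝ) (t : ℝ) : conv (beta 1) q t = ∫ s in (0 : ℝ)..t, q s := by
  simp [conv, beta_one]

theorem conv_const {X : Type} [NormedAddCommGroup X] [NormedSpace ℝ X] [CompleteSpace X]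
    (k : ℝ → ℝ) (c : X) (t : ℝ) : conv k (fun _ => c) t = (∫ s in (0 : ℝ)..t, k s) • c := by
  rw [conv, intervalIntegral.integral_smul_const,
    intervalIntegral.integral_comp_sub_left (fun s => k s)]
  simp

/-- The density of the datum of the memory equation satisfied by mild solutions. -/
def memoryDensity (hT : 0 ≤ T) {a : ℝ} (ha : 0 < a) (α : ℝ → ℝ) (f : CT T (L2 Ω))
    (u₀ ubar₀ : L2 Ω) (s : ℝ) : L2 Ω :=
  deriv (genId α) s • u₀ + IccExtend hT (convCT hT _ (isKernel_beta ha T hT) f) s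
    + genId α s • ubar₀

theorem integrableOn_memoryDensity (hT : 0 ≤ T) {a : ℝ} (ha : 0 < a) (hg : IsKernel T (genId α))
    (hγ : IsKernel T (deriv (genId α))) (f : CT T (L2 Ω)) (u₀ ubar₀ : L2 Ω) :
    IntegrableOn (memoryDensity hT ha α f u₀ ubar₀) (Ioc 0 T) volume :=
  ((Integrable.smul_const hγ u₀).add (continuous_IccExtend hT _).integrableOn_Ioc).add
    (Integrable.smul_const hg ubar₀)

theorem integral_norm_memoryDensity_le (hT : 0 ≤ T) {a : ℝ} (ha : 0 < a)
    (hg : IsKernel T (genId α)) (hγ : IsKernel T (deriv (genId α))) (f : CT T (L2 Ω))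
    (u₀ ubar₀ : L2 Ω) : ∫ s in Ioc 0 T, ‖memoryDensity hT ha α f u₀ ubar₀ s‖
      ≤ (∫ s in Ioc 0 T, |deriv (genId α) s|) * ‖u₀‖
        + T * ((∫ s in Ioc 0 T, |beta a s|) * ‖f‖) + (∫ s in Ioc 0 T, |genId α s|) * ‖ubar₀‖ := by
  have h1 : IntegrableOn (fun s => |deriv (genId α) s| * ‖u₀‖) (Ioc 0 T) volume :=
    (Integrable.abs hγ).mul_const _
  have h2 : IntegrableOn (fun _ : ℝ => (∫ s in Ioc 0 T, |beta a s|) * ‖f‖) (Ioc 0 T) volume :=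
    integrableOn_const (by simp)
  have h3 : IntegrableOn (fun s => |genId α s| * ‖ubar₀‖) (Ioc 0 T) volume :=
    (Integrable.abs hg).mul_const _
  have h := setIntegral_mono_on (integrableOn_memoryDensity hT ha hg hγ f u₀ ubar₀).norm
    ((h1.add h2).add h3) measurableSet_Ioc fun s _ => show
      ‖memoryDensity hT ha α f u₀ ubar₀ s‖ ≤ |deriv (genId α) s| * ‖u₀‖
        + (∫ s in Ioc 0 T, |beta a s|) * ‖f‖ + |genId α s| * ‖ubar₀‖ by
    refine norm_add₃_le.trans ?_
    rw [norm_smul, norm_smul, Real.norm_eq_abs, Real.norm_eq_abs]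
    gcongr
    exact (norm_IccExtend_le hT _ s).trans (norm_convCT_le hT _ f)
  refine h.trans (le_of_eq ?_)
  rw [integral_add' (h1.add h2) h3, integral_add' h1 h2, integral_mul_const, setIntegral_const,
    integral_mul_const, smul_eq_mul, Real.volume_real_Ioc_of_le hT, sub_zero]

/-- The datum collects `u₀` with the primitives of `g' u₀`, `β_a * f` and `g ū₀`. The existential
over `A V` is removed by the resolvent identity `V = R (V - w)`, after which the equation has been
multiplied by `R`. -/
theorem isMildSolution_iff (hT : 0 < T) {κ : ℝ} (hκ : 0 < κ) (ha : 0 < α 0 - 1)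
    (hg : IsKernel T (genId α)) (hγ : IsKernel T (deriv (genId α))) (f : CT T (L2 Ω))
    (u₀ ubar₀ : L2 Ω) (u : CT T (L2 Ω)) : IsMildSolution hT.le κ α f u₀ ubar₀ u ↔
      IsMemorySolution hT.le (dirichletResolvent Ω) κ
        (isKernel_beta (by linarith : 0 < 1 + (α 0 - 1)) T hT.le) hγ
        (datum hT.le u₀ _ (integrableOn_memoryDensity hT.le ha hg hγ f u₀ ubar₀)) u := by
  set R := dirichletResolvent Ω
  set G := datum hT.le u₀ _ (integrableOn_memoryDensity hT.le ha hg hγ f u₀ ubar₀)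
  have hα : α 0 = 1 + (α 0 - 1) := by ring
  have hrhs : ∀ t : Icc (0 : ℝ) T, rhsP hT.le α f u₀ ubar₀ u t
      = G t - u₀ - conv (deriv (genId α)) (IccExtend hT.le u) t := fun t => by
    have e1 : conv (beta (α 0)) (IccExtend hT.le f) t = ∫ s in (0 : ℝ)..t,
        IccExtend hT.le (convCT hT.le _ (isKernel_beta ha T hT.le) f) s := by
      rw [← conv_beta_one_add hT.le ha f t.2, ← hα]
    have e2 : conv (deriv (genId α)) (fun s => IccExtend hT.le u s - u₀) t
        = conv (deriv (genId α)) (IccExtend hT.le u) t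
          - (∫ s in (0 : ℝ)..t, deriv (genId α) s) • u₀ := by
      have := congrArg (fun q : CT T (L2 Ω) => q t)
        (convCT_sub hT.le hγ u (ContinuousMap.const _ u₀))
      rw [← conv_const]
      exact this
    have i1 := intervalIntegrable_of_mem (Integrable.smul_const hγ u₀) t.2
    have i2 := (continuous_IccExtend hT.le
      (convCT hT.le _ (isKernel_beta ha T hT.le) f)).intervalIntegrable (μ := volume) 0 t
    have i3 := intervalIntegrable_of_mem (Integrable.smul_const hg ubar₀) t.2
    have e3 : G t = u₀ + ∫ s in (0 : ℝ)..t, (deriv (genId α) s • u₀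
        + IccExtend hT.le (convCT hT.le _ (isKernel_beta ha T hT.le) f) s
        + genId α s • ubar₀) := rfl
    rw [rhsP, e1, e2, e3, conv_beta_one, intervalIntegral.integral_add (i1.add i2) i3,
      intervalIntegral.integral_add i1 i2, intervalIntegral.integral_smul_const,
      intervalIntegral.integral_smul_const]
    abel
  have hpt : ∀ t : Icc (0 : ℝ) T, (∃ w : L2 Ω,
      IsDirichletLaplacian Ω (conv (beta (α 0)) (IccExtend hT.le u) t) w ∧
        u t - u₀ - κ • w = rhsP hT.le α f u₀ ubar₀ u t) ↔
      R (u t + conv (deriv (genId α)) (IccExtend hT.le u) t - G t)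
        + κ • (conv (beta (1 + (α 0 - 1))) (IccExtend hT.le u) t
          - R (conv (beta (1 + (α 0 - 1))) (IccExtend hT.le u) t)) = 0 := fun t => by
    rw [hrhs t, ← hα]
    set V := conv (beta (α 0)) (IccExtend hT.le u) t
    set X := u t + conv (deriv (genId α)) (IccExtend hT.le u) t - G t
    have hX : ∀ w : L2 Ω, u t - u₀ - κ • w
        = G t - u₀ - conv (deriv (genId α)) (IccExtend hT.le u) t ↔ X = κ • w := fun w => by
      rw [← sub_eq_zero, ← sub_eq_zero (a := X)]
      have : u t - u₀ - κ • w - (G t - u₀ - conv (deriv (genId α)) (IccExtend hT.le u) t)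
          = X - κ • w := by simp only [X]; abel
      rw [this]
    constructor
    · rintro ⟨w, h1, h2⟩
      rw [hX] at h2
      rw [isDirichletLaplacian_iff] at h1
      have h3 : V - R V = -R w := by
        nth_rw 1 [h1]
        rw [map_sub]
        abel
      rw [h2, h3, map_smul, smul_neg, add_neg_cancel]
    · intro h
      -- The equation itself forces `w = κ⁻¹ X`; only membership in the graph of `A` remains to be
      -- read off from `h`.
      refine ⟨κ⁻¹ • X, ?_, (hX _).2 (smul_inv_smul₀ hκ.ne' X).symm⟩
      rw [isDirichletLaplacian_iff, map_sub, map_smul, eq_neg_of_add_eq_zero_left h, smul_neg,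
        inv_smul_smul₀ hκ.ne']
      abel
  constructor
  · intro h
    ext1 t
    exact (hpt t).1 (h t)
  · intro h t
    exact (hpt t).2 (congrArg (fun q : CT T (L2 Ω) => q t) h)

end MildSolutions

end DiffusionWave
end

/-! ### Assembly of existence, uniqueness and the estimate. -/

theorem mainTheorem4 {d : ℕ} (Ω : Set (DiffusionWave.E d)) (hΩ : IsOpen Ω)
    (hΩb : Bornology.IsBounded Ω) (T : ℝ) (hT : 0 < T) (κ : ℝ) (hκ : 0 < κ)
    (L : ℝ) (α : ℝ → ℝ) (hα : DiffusionWave.IsExponent T L α) :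
    ∃ Q : ℝ, 0 < Q ∧
      ∀ (f : DiffusionWave.CT T (DiffusionWave.L2 Ω)) (u₀ ubar₀ : DiffusionWave.L2 Ω),
        (∃! u : DiffusionWave.CT T (DiffusionWave.L2 Ω),
          DiffusionWave.IsMildSolution hT.le κ α f u₀ ubar₀ u) ∧
        ∀ u : DiffusionWave.CT T (DiffusionWave.L2 Ω),
          DiffusionWave.IsMildSolution hT.le κ α f u₀ ubar₀ u →
            ‖u‖ ≤ Q * (‖f‖ + ‖u₀‖ + ‖ubar₀‖) := by
  obtain ⟨h1, h2⟩ := hα.mem 0 ⟨le_rfl, hT.le⟩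
  have ha : 0 < α 0 - 1 := by linarith
  have hg := hα.isKernel_genId hT
  have hγ := hα.isKernel_deriv_genId hT
  obtain ⟨Q, hQ, hwell⟩ := (DiffusionWave.isFirmResolvent_dirichletResolvent hΩ).memory_wellPosed
    hT hκ.le ha (by linarith) hγ
  set Cγ := ∫ s in Ioc 0 T, |deriv (DiffusionWave.genId α) s|
  set Cg := ∫ s in Ioc 0 T, |DiffusionWave.genId α s|
  set Cβ := ∫ s in Ioc 0 T, |DiffusionWave.beta (α 0 - 1) s|
  have hCγ : 0 ≤ Cγ := integral_nonneg fun _ => abs_nonneg _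
  have hCg : 0 ≤ Cg := integral_nonneg fun _ => abs_nonneg _
  have hCβ : 0 ≤ Cβ := integral_nonneg fun _ => abs_nonneg _
  -- The bracket dominates each coefficient in the bound of the datum: `1 + Cγ` for `u₀`, `T Cβ` for
  -- `f` and `Cg` for `ū₀`.
  refine ⟨Q * (1 + Cγ + T * Cβ + Cg), by positivity, fun f u₀ ubar₀ => ?_⟩
  obtain ⟨u, hu, hub⟩ := hwell u₀ _
    (DiffusionWave.integrableOn_memoryDensity hT.le ha hg hγ f u₀ ubar₀)
  have hiff : ∀ u', DiffusionWave.IsMildSolution hT.le κ α f u₀ ubar₀ u' ↔ u' = u := fun u' =>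
    (DiffusionWave.isMildSolution_iff hT hκ ha hg hγ f u₀ ubar₀ u').trans (hu u')
  refine ⟨⟨u, (hiff u).2 rfl, fun u' h => (hiff u').1 h⟩, fun u' h => ?_⟩
  rw [(hiff u').1 h]
  refine hub.trans ?_
  rw [mul_assoc]
  refine mul_le_mul_of_nonneg_left ?_ hQ.le
  have h3 := DiffusionWave.integral_norm_memoryDensity_le hT.le ha hg hγ f u₀ ubar₀
  have n1 := norm_nonneg f
  have n2 := norm_nonneg u₀
  have n3 := norm_nonneg ubar₀
  calc ‖u₀‖ + ∫ s in Ioc 0 T, ‖DiffusionWave.memoryDensity hT.le ha α f u₀ ubar₀ s‖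
      ≤ ‖u₀‖ + (Cγ * ‖u₀‖ + T * (Cβ * ‖f‖) + Cg * ‖ubar₀‖) := add_le_add le_rfl h3
    _ ≤ (1 + Cγ + T * Cβ + Cg) * ‖u₀‖ + (1 + Cγ + T * Cβ + Cg) * ‖f‖
        + (1 + Cγ + T * Cβ + Cg) * ‖ubar₀‖ := by
        have k1 : 0 ≤ T * Cβ := by positivity
        have k2 : (1 + Cγ) * ‖u₀‖ ≤ (1 + Cγ + T * Cβ + Cg) * ‖u₀‖ :=
          mul_le_mul_of_nonneg_right (by linarith) n2
        have k3 : T * Cβ * ‖f‖ ≤ (1 + Cγ + T * Cβ + Cg) * ‖f‖ :=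
          mul_le_mul_of_nonneg_right (by linarith) n1
        have k4 : Cg * ‖ubar₀‖ ≤ (1 + Cγ + T * Cβ + Cg) * ‖ubar₀‖ :=
          mul_le_mul_of_nonneg_right (by linarith) n3
        linarith
    _ = _ := by ring
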